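/- Let $p>7$ and $\ell\neq p$ be primes, let $k$ be an algebraic closure of $\mathbb{F}_p$, and fix a non-trivial additive character $\psi:\mathbb{F}_p\to\overline{\mathbb{Q}}_\ell^*$. Let $S\subset\mathbb{P}^1(k)$ be a finite set, $U=\mathbb{P}^1_k\setminus S$, and let $\mathcal{L}$ be an irreducible rigid $\ell$-adic local system of rank $7$ on $U$, that is, an irreducible continuous representation $\rho:\pi_1^{\text{ét}}(U)\to\mathrm{GL}_7(\overline{\mathbb{Q}}_\ell)$ which is determined up to isomorphism by the isomorphism classes of its local monodromies $V_x=\rho|_{I_x}$, $x\in S$. Suppose that the monodromy group of $\mathcal{L}$ (the Zariski closure of the image of $\rho$) is $G_2(\overline{\mathbb{Q}}_\ell)$ in its standard $7$-dimensional representation, up to a change of basis, and that all non-zero slopes of all $V_x$, $x\in S$, have numerator $1$, i.e. are of the form $1/d$ with an integer $d\geq 1$ (slopes are taken with respect to the upper numbering filtration of the inertia group $I=\mathrm{Gal}(k((t))^{\mathrm{sep}}/k((t)))$). Let $x\in S$ and let $\varphi\in u^{-1}k[u^{-1}]$ be a polynomial whose pole order (its degree in $u^{-1}$) is not divisible by $p$;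 in particular $\varphi\neq 0$. Suppose that $\varphi$ appears in the Levelt–Turrittin-type decomposition of $V_x$, in the sense that for some integer $r\geq 1$ prime to $p$ and some non-zero tame representation $\mathcal{K}$ of $I(r)=\mathrm{Gal}(k((t))^{\mathrm{sep}}/k((u)))$, $u^r=t$, the representation $$[r]_*(\mathcal{L}_\psi(\varphi)\otimes\mathcal{K})=\mathrm{Ind}_{I(r)}^{I}(\mathcal{L}_\psi(\varphi)\otimes\mathcal{K})$$ is a direct summand of $V_x$, where $\mathcal{L}_\psi(\varphi)$ is the Artin–Schreier character $\sigma\mapsto\psi(\sigma(y)-y)$, $y^p-y=\varphi$. Then the pole order of $\varphi$ is $1$ or $2$. -/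

import Mathlib

open Polynomial

noncomputable section

namespace WildG2

/-! ### Galois groups, local fields and tame ramification -/

/-- The absolute Galois group of a field, with the Krull topology. -/
abbrev AbsGal (K : Type*) [Field K] : Type _ :=
  AlgebraicClosure K ≃ₐ[K] AlgebraicClosure K

/-- The inertia group `I`: the absolute Galois group of the local field `k((t))`
(for `k` algebraically closed the whole Galois group is inertia). -/
abbrev Inertia (k : Type*) [Field k] : Type _ := AbsGal (LaurentSeries k)

/-- The uniformizer `t` of `k((t))`. -/
def unif (k : Type*) [Field k] : LaurentSeries k := HahnSeries.single 1 1

/-- The uniformizer `t`, viewed in the algebraic closure of `k((t))`. -/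
def unifCl (k : Type*) [Field k] : AlgebraicClosure (LaurentSeries k) :=
  algebraMap (LaurentSeries k) _ (unif k)

/-- The maximal tamely ramified extension of `k((t))` (for `k` algebraically closed of
characteristic `p`): it is generated by all `n`-th roots of `t`, `n` prime to `p`. -/
def tameClosure (k : Type*) [Field k] (p : ℕ) :
    IntermediateField (LaurentSeries k) (AlgebraicClosure (LaurentSeries k)) :=
  IntermediateField.adjoin _ {u | ∃ n : ℕ, n.Coprime p ∧ u ^ n = unifCl k}

/-- The wild ramification subgroup `P` of the inertia group. -/
def wildInertia (k : Type*) [Field k] (p : ℕ) : Subgroup (Inertia k) :=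
  (tameClosure k p).fixingSubgroup

/-- For `u ^ r = t`, the open subgroup `I(r)` of the inertia group `I` belonging to `k((u))`. -/
def rootSubgroup (k : Type*) [Field k] (u : AlgebraicClosure (LaurentSeries k)) :
    Subgroup (Inertia k) :=
  (IntermediateField.adjoin (LaurentSeries k) {u}).fixingSubgroup

/-! ### Upper numbering filtration and slopes -/

/-- The lower ramification group `G_i` of a finite Galois extension `L` of `k((t))`: the
automorphisms acting trivially on `O_L / m_L ^ (i + 1)`.  Here `O_L` is the integral closure of
`k[[t]]` in `L`, a local ring, and its maximal ideal `m_L` is written as its Jacobson radical. -/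
def lowerRam {k : Type*} [Field k]
    (L : IntermediateField (LaurentSeries k) (AlgebraicClosure (LaurentSeries k))) (i : ℕ) :
    Set (L ≃ₐ[LaurentSeries k] L) :=
  {σ | ∀ x : integralClosure (PowerSeries k) L,
    ∃ z ∈ (⊥ : Ideal (integralClosure (PowerSeries k) L)).jacobson ^ (i + 1),
      (z : L) = σ (x : L) - (x : L)}

/-- The Herbrand function `x ↦ ∫₀ˣ ds / [G_0 : G_s]` (for `x ≥ 0`, where `G_s = G_⌈s⌉`), written
out as the integral of a step function. -/
def herbrand {k : Type*} [Field k]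
    (L : IntermediateField (LaurentSeries k) (AlgebraicClosure (LaurentSeries k))) (x : ℝ) : ℝ :=
  ((∑ i ∈ Finset.range ⌊x⌋₊, (Nat.card (lowerRam L (i + 1)) : ℝ)) +
      (x - ⌊x⌋₊) * (Nat.card (lowerRam L (⌊x⌋₊ + 1)) : ℝ)) / (Nat.card (lowerRam L 0) : ℝ)

/-- The upper numbering ramification group `G^y`, `y ≥ 0`, of a finite Galois extension of
`k((t))`: it is `G_x` for the unique `x ≥ 0` whose image under the Herbrand function is `y`. -/
def upperRamFin {k : Type*} [Field k]
    (L : IntermediateField (LaurentSeries k) (AlgebraicClosure (LaurentSeries k))) (y : ℝ) :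
    Set (L ≃ₐ[LaurentSeries k] L) :=
  {σ | ∃ x : ℝ, 0 ≤ x ∧ herbrand L x = y ∧ σ ∈ lowerRam L ⌈x⌉₊}

/-- The upper numbering ramification group `I^(y)`, `y ≥ 0`, of the inertia group: the inverse
limit of the groups `Gal(L / k((t)))^y` over all finite Galois extensions `L` of `k((t))`. -/
def upperRam (k : Type*) [Field k] (y : ℝ) : Set (Inertia k) :=
  {σ | ∀ (L : IntermediateField (LaurentSeries k) (AlgebraicClosure (LaurentSeries k)))
    [FiniteDimensional (LaurentSeries k) L] [IsGalois (LaurentSeries k) L],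
    AlgEquiv.restrictNormalHom L σ ∈ upperRamFin L y}

/-- The slopes of a representation `V` of the inertia group.  In the slope decomposition
`V = ⨁ V(y)` one has `V(0) = V^P`, while for `y > 0` the group `I^(y)` has no non-zero invariants
on `V(y)` and acts trivially on `V(x)` for all `x < y`.  Therefore `V^{I^(y)} = ⨁_{x < y} V(x)` and
`V^{I^(y+)} = ⨁_{x ≤ y} V(x)`, and `V(y) ≠ 0` if and only if the second space is larger. -/
def IsSlope {k : Type*} [Field k] (p : ℕ) {F V : Type*} [Field F] [AddCommGroup V] [Module F V]
    (ρ : Representation F (Inertia k) V) (y : ℝ) : Prop :=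
  (y = 0 ∧ ∃ v : V, v ≠ 0 ∧ ∀ σ ∈ wildInertia k p, ρ σ v = v) ∨
  (0 < y ∧ ∃ v : V, (∀ x : ℝ, y < x → ∀ σ ∈ upperRam k x, ρ σ v = v) ∧
    ∃ σ ∈ upperRam k y, ρ σ v ≠ v)

/-! ### Representations with values in `GL_n` -/

/-- The linear representation on `Fⁿ` given by a homomorphism to `GL_n(F)`. -/
def toRep {F : Type*} [Field F] {G : Type*} [Group G] {n : ℕ} (ρ : G →* GL (Fin n) F) :
    Representation F G (Fin n → F) :=
  ((Matrix.toLinAlgEquiv' : Matrix (Fin n) (Fin n) F ≃ₐ[F] _) :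
    Matrix (Fin n) (Fin n) F →* ((Fin n → F) →ₗ[F] (Fin n → F))).comp
    ((Units.coeHom (Matrix (Fin n) (Fin n) F)).comp ρ)

theorem toRep_apply {F : Type*} [Field F] {G : Type*} [Group G] {n : ℕ} (ρ : G →* GL (Fin n) F)
    (g : G) (v : Fin n → F) :
    toRep ρ g v = (ρ g : Matrix (Fin n) (Fin n) F).mulVec v := rfl

/-- The tensor product `χ ⊗ ρ` of a character and a representation. -/
def twist {F : Type*} [Field F] {G V : Type*} [Group G] [AddCommGroup V] [Module F V]
    (χ : G →* F) (ρ : Representation F G V) : Representation F G V where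
  toFun g := χ g • ρ g
  map_one' := by simp
  map_mul' g h := by
    rw [map_mul, map_mul, smul_mul_smul_comm]

/-- `E` is a direct summand of `V` as a representation. -/
def IsDirectSummand {F G E V : Type*} [Field F] [Group G] [AddCommGroup E] [Module F E]
    [AddCommGroup V] [Module F V] (ε : Representation F G E) (ρ : Representation F G V) : Prop :=
  ∃ (i : Representation.IntertwiningMap ε ρ) (q : Representation.IntertwiningMap ρ ε),
    ∀ e : E, q (i e) = e

/-! ### Artin-Schreier characters and the objects `[r]_* (L_ψ(φ) ⊗ K)` -/

theorem exists_asRoot {E : Type*} [Field E] [IsAlgClosed E] {p : ℕ} (hp : 1 < p) (a : E) :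
    ∃ y : E, y ^ p - y = a := by
  have hd : (X ^ p - X - C a : E[X]).degree = p := by
    have h1 : (X ^ p - X - C a : E[X]) = X ^ p - (X + C a) := by ring
    rw [h1, degree_sub_eq_left_of_degree_lt]
    · simp
    · rw [degree_X_add_C, degree_X_pow]
      exact_mod_cast hp
  obtain ⟨y, hy⟩ := IsAlgClosed.exists_root (X ^ p - X - C a : E[X]) (by
    rw [hd]; exact_mod_cast (by omega : p ≠ 0))
  refine ⟨y, ?_⟩
  simpa [IsRoot, sub_eq_zero] using hy

/-- A root `y` of the Artin-Schreier equation `y ^ p - y = a`. -/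
def asRoot {E : Type*} [Field E] [IsAlgClosed E] (p : ℕ) [hp : Fact p.Prime] (a : E) : E :=
  (exists_asRoot hp.out.one_lt a).choose

theorem asRoot_spec {E : Type*} [Field E] [IsAlgClosed E] (p : ℕ) [hp : Fact p.Prime] (a : E) :
    asRoot p a ^ p - asRoot p a = a :=
  (exists_asRoot hp.out.one_lt a).choose_spec

theorem exists_primeField {E : Type*} [Field E] (p : ℕ) [hp : Fact p.Prime] [Algebra (ZMod p) E]
    (z : E) (hz : z ^ p = z) : ∃ c : ZMod p, algebraMap (ZMod p) E c = z := by
  have hs : (X ^ p - X : (ZMod p)[X]).Splits := by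
    have h := FiniteField.roots_X_pow_card_sub_X (ZMod p)
    rw [ZMod.card] at h
    rw [splits_iff_card_roots, h, FiniteField.X_pow_card_sub_X_natDegree_eq _ hp.out.one_lt]
    simp [ZMod.card]
  have hne : (X ^ p - X : (ZMod p)[X]) ≠ 0 :=
    FiniteField.X_pow_card_sub_X_ne_zero _ hp.out.one_lt
  exact hs.mem_range_of_isRoot hne (by simp [IsRoot, hz])

theorem exists_cocycle {K : Type*} [Field K] (p : ℕ) [Fact p.Prime] [Algebra (ZMod p) K]
    (a : AlgebraicClosure K) (σ : AbsGal K) (hσ : σ a = a) :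
    ∃ c : ZMod p, algebraMap (ZMod p) (AlgebraicClosure K) c = σ (asRoot p a) - asRoot p a := by
  apply exists_primeField
  have : CharP (AlgebraicClosure K) p := charP_of_injective_algebraMap
    (algebraMap (ZMod p) (AlgebraicClosure K)).injective p
  have h1 := asRoot_spec p a
  have h2 := congrArg σ h1
  rw [map_sub, map_pow, hσ] at h2
  rw [sub_pow_char]
  linear_combination h2 - h1

/-- The element `σ y - y` of `𝔽_p`, where `y ^ p - y = a` and `σ` fixes `a`. -/
def cocycle {K : Type*} [Field K] (p : ℕ) [Fact p.Prime] [Algebra (ZMod p) K]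
    (a : AlgebraicClosure K) (σ : AbsGal K) (hσ : σ a = a) : ZMod p :=
  (exists_cocycle p a σ hσ).choose

theorem cocycle_spec {K : Type*} [Field K] (p : ℕ) [Fact p.Prime] [Algebra (ZMod p) K]
    (a : AlgebraicClosure K) (σ : AbsGal K) (hσ : σ a = a) :
    algebraMap (ZMod p) (AlgebraicClosure K) (cocycle p a σ hσ) =
      σ (asRoot p a) - asRoot p a :=
  (exists_cocycle p a σ hσ).choose_spec

/-- The Artin-Schreier character `σ ↦ ψ (σ y - y)`, `y ^ p - y = a`, of a subgroup `H` of the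
Galois group that fixes `a`. -/
def asChar {K : Type*} [Field K] {p : ℕ} [Fact p.Prime] [Algebra (ZMod p) K] {F : Type*} [Field F]
    (ψ : AddChar (ZMod p) F) (H : Subgroup (AbsGal K)) (a : AlgebraicClosure K)
    (ha : ∀ σ ∈ H, σ a = a) : H →* F where
  toFun σ := ψ (cocycle p a σ (ha σ σ.2))
  map_one' := by
    have h : cocycle p a ((1 : H) : AbsGal K) (ha _ (1 : H).2) = 0 := by
      apply (algebraMap (ZMod p) (AlgebraicClosure K)).injective
      rw [cocycle_spec]
      simp
    rw [h, AddChar.map_zero_eq_one]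
  map_mul' σ τ := by
    have h : cocycle p a ((σ * τ : H) : AbsGal K) (ha _ (σ * τ).2) =
        cocycle p a σ (ha σ σ.2) + cocycle p a τ (ha τ τ.2) := by
      apply (algebraMap (ZMod p) (AlgebraicClosure K)).injective
      rw [map_add, cocycle_spec, cocycle_spec, cocycle_spec]
      have h1 := cocycle_spec p a (τ : AbsGal K) (ha τ τ.2)
      have h2 := congrArg (σ : AbsGal K) h1
      have h3 : (σ : AbsGal K) (algebraMap (ZMod p) (AlgebraicClosure K)
          (cocycle p a τ (ha τ τ.2))) = algebraMap (ZMod p) (AlgebraicClosure K)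
          (cocycle p a τ (ha τ τ.2)) := by
        rw [IsScalarTower.algebraMap_apply (ZMod p) K (AlgebraicClosure K), AlgEquiv.commutes]
      rw [h3, h1, map_sub] at h2
      simp only [Subgroup.coe_mul, AlgEquiv.mul_apply]
      linear_combination -h2
    rw [h, AddChar.map_add_eq_mul]

/-- The value at `u⁻¹` of a polynomial `φ` over `k`, in the algebraic closure of `k((t))`. -/
def evalInv {k : Type*} [Field k] (u : AlgebraicClosure (LaurentSeries k)) (φ : k[X]) :
    AlgebraicClosure (LaurentSeries k) :=
  φ.eval₂ ((algebraMap (LaurentSeries k) (AlgebraicClosure (LaurentSeries k))).comp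
    (HahnSeries.C : k →+* LaurentSeries k)) u⁻¹

theorem evalInv_fixed {k : Type*} [Field k] (u : AlgebraicClosure (LaurentSeries k)) (φ : k[X]) :
    ∀ σ ∈ rootSubgroup k u, σ (evalInv u φ) = evalInv u φ := by
  intro σ hσ
  have hu : σ u = u :=
    hσ ⟨u, IntermediateField.mem_adjoin_simple_self (LaurentSeries k) u⟩
  let f : AlgebraicClosure (LaurentSeries k) →+* AlgebraicClosure (LaurentSeries k) :=
    RingHomClass.toRingHom (σ : AbsGal (LaurentSeries k))
  have h := Polynomial.hom_eval₂ φ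
    ((algebraMap (LaurentSeries k) (AlgebraicClosure (LaurentSeries k))).comp
      (HahnSeries.C : k →+* LaurentSeries k)) f u⁻¹
  have h1 : f.comp ((algebraMap (LaurentSeries k) (AlgebraicClosure (LaurentSeries k))).comp
      (HahnSeries.C : k →+* LaurentSeries k)) =
      (algebraMap (LaurentSeries k) (AlgebraicClosure (LaurentSeries k))).comp
        (HahnSeries.C : k →+* LaurentSeries k) := by
    ext c
    exact AlgEquiv.commutes σ _
  have h2 : f u⁻¹ = u⁻¹ := by
    change σ u⁻¹ = u⁻¹
    rw [map_inv₀, hu]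
  rw [h1, h2] at h
  exact h

/-- The representation `Ind_{I(r)}^I (L_ψ(φ(1/u)) ⊗ K)` belonging to the sheaf
`[r]_* (L_ψ(φ) ⊗ K)`, where `u ^ r = t` and `K` is given by `κ`.  The push-forward along a finite
covering is the coinduced representation, which is the induced one as the index is finite.
A polynomial `φ` without constant term stands for the element `φ(1/u)` of `u⁻¹k[u⁻¹]`; its degree
is the pole order. -/
def elementary {k : Type*} [Field k] {p : ℕ} [Fact p.Prime] [Algebra (ZMod p) k]
    {F : Type*} [Field F] (ψ : AddChar (ZMod p) F) (u : AlgebraicClosure (LaurentSeries k))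
    (φ : k[X]) {n : ℕ} (κ : rootSubgroup k u →* GL (Fin n) F) :
    Representation F (Inertia k) (Representation.coindV (rootSubgroup k u).subtype
      (twist (asChar ψ (rootSubgroup k u) (evalInv u φ) (evalInv_fixed u φ)) (toRep κ))) :=
  Representation.coind (rootSubgroup k u).subtype
    (twist (asChar ψ (rootSubgroup k u) (evalInv u φ) (evalInv_fixed u φ)) (toRep κ))

/-- `φ` appears in the Levelt-Turrittin-type decomposition of the representation `V` of `I`: for
some `r` prime to `p` and some non-zero tame `K`, the representation `[r]_* (L_ψ(φ) ⊗ K)` is a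
direct summand of `V`.  (In every decomposition of `V` each summand is a direct summand, and neither
a complement of that form nor the indecomposability of `K` is asked for.) -/
def AppearsIn {k : Type*} [Field k] {p : ℕ} [Fact p.Prime] [Algebra (ZMod p) k]
    {F : Type*} [Field F] [TopologicalSpace F] (ψ : AddChar (ZMod p) F) (φ : k[X])
    {V : Type*} [AddCommGroup V] [Module F V] (ρ : Representation F (Inertia k) V) : Prop :=
  ∃ (r : ℕ) (u : AlgebraicClosure (LaurentSeries k)) (n : ℕ)
    (κ : rootSubgroup k u →* GL (Fin n) F),
    r.Coprime p ∧ u ^ r = unifCl k ∧ 0 < n ∧ Continuous κ ∧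
    (∀ σ : rootSubgroup k u, (σ : Inertia k) ∈ wildInertia k p → κ σ = 1) ∧
    IsDirectSummand (elementary ψ u φ κ) ρ

/-! ### Local systems on open subsets of the projective line -/

/-- The expansion of the coordinate function `X` of `ℙ¹` in the local coordinate `t` at a point of
`ℙ¹(k) = k ∪ {∞}`: it is `a + t` at the point `a` and `t⁻¹` at `∞`. -/
def coordAt {k : Type*} [Field k] (x : OnePoint k) : LaurentSeries k :=
  x.elim (unif k)⁻¹ (fun a => HahnSeries.C a + unif k)

theorem algebraMap_eq_C (k : Type*) [Field k] :
    algebraMap k (LaurentSeries k) = HahnSeries.C := by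
  ext1 a
  rw [HahnSeries.algebraMap_apply', PowerSeries.algebraMap_apply,
    Algebra.algebraMap_self_apply, HahnSeries.ofPowerSeries_C]

theorem transcendental_unif (k : Type*) [Field k] : Transcendental k (unif k) := by
  rw [transcendental_iff_injective]
  have h : ∀ q : k[X], aeval (unif k) q = HahnSeries.ofPowerSeries ℤ k (q : PowerSeries k) := by
    intro q
    induction q using Polynomial.induction_on' with
    | add p q hp hq => simp [hp, hq]
    | monomial n a =>
      rw [← C_mul_X_pow_eq_monomial, Polynomial.coe_mul, Polynomial.coe_pow, Polynomial.coe_C,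
        Polynomial.coe_X, map_mul, map_mul, map_pow, map_pow, HahnSeries.ofPowerSeries_X,
        HahnSeries.ofPowerSeries_C, aeval_C, aeval_X, algebraMap_eq_C, unif]
  intro q q' hqq
  rw [h, h] at hqq
  exact Polynomial.coe_injective k (HahnSeries.ofPowerSeries_injective hqq)

theorem transcendental_coordAt {k : Type*} [Field k] (x : OnePoint k) :
    Transcendental k (coordAt x) := by
  induction x using OnePoint.rec with
  | infty =>
    intro h
    exact transcendental_unif k (by simpa [coordAt] using h.inv)
  | coe a =>
    intro h
    have h1 : IsAlgebraic k (algebraMap k (LaurentSeries k) a + unif k) := by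
      rw [algebraMap_eq_C]; exact h
    exact transcendental_unif k (by simpa using h1.sub (isAlgebraic_algebraMap a))

theorem eval_coordAt_injective {k : Type*} [Field k] (x : OnePoint k) :
    Function.Injective (eval₂RingHom (HahnSeries.C : k →+* LaurentSeries k) (coordAt x)) := by
  rw [← algebraMap_eq_C]
  exact transcendental_iff_injective.1 (transcendental_coordAt x)

/-- The embedding of the function field `k(X)` of `ℙ¹` into its completion `k((t))` at `x`. -/
def completionEmb {k : Type*} [Field k] (x : OnePoint k) : RatFunc k →+* LaurentSeries k :=
  IsFractionRing.lift (A := k[X]) (eval_coordAt_injective x)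

theorem completionEmb_X {k : Type*} [Field k] (x : OnePoint k) :
    completionEmb x RatFunc.X = coordAt x := by
  rw [completionEmb, ← RatFunc.algebraMap_X, IsFractionRing.lift_algebraMap]
  simp

/-- An embedding of algebraic closures extending the embedding of `K` into the extension `K'`. -/
def closureEmb (K K' : Type*) [Field K] [Field K'] [Algebra K K'] :
    AlgebraicClosure K →ₐ[K] AlgebraicClosure K' :=
  IsAlgClosed.lift

/-- The homomorphism of absolute Galois groups given by restriction of automorphisms along
`closureEmb`.  Another choice of this embedding changes it by an inner automorphism. -/
def galMap (K K' : Type*) [Field K] [Field K'] [Algebra K K'] : AbsGal K' →* AbsGal K :=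
  letI : Algebra (AlgebraicClosure K) (AlgebraicClosure K') := (closureEmb K K').toAlgebra
  haveI : IsScalarTower K (AlgebraicClosure K) (AlgebraicClosure K') :=
    IsScalarTower.of_algebraMap_eq fun f => ((closureEmb K K').commutes f).symm
  (AlgEquiv.restrictNormalHom (AlgebraicClosure K)).comp (AlgEquiv.restrictScalarsHom K)

theorem closureEmb_galMap (K K' : Type*) [Field K] [Field K'] [Algebra K K'] (σ : AbsGal K')
    (a : AlgebraicClosure K) :
    closureEmb K K' (galMap K K' σ a) = σ (closureEmb K K' a) := by
  let : Algebra (AlgebraicClosure K) (AlgebraicClosure K') := (closureEmb K K').toAlgebra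
  have : IsScalarTower K (AlgebraicClosure K) (AlgebraicClosure K') :=
    IsScalarTower.of_algebraMap_eq fun f => ((closureEmb K K').commutes f).symm
  exact AlgEquiv.restrictNormal_commutes (AlgEquiv.restrictScalars K σ) (AlgebraicClosure K) a

/-- The homomorphism from the inertia group at `x` to the absolute Galois group of `k(X)`. -/
def inertiaMap {k : Type*} [Field k] (x : OnePoint k) : Inertia k →* AbsGal (RatFunc k) :=
  @galMap (RatFunc k) (LaurentSeries k) _ _ (completionEmb x).toAlgebra

/-- An `ℓ`-adic local system of rank `n` on the complement `U` of a finite set `S` in `ℙ¹`: a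
continuous representation of `π₁(U)`, that is, of the absolute Galois group of the function field
`k(X)`, trivial on the inertia groups at all points of `U`. -/
structure LocalSystem (k : Type*) [Field k] (ℓ : ℕ) [Fact ℓ.Prime] (S : Finset (OnePoint k))
    (n : ℕ) where
  toHom : AbsGal (RatFunc k) →* GL (Fin n) (PadicAlgCl ℓ)
  continuous_toHom : Continuous toHom
  unramified : ∀ x ∉ S, ∀ σ : Inertia k, toHom (inertiaMap x σ) = 1

namespace LocalSystem

/-- The representation of the Galois group of the function field on `\overline{ℚ}_ℓ^n`. -/
def rep {k : Type*} [Field k] {ℓ : ℕ} [Fact ℓ.Prime] {S : Finset (OnePoint k)} {n : ℕ}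
    (L : LocalSystem k ℓ S n) :
    Representation (PadicAlgCl ℓ) (AbsGal (RatFunc k)) (Fin n → PadicAlgCl ℓ) :=
  toRep L.toHom

/-- The local monodromy `V_x` at `x`, a representation of the inertia group. -/
def localMonodromy {k : Type*} [Field k] {ℓ : ℕ} [Fact ℓ.Prime] {S : Finset (OnePoint k)} {n : ℕ}
    (L : LocalSystem k ℓ S n) (x : OnePoint k) :
    Representation (PadicAlgCl ℓ) (Inertia k) (Fin n → PadicAlgCl ℓ) :=
  toRep (L.toHom.comp (inertiaMap x))

/-- Rigidity: the isomorphism classes of the local monodromies at the points of `S` determine the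
local system up to isomorphism. -/
def IsRigid {k : Type*} [Field k] {ℓ : ℕ} [Fact ℓ.Prime] {S : Finset (OnePoint k)} {n : ℕ}
    (L : LocalSystem k ℓ S n) : Prop :=
  ∀ L' : LocalSystem k ℓ S n,
    (∀ x ∈ S, Nonempty ((L.localMonodromy x).Equiv (L'.localMonodromy x))) →
      Nonempty (L.rep.Equiv L'.rep)

end LocalSystem

/-! ### The group `G_2` -/

/-- The cross product on the `7`-dimensional space of imaginary octonions, in the basis
`e_0, …, e_6` (indices modulo `7`) with `e_i × e_{i+1} = e_{i+3}`, `e_{i+1} × e_{i+3} = e_i` and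
`e_{i+3} × e_i = e_{i+1}`. -/
def octCross {F : Type*} [Field F] (x y : Fin 7 → F) : Fin 7 → F := fun m =>
  (x (m + 1) * y (m + 3) - x (m + 3) * y (m + 1)) +
  (x (m + 2) * y (m + 6) - x (m + 6) * y (m + 2)) +
  (x (m + 4) * y (m + 5) - x (m + 5) * y (m + 4))

/-- The identity that characterizes cross products in dimension `7`. -/
theorem octCross_octCross {F : Type*} [Field F] (x y : Fin 7 → F) :
    octCross x (octCross x y) = (x ⬝ᵥ y) • x - (x ⬝ᵥ x) • y := by
  ext m
  fin_cases m <;> simp [octCross, dotProduct, Fin.sum_univ_succ] <;> ring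

/-- The group `G_2(F)` in its standard `7`-dimensional representation: the automorphisms of the
octonions, acting on the imaginary octonions. -/
def G2 (F : Type*) [Field F] : Subgroup (GL (Fin 7) F) where
  carrier := {g | ∀ x y, (g : Matrix (Fin 7) (Fin 7) F).mulVec (octCross x y) =
    octCross ((g : Matrix (Fin 7) (Fin 7) F).mulVec x) ((g : Matrix (Fin 7) (Fin 7) F).mulVec y)}
  one_mem' := by simp
  mul_mem' := by
    intro g h hg hh x y
    rw [Units.val_mul, ← Matrix.mulVec_mulVec, ← Matrix.mulVec_mulVec, ← Matrix.mulVec_mulVec,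
      hh, hg]
  inv_mem' := by
    intro g hg x y
    have h : ∀ v : Fin 7 → F, (g : Matrix (Fin 7) (Fin 7) F).mulVec
        (((g⁻¹ : GL (Fin 7) F) : Matrix (Fin 7) (Fin 7) F).mulVec v) = v := by
      intro v
      rw [Matrix.mulVec_mulVec, ← Units.val_mul, mul_inv_cancel, Units.val_one, Matrix.one_mulVec]
    have h' : ∀ v : Fin 7 → F, ((g⁻¹ : GL (Fin 7) F) : Matrix (Fin 7) (Fin 7) F).mulVec
        ((g : Matrix (Fin 7) (Fin 7) F).mulVec v) = v := by
      intro v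
      rw [Matrix.mulVec_mulVec, ← Units.val_mul, inv_mul_cancel, Units.val_one, Matrix.one_mulVec]
    have h2 := hg (((g⁻¹ : GL (Fin 7) F) : Matrix (Fin 7) (Fin 7) F).mulVec x)
      (((g⁻¹ : GL (Fin 7) F) : Matrix (Fin 7) (Fin 7) F).mulVec y)
    rw [h, h] at h2
    rw [← h2, h']

/-- The Zariski closure in `GL_n(F)` of a set of matrices. -/
def zariskiClosure {F : Type*} [Field F] {n : ℕ} (H : Set (GL (Fin n) F)) : Set (GL (Fin n) F) :=
  {g | ∀ f : MvPolynomial (Fin n × Fin n) F,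
    (∀ h ∈ H, MvPolynomial.eval (fun ij => (h : Matrix (Fin n) (Fin n) F) ij.1 ij.2) f = 0) →
      MvPolynomial.eval (fun ij => (g : Matrix (Fin n) (Fin n) F) ij.1 ij.2) f = 0}

/-- The monodromy group of `L`, the Zariski closure of the image of the representation, is `G_2`:
in a suitable basis it is `G_2(\overline{ℚ}_ℓ)` in the standard `7`-dimensional representation. -/
def LocalSystem.HasMonodromyG2 {k : Type*} [Field k] {ℓ : ℕ} [Fact ℓ.Prime]
    {S : Finset (OnePoint k)} (L : LocalSystem k ℓ S 7) : Prop :=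
  ∃ b : GL (Fin 7) (PadicAlgCl ℓ), ∀ g : GL (Fin 7) (PadicAlgCl ℓ),
    g ∈ zariskiClosure (Set.range L.toHom) ↔ b⁻¹ * g * b ∈ G2 (PadicAlgCl ℓ)

end WildG2

end

open Polynomial

noncomputable section

namespace WildG2

/-! ### Finite domains over complete rings are local -/

section Complete

universe w

/-! Let h be the degree of φ in 1/u, with u^r = t. The character of φ has slope h in u, hence slope
h/r over k((t)). This slope occurs in V_x, so it equals some 1/d, which means r = dh. On I^(h/r)
only the leading term of φ matters. For a root of unity ζ with ζ^h = 1, replacing 1/u by ζ/u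
preserves the leading term and changes φ by a polynomial of smaller degree, whose Artin-Schreier
root is fixed by I^(h/r) (`cocycle_conj`; this needs h < p, which holds because h ≤ r ≤ 7 < p).
Since h divides r, inertia realizes all h such substitutions. So an element σ of I^(h/r) at which
the character takes a value ω ≠ 1 has ω as an eigenvalue on h independent vectors of the induced
representation, supported on different cosets of I(r) (`AppearsIn.exists_eigenvectors`).

Here ω is a primitive p-th root of unity, and an element of G₂ has no eigenvalue of order larger
than 4 with multiplicity 3 (`finrank_eigenspace_lt_three`). The reason is a dimension count: the
eigenspaces of ω and 1/ω fill at least 6 of the 7 dimensions, which forces many cross products to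
vanish or to be proportional, and the polarized identity for x × (x × y) gives a contradiction.
Hence h ≤ 2, and h ≠ 0 because p does not divide h.

The remaining work is the ramification theory behind "slope h/r". The rings of integers are totally
ramified discrete valuation rings. The sum of the ramification function over a coset of H is the
valuation of sc - c for a uniformizer c of the fixed field of H (`ramSum_eq_addVal`). This yields
compatibility of the upper numbering with quotients, and, with an explicit c built from u and the
Artin-Schreier root, the upper jump h/r (`ramTot_of_asRoot`). Compactness of the Galois group
transfers it to the absolute Galois group (`exists_mem_upperRam`). -/

theorem isAdicComplete_of_finite {A M : Type w} [CommRing A] [IsNoetherianRing A] (I : Ideal A)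
    [IsAdicComplete I A] [AddCommGroup M] [Module A M] [Module.Finite A M] :
    IsAdicComplete I M := by
  rw [← AdicCompletion.of_bijective_iff]
  have h := AdicCompletion.ofTensorProduct_bijective_of_finite_of_isNoetherian I M
  have hA : Function.Bijective (AdicCompletion.of I A) := AdicCompletion.of_bijective I A
  let e : A ≃ₗ[A] AdicCompletion I A := LinearEquiv.ofBijective _ hA
  have h2 : Function.Bijective ((TensorProduct.lid A M).symm.trans
      (LinearEquiv.rTensor M e)) := LinearEquiv.bijective _
  convert h.comp h2 using 1
  ext1 m
  have h1 : AdicCompletion.of I A 1 = 1 := rfl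
  simp [e, h1]

/-- A domain that is finite over a complete ring `A`, and has finite-dimensional reduction modulo
the ideal, is local. -/
theorem isLocalRing_of_finite {A B : Type w} [CommRing A] [IsNoetherianRing A] (I : Ideal A)
    [I.IsMaximal] [IsAdicComplete I A] [CommRing B] [IsDomain B] [Algebra A B] [Module.Finite A B] :
    IsLocalRing B := by
  have h1 : IsAdicComplete I B := isAdicComplete_of_finite I
  have h2 : IsAdicComplete (I.map (algebraMap A B)) B :=
    (IsAdicComplete.map_algebraMap_iff _ _).2 h1
  set J := I.map (algebraMap A B)
  have hJ : J ≤ (⊥ : Ideal B).jacobson := IsAdicComplete.le_jacobson_bot J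
  have hunit : ∀ x : B, x - 1 ∈ J → IsUnit x := fun x hx => by
    have := (Ideal.mem_jacobson_bot.1 (hJ hx)) 1
    simpa using this
  let := Ideal.Quotient.field I
  have hfin : Module.Finite (A ⧸ I) (B ⧸ J) := inferInstance
  have hart : IsArtinianRing (B ⧸ J) := IsArtinianRing.of_finite (A ⧸ I) (B ⧸ J)
  refine IsLocalRing.of_isUnit_or_isUnit_one_sub_self fun b => ?_
  let q := Ideal.Quotient.mk J
  -- Modulo J the powers of b stabilize, and a₀ = b^m y^m becomes idempotent. Its Hensel lift to the
  -- domain B is 0 or 1: in the first case b^m lies in J and 1 - b is a unit, in the second b is a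
  -- unit.
  obtain ⟨n, y, hy⟩ := IsArtinian.exists_pow_succ_smul_dvd (q b) (1 : B ⧸ J)
  obtain ⟨y, rfl⟩ := Ideal.Quotient.mk_surjective y
  simp only [smul_eq_mul, mul_one] at hy
  have hstep : ∀ j, (q b) ^ (n + j) * (q y) ^ j = (q b) ^ n := by
    intro j
    induction j with
    | zero => simp
    | succ j ih =>
      calc (q b) ^ (n + (j + 1)) * (q y) ^ (j + 1)
          = ((q b) ^ (n + 1) * q y) * ((q b) ^ j * (q y) ^ j) := by ring
        _ = (q b) ^ n * ((q b) ^ j * (q y) ^ j) := by rw [← hy]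
        _ = (q b) ^ (n + j) * (q y) ^ j := by ring
        _ = _ := ih
  -- The exponent n + 1 instead of n makes b divide b^m even if n = 0.
  have hm : (q b) ^ (2 * (n + 1)) * (q y) ^ (n + 1) = (q b) ^ (n + 1) := by
    calc _ = q b * ((q b) ^ (n + (n + 1)) * (q y) ^ (n + 1)) := by ring
      _ = _ := by rw [hstep]; ring
  set m := n + 1
  let a₀ := b ^ m * y ^ m
  have ha₀ : q a₀ * q a₀ = q a₀ := by
    simp only [a₀, map_mul, map_pow]
    calc _ = ((q b) ^ (2 * m) * (q y) ^ m) * (q y) ^ m := by ring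
      _ = _ := by rw [hm]
  have hba : q b ^ m * q a₀ = q b ^ m := by
    simp only [a₀, map_mul, map_pow]
    calc _ = ((q b) ^ (2 * m) * (q y) ^ m) := by ring
      _ = _ := by rw [hm]
  obtain ⟨a, har, haJ⟩ := HenselianRing.is_henselian (R := B) (I := J) (X ^ 2 - X : B[X])
    (by monicity!) a₀ (by
      rw [← Ideal.Quotient.eq_zero_iff_mem]
      simp only [eval_sub, eval_pow, eval_X, map_sub, map_pow]
      change q a₀ ^ 2 - q a₀ = 0
      rw [pow_two, ha₀, sub_self]) (by
      -- The derivative 2a₀ - 1 is its own inverse modulo J, in every characteristic, as a₀ is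
      -- idempotent there.
      refine IsUnit.of_mul_eq_one (Ideal.Quotient.mk J ((X ^ 2 - X : B[X]).derivative.eval a₀)) ?_
      have h2 : q 2 = 2 := map_ofNat q 2
      have h4 : (X ^ 2 - X : B[X]).derivative.eval a₀ = 2 * a₀ - 1 := by
        simp [one_add_one_eq_two]
      rw [h4]
      change q (2 * a₀ - 1) * q (2 * a₀ - 1) = 1
      rw [map_sub, map_mul, map_one, h2]
      linear_combination 4 * ha₀)
  have ha' : q a = q a₀ := by
    rw [← sub_eq_zero, ← map_sub]
    exact Ideal.Quotient.eq_zero_iff_mem.2 haJ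
  have hcase : a = 0 ∨ a = 1 := by
    have : a * (a - 1) = 0 := by
      have h : a ^ 2 - a = 0 := by simpa [IsRoot] using har
      linear_combination h
    rcases mul_eq_zero.1 this with h | h
    · exact Or.inl h
    · exact Or.inr (sub_eq_zero.1 h)
  rcases hcase with rfl | rfl
  · right
    rw [← ha', map_zero, mul_zero] at hba
    have h3 : IsUnit (1 - b ^ m) := by
      apply hunit
      rw [← Ideal.Quotient.eq_zero_iff_mem]
      change q _ = 0
      simp [← hba]
    exact isUnit_of_dvd_unit (by simpa using sub_dvd_pow_sub_pow 1 b m) h3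
  · left
    rw [map_one] at ha'
    have h3 : IsUnit a₀ := by
      apply hunit
      rw [← Ideal.Quotient.eq_zero_iff_mem]
      change q _ = 0
      rw [map_sub, ← ha', map_one, sub_self]
    exact isUnit_of_dvd_unit ((dvd_pow_self b (by simp [m])).mul_right _) h3


end Complete

/-! ### Rings of integers of finite extensions of k((t)): total ramification -/

section TotallyRamified

open IsLocalRing
open IsDiscreteValuationRing hiding maximalIdeal

universe w

variable {k L : Type w} [Field k] [Field L] [Algebra (LaurentSeries k) L]
  [Algebra (PowerSeries k) L] [IsScalarTower (PowerSeries k) (LaurentSeries k) L]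
  [FiniteDimensional (LaurentSeries k) L] [Algebra.IsSeparable (LaurentSeries k) L]

instance : Module.Finite (PowerSeries k) (integralClosure (PowerSeries k) L) :=
  IsIntegralClosure.finite (PowerSeries k) (LaurentSeries k) L _

instance isMaximal_span_X (k : Type*) [Field k] :
    (Ideal.span {PowerSeries.X} : Ideal (PowerSeries k)).IsMaximal := by
  rw [← PowerSeries.maximalIdeal_eq_span_X]
  infer_instance

instance : IsLocalRing (integralClosure (PowerSeries k) L) :=
  isLocalRing_of_finite (Ideal.span {PowerSeries.X} : Ideal (PowerSeries k))

theorem injective_algebraMap_integralClosure :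
    Function.Injective (algebraMap (PowerSeries k) (integralClosure (PowerSeries k) L)) := by
  have h : Function.Injective (algebraMap (PowerSeries k) L) := by
    rw [IsScalarTower.algebraMap_eq (PowerSeries k) (LaurentSeries k) L]
    exact (algebraMap (LaurentSeries k) L).injective.comp
      (IsFractionRing.injective (PowerSeries k) (LaurentSeries k))
  rw [IsScalarTower.algebraMap_eq (PowerSeries k) (integralClosure (PowerSeries k) L) L,
    RingHom.coe_comp] at h
  exact h.of_comp

instance : IsLocalHom (algebraMap (PowerSeries k) (integralClosure (PowerSeries k) L)) :=
  (algebraMap_isIntegral_iff.2 inferInstance).isLocalHom injective_algebraMap_integralClosure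

theorem algebraMap_X_mem_maximalIdeal :
    algebraMap (PowerSeries k) (integralClosure (PowerSeries k) L) PowerSeries.X ∈
      maximalIdeal (integralClosure (PowerSeries k) L) := by
  rw [mem_maximalIdeal, mem_nonunits_iff, isUnit_map_iff]
  exact PowerSeries.X_prime.not_isUnit

instance : IsDiscreteValuationRing (integralClosure (PowerSeries k) L) := by
  have h1 : IsDedekindDomain (integralClosure (PowerSeries k) L) :=
    integralClosure.isDedekindDomain (PowerSeries k) (LaurentSeries k) L
  have h2 : ¬ IsField (integralClosure (PowerSeries k) L) := by
    intro h
    have := (IsLocalRing.isField_iff_maximalIdeal_eq.1 h)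
    have h3 := algebraMap_X_mem_maximalIdeal (k := k) (L := L)
    rw [this, Ideal.mem_bot, ← map_zero (algebraMap (PowerSeries k) _)] at h3
    exact PowerSeries.X_ne_zero (injective_algebraMap_integralClosure h3)
  exact ((IsDiscreteValuationRing.TFAE _ h2).out 2 0).1 h1

/-- The residue field of a finite separable extension of `k((t))` is `k`. -/
theorem exists_C_sub_mem [IsAlgClosed k] (b : integralClosure (PowerSeries k) L) :
    ∃ a : k, b - algebraMap (PowerSeries k) (integralClosure (PowerSeries k) L) (PowerSeries.C a) ∈
      maximalIdeal (integralClosure (PowerSeries k) L) := by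
  let f : PowerSeries k →+* ResidueField (integralClosure (PowerSeries k) L) :=
    (residue (integralClosure (PowerSeries k) L)).comp
      (algebraMap (PowerSeries k) (integralClosure (PowerSeries k) L))
  let g : k →+* ResidueField (integralClosure (PowerSeries k) L) := f.comp PowerSeries.C
  -- X dies in the residue field, so the residue field is integral over the constants k, which are
  -- algebraically closed.
  have hf : f = g.comp PowerSeries.constantCoeff := by
    ext1 a
    change f a = f (PowerSeries.C (PowerSeries.constantCoeff a))
    rw [← sub_eq_zero, ← map_sub]
    have h : PowerSeries.X ∣ a - PowerSeries.C (PowerSeries.constantCoeff a) := by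
      rw [PowerSeries.X_dvd_iff]; simp
    obtain ⟨c, hc⟩ := h
    rw [hc]
    change residue (integralClosure (PowerSeries k) L) _ = 0
    rw [residue_eq_zero_iff, map_mul]
    exact Ideal.mul_mem_right _ _ algebraMap_X_mem_maximalIdeal
  have hfi : f.IsIntegral := (algebraMap_isIntegral_iff.2 inferInstance).trans _ _
    (RingHom.isIntegral_of_surjective _ residue_surjective)
  have hg : g.IsIntegral := RingHom.IsIntegral.tower_top _ _ (hf ▸ hfi)
  obtain ⟨a, ha⟩ := (IsAlgClosed.ringHom_bijective_of_isIntegral g hg).2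
    (residue (integralClosure (PowerSeries k) L) b)
  refine ⟨a, ?_⟩
  rw [← residue_eq_zero_iff, map_sub, ← ha]
  exact sub_self _

variable (k L) in
theorem exists_addVal_X : ∃ e : ℕ, 0 < e ∧ addVal (integralClosure (PowerSeries k) L)
    (algebraMap (PowerSeries k) _ PowerSeries.X) = e := by
  have h0 : algebraMap (PowerSeries k) (integralClosure (PowerSeries k) L) PowerSeries.X ≠ 0 := by
    rw [← map_zero (algebraMap (PowerSeries k) _)]
    exact injective_algebraMap_integralClosure.ne PowerSeries.X_ne_zero
  obtain ⟨e, he⟩ := ENat.ne_top_iff_exists.1 (mt addVal_eq_top_iff.1 h0)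
  refine ⟨e, ?_, he.symm⟩
  rw [pos_iff_ne_zero]
  rintro rfl
  exact algebraMap_X_mem_maximalIdeal (addVal_eq_zero_iff.1 he.symm)

/-- Since the residue field is k, the digits of a ϖ-adic expansion can be taken constant. After e
digits the remainder is a multiple of ϖ^e, an associate of X, and Nakayama's lemma finishes. -/
theorem span_pow_uniformizer_eq_top [IsAlgClosed k] {ϖ : integralClosure (PowerSeries k) L}
    (hϖ : Irreducible ϖ) {e : ℕ} (he : addVal (integralClosure (PowerSeries k) L)
      (algebraMap (PowerSeries k) _ PowerSeries.X) = e) :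
    Submodule.span (PowerSeries k) (Set.range fun i : Fin e => ϖ ^ (i : ℕ)) = ⊤ := by
  set N := Submodule.span (PowerSeries k) (Set.range fun i : Fin e => ϖ ^ (i : ℕ))
  have key : ∀ (b : integralClosure (PowerSeries k) L) (j : ℕ), j ≤ e →
      ∃ c ∈ N, ∃ d, b = c + ϖ ^ j * d := by
    intro b j
    induction j with
    | zero => exact fun _ => ⟨0, N.zero_mem, b, by simp⟩
    | succ j ih =>
      intro hj
      obtain ⟨c, hc, d, rfl⟩ := ih (by omega)
      obtain ⟨a, ha⟩ := exists_C_sub_mem d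
      rw [hϖ.maximalIdeal_eq, Ideal.mem_span_singleton] at ha
      obtain ⟨d', hd'⟩ := ha
      refine ⟨c + (PowerSeries.C a) • ϖ ^ j, N.add_mem hc (N.smul_mem _
        (Submodule.subset_span ⟨⟨j, hj⟩, rfl⟩)), d', ?_⟩
      rw [Algebra.smul_def]
      linear_combination ϖ ^ j * hd'
  rw [eq_top_iff]
  apply Submodule.le_of_le_smul_of_le_jacobson_bot (I := Ideal.span {PowerSeries.X})
    Module.Finite.fg_top
  · rw [← PowerSeries.maximalIdeal_eq_span_X, IsLocalRing.jacobson_eq_maximalIdeal _ bot_ne_top]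
  · intro b _
    obtain ⟨c, hc, d, rfl⟩ := key b e le_rfl
    refine Submodule.add_mem_sup hc ?_
    rw [← hϖ.addVal_pow, addVal_eq_iff_associated] at he
    obtain ⟨u, hu⟩ := he
    have : ϖ ^ e * d = (PowerSeries.X : PowerSeries k) • (u * d) := by
      rw [Algebra.smul_def, ← hu]; ring
    rw [this]
    exact Submodule.smul_mem_smul (Ideal.mem_span_singleton_self _) trivial

theorem adjoin_uniformizer_eq_top [IsAlgClosed k] {ϖ : integralClosure (PowerSeries k) L}
    (hϖ : Irreducible ϖ) : Algebra.adjoin (PowerSeries k) {ϖ} = ⊤ := by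
  obtain ⟨e, -, he⟩ := exists_addVal_X k L
  rw [← Algebra.toSubmodule_eq_top, eq_top_iff, ← span_pow_uniformizer_eq_top hϖ he,
    Submodule.span_le]
  rintro _ ⟨i, rfl⟩
  exact Subalgebra.pow_mem _ (Algebra.self_mem_adjoin_singleton _ _) _

/-- In a relation, the first coefficient not divisible by X would give a term of valuation i < e,
while all other terms have larger valuation. So X divides every coefficient; dividing the relation
by X and repeating gives divisibility by all powers of X. -/
theorem linearIndependent_pow_uniformizer {ϖ : integralClosure (PowerSeries k) L}
    (hϖ : Irreducible ϖ) {e : ℕ} (he : addVal (integralClosure (PowerSeries k) L)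
      (algebraMap (PowerSeries k) _ PowerSeries.X) = e) :
    LinearIndependent (PowerSeries k) (fun i : Fin e => ϖ ^ (i : ℕ)) := by
  have hX0 : algebraMap (PowerSeries k) (integralClosure (PowerSeries k) L) PowerSeries.X ≠ 0 := by
    rw [← map_zero (algebraMap (PowerSeries k) _)]
    exact injective_algebraMap_integralClosure.ne PowerSeries.X_ne_zero
  rw [← hϖ.addVal_pow, addVal_eq_iff_associated] at he
  obtain ⟨u, hu₀⟩ := he.symm
  have hdvd : ∀ (n : ℕ) (g : Fin e → PowerSeries k), ∑ i, g i • ϖ ^ (i : ℕ) = 0 →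
      ∀ i, PowerSeries.X ^ n ∣ g i := by
    have h1 : ∀ g : Fin e → PowerSeries k, ∑ i, g i • ϖ ^ (i : ℕ) = 0 →
        ∀ i, PowerSeries.X ∣ g i := by
      intro g hg i
      induction i using Fin.strong_induction_on with
      | _ i ih =>
      by_contra hi
      have hu : IsUnit (g i) := by
        rw [PowerSeries.isUnit_iff_constantCoeff, isUnit_iff_ne_zero]
        rwa [PowerSeries.X_dvd_iff] at hi
      have h2 : ∀ j ∈ Finset.univ.erase i, ϖ ^ ((i : ℕ) + 1) ∣ g j • ϖ ^ (j : ℕ) := by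
        intro j hj
        rw [Algebra.smul_def]
        rcases lt_or_gt_of_ne (Finset.ne_of_mem_erase hj) with h | h
        · obtain ⟨c, hc⟩ := ih j h
          rw [hc, map_mul, ← hu₀]
          exact (((pow_dvd_pow ϖ (by omega : (i : ℕ) + 1 ≤ e)).mul_right _).mul_right _).mul_right _
        · exact (pow_dvd_pow ϖ (by exact_mod_cast h)).mul_left _
      rw [← Finset.add_sum_erase _ _ (Finset.mem_univ i)] at hg
      have h3 := (dvd_neg.2 (Finset.dvd_sum h2))
      rw [← eq_neg_of_add_eq_zero_left hg, Algebra.smul_def, pow_succ,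
        mul_comm (algebraMap _ _ _)] at h3
      have h4 := (mul_dvd_mul_iff_left (pow_ne_zero _ hϖ.ne_zero)).1 h3
      exact hϖ.not_isUnit (isUnit_of_dvd_unit h4 (hu.map _))
    intro n
    induction n with
    | zero => simp
    | succ n ih =>
      intro g hg i
      choose g' hg' using h1 g hg
      have h2 : ∑ i, g' i • ϖ ^ (i : ℕ) = 0 := by
        have h3 : algebraMap (PowerSeries k) (integralClosure (PowerSeries k) L) PowerSeries.X *
            ∑ i, g' i • ϖ ^ (i : ℕ) = 0 := by
          rw [← hg, Finset.mul_sum]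
          refine Finset.sum_congr rfl fun i _ => ?_
          rw [hg' i, mul_smul, ← Algebra.smul_def]
        exact (mul_eq_zero.1 h3).resolve_left hX0
      rw [hg' i, pow_succ']
      exact mul_dvd_mul_left _ (ih g' h2 i)
  rw [Fintype.linearIndependent_iff]
  intro g hg i
  ext m
  exact PowerSeries.X_pow_dvd_iff.1 (hdvd (m + 1) g hg i) m (Nat.lt_succ_self m)

/-- The first e powers of a uniformizer form a basis, so the ramification index e is the full
degree. -/
theorem addVal_X_eq_finrank [IsAlgClosed k] :
    addVal (integralClosure (PowerSeries k) L) (algebraMap (PowerSeries k) _ PowerSeries.X) =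
      Module.finrank (LaurentSeries k) L := by
  obtain ⟨e, -, he⟩ := exists_addVal_X k L
  obtain ⟨ϖ, hϖ⟩ := IsDiscreteValuationRing.exists_irreducible (integralClosure (PowerSeries k) L)
  have : Module.IsTorsionFree (PowerSeries k) L := by
    have : FaithfulSMul (PowerSeries k) L := FaithfulSMul.trans (PowerSeries k) (LaurentSeries k) L
    infer_instance
  rw [he, ← IsIntegralClosure.rank (PowerSeries k) (LaurentSeries k) L
    (integralClosure (PowerSeries k) L), Module.finrank_eq_card_basis (Module.Basis.mk
    (linearIndependent_pow_uniformizer hϖ he) (span_pow_uniformizer_eq_top hϖ he).ge),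
    Fintype.card_fin]

end TotallyRamified

/-! ### The ramification function, its sums over cosets, and Herbrand's theorem -/

section RamificationFunction

open IsDiscreteValuationRing hiding maximalIdeal

variable {B : Type*} [CommRing B] [IsDomain B] [IsDiscreteValuationRing B]

theorem addVal_neg (b : B) : addVal B (-b) = addVal B b :=
  (addVal_eq_iff_associated _ _).2 (Associated.refl b).neg_left

theorem addVal_sub_comm (a b : B) : addVal B (a - b) = addVal B (b - a) := by
  rw [← addVal_neg, neg_sub]

theorem addVal_prod {ι : Type*} (s : Finset ι) (f : ι → B) :
    addVal B (∏ i ∈ s, f i) = ∑ i ∈ s, addVal B (f i) := by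
  classical
  induction s using Finset.induction_on with
  | empty => simp
  | insert i s hi ih => rw [Finset.prod_insert hi, Finset.sum_insert hi, addVal_mul, ih]

theorem one_le_addVal_iff {b : B} : 1 ≤ addVal B b ↔ ¬ IsUnit b := by
  rw [Order.one_le_iff_ne_zero, Ne, addVal_eq_zero_iff]

variable {G : Type*} [Group G] [MulSemiringAction G B]

theorem addVal_smul (s : G) (b : B) : addVal B (s • b) = addVal B b := by
  have h : ∀ (s : G) (b : B), addVal B b ≤ addVal B (s • b) := by
    intro s b
    by_cases hb : b = 0
    · simp [hb]
    obtain ⟨ϖ, hϖ⟩ := exists_irreducible B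
    obtain ⟨n, u, rfl⟩ := eq_unit_mul_pow_irreducible hb hϖ
    rw [addVal_def' u hϖ n, smul_mul', smul_pow', addVal_mul, addVal_pow]
    have h1 : 1 ≤ addVal B (s • ϖ) := by
      rw [one_le_addVal_iff]
      intro hu
      apply hϖ.not_isUnit
      have := hu.map (MulSemiringAction.toRingHom G B s⁻¹)
      simpa using this
    calc (n : ℕ∞) = n • (1 : ℕ∞) := by simp
      _ ≤ n • addVal B (s • ϖ) := nsmul_le_nsmul_right h1 n
      _ ≤ _ := le_add_self
  exact le_antisymm (by simpa using h s⁻¹ (s • b)) (h s b)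

variable (B) in
/-- The largest `n` such that `s` acts trivially modulo the `n`-th power of the maximal ideal. -/
def ram (s : G) : ℕ∞ := ⨅ b : B, addVal B (s • b - b)

theorem ram_le (s : G) (b : B) : ram B s ≤ addVal B (s • b - b) := iInf_le _ b

theorem ram_one : ram B (1 : G) = ⊤ := by simp [ram]

theorem ram_mul (s t : G) : min (ram B s) (ram B t) ≤ ram B (s * t) := by
  refine le_iInf fun b => ?_
  have h : (s * t) • b - b = (s • (t • b - b)) + (s • b - b) := by
    rw [mul_smul, smul_sub]; ring
  rw [h]
  refine le_trans (le_min ?_ ?_) addVal_add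
  · rw [addVal_smul]; exact (min_le_right _ _).trans (ram_le t b)
  · exact (min_le_left _ _).trans (ram_le s b)

theorem ram_inv (s : G) : ram B s⁻¹ = ram B s := by
  have h : ∀ s : G, ram B s ≤ ram B s⁻¹ := fun s => le_iInf fun b => by
    have h1 := ram_le (B := B) s (s⁻¹ • b)
    rwa [smul_inv_smul, addVal_sub_comm] at h1
  exact le_antisymm (by simpa using h s⁻¹) (h s)

theorem ram_eq_top_iff [FaithfulSMul G B] {s : G} : ram B s = ⊤ ↔ s = 1 := by
  refine ⟨fun h => ?_, fun h => h ▸ ram_one⟩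
  refine FaithfulSMul.eq_of_smul_eq_smul (α := B) fun b => ?_
  have h1 := ram_le (B := B) s b
  rw [h, top_le_iff, addVal_eq_top_iff, sub_eq_zero] at h1
  rw [h1, one_smul]

/-- The ultrametric inequality applied to t = s₀⁻¹(s₀t): when s₀ has the largest value on its coset,
the value at s₀t is determined by those at t and s₀. -/
theorem ram_mul_of_forall_le {s₀ t : G} (h : ram B (s₀ * t) ≤ ram B s₀) :
    ram B (s₀ * t) = min (ram B t) (ram B s₀) := by
  refine le_antisymm (le_min ?_ h) (min_comm (ram B t) _ ▸ ram_mul s₀ t)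
  have h1 := ram_mul (B := B) s₀⁻¹ (s₀ * t)
  rw [ram_inv, inv_mul_cancel_left, min_eq_right h] at h1
  exact h1

variable (B) in
/-- The sum of the ramification function over the coset `s H`. -/
def ramSum (H : Subgroup G) [Fintype H] (s : G) : ℕ∞ := ∑ t : H, ram B (s * t)

variable (B) in
theorem exists_max_ram (H : Subgroup G) [Fintype H] (s : G) :
    ∃ t₀ : H, ∀ t : H, ram B (s * t) ≤ ram B (s * t₀) := by
  obtain ⟨t₀, -, h⟩ := Finset.exists_max_image Finset.univ (fun t : H => ram B (s * t))
    Finset.univ_nonempty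
  exact ⟨t₀, fun t => h t (Finset.mem_univ t)⟩

theorem sum_min_ram_of_forall_le (H : Subgroup G) [Fintype H] {s₀ : G}
    (h : ∀ t : H, ram B (s₀ * t) ≤ ram B s₀) (m : ℕ∞) :
    ∑ t : H, min (ram B (s₀ * t)) m = ∑ t : H, min (ram B (t : G)) (min (ram B s₀) m) := by
  refine Finset.sum_congr rfl fun t _ => ?_
  rw [ram_mul_of_forall_le (h t), min_assoc]

theorem ramSum_mul (H : Subgroup G) [Fintype H] (s : G) (t₀ : H) :
    ramSum B H (s * t₀) = ramSum B H s := by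
  simp only [ramSum, mul_assoc]
  exact Fintype.sum_equiv (Equiv.mulLeft t₀) _ _ fun t => by simp

theorem sum_min_ram_mul (H : Subgroup G) [Fintype H] (s : G) (t₀ : H) (m : ℕ∞) :
    ∑ t : H, min (ram B (s * t₀ * t)) m = ∑ t : H, min (ram B (s * t)) m := by
  simp only [mul_assoc]
  exact Fintype.sum_equiv (Equiv.mulLeft t₀) _ _ fun t => by simp

/-- If `j` is the maximum of the ramification function on the coset `s H`, the sums of its
truncations at `j` over cosets of `H` are the truncations of the full sums. -/
theorem sum_min_ram_eq_min (H : Subgroup G) [Fintype H] {s₀ : G}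
    (h : ∀ t : H, ram B (s₀ * t) ≤ ram B s₀) (s' : G) :
    ∑ t : H, min (ram B (s' * t)) (ram B s₀) = min (ramSum B H s') (ramSum B H s₀) := by
  -- On a coset with maximum j the full sum is Φ(j) and the sum truncated at m is Φ(min(j, m)).
  -- Being monotone, Φ commutes with minima.
  let Φ : ℕ∞ → ℕ∞ := fun m => ∑ t : H, min (ram B (t : G)) m
  have hmono : Monotone Φ := fun m m' hm => Finset.sum_le_sum fun t _ => min_le_min le_rfl hm
  have hΦ : ∀ s₀ : G, (∀ t : H, ram B (s₀ * t) ≤ ram B s₀) → ramSum B H s₀ = Φ (ram B s₀) := by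
    intro s₀ h
    exact Finset.sum_congr rfl fun t _ => ram_mul_of_forall_le (h t)
  obtain ⟨t₀, ht₀⟩ := exists_max_ram B H s'
  have h' : ∀ t : H, ram B (s' * t₀ * t) ≤ ram B (s' * t₀) := fun t => by
    rw [mul_assoc]; exact ht₀ (t₀ * t)
  rw [← sum_min_ram_mul H s' t₀, sum_min_ram_of_forall_le H h', hΦ s₀ h,
    ← ramSum_mul H s' t₀, hΦ _ h', ← hmono.map_min]

/-- The element c plays the role of a uniformizer of the invariants of H. Write b = a + cb' with a
fixed by G; then sb - b = sc(sb' - b') + (sc - c)b', so moving b costs at least moving c, or the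
question passes to b' with one more factor of positive valuation. -/
theorem addVal_sub_le_of_fixed {H : Subgroup G} {c : B} (hc0 : c ≠ 0) (hcu : ¬ IsUnit c)
    (hc : ∀ t ∈ H, t • c = c)
    (hdvd : ∀ b : B, (∀ t ∈ H, t • b = b) → ¬ IsUnit b → c ∣ b)
    (hres : ∀ b : B, ∃ a : B, (∀ t : G, t • a = a) ∧ ¬ IsUnit (b - a))
    (s : G) {b : B} (hb : ∀ t ∈ H, t • b = b) :
    addVal B (s • c - c) ≤ addVal B (s • b - b) := by
  -- The bound truncated at n is accessible to induction: each step gains the valuation of sc, which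
  -- is at least 1.
  have key : ∀ (n : ℕ) (b : B), (∀ t ∈ H, t • b = b) →
      min (addVal B (s • c - c)) n ≤ addVal B (s • b - b) := by
    intro n
    induction n with
    | zero => intro b _; simp
    | succ n ih =>
      intro b hb
      obtain ⟨a, ha, hab⟩ := hres b
      have h1 : ∀ t ∈ H, t • (b - a) = b - a := fun t ht => by rw [smul_sub, hb t ht, ha]
      obtain ⟨b', hb'⟩ := hdvd _ h1 hab
      have h2 : ∀ t ∈ H, t • b' = b' := fun t ht => by
        have h3 := h1 t ht
        rw [hb', smul_mul', hc t ht] at h3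
        exact mul_left_cancel₀ hc0 h3
      have h3 : s • b - b = s • c * (s • b' - b') + (s • c - c) * b' := by
        have h4 : s • b - b = s • (b - a) - (b - a) := by rw [smul_sub, ha]; ring
        rw [h4, hb', smul_mul']; ring
      rw [h3]
      refine le_trans (le_min ?_ ?_) addVal_add
      · rw [addVal_mul, addVal_smul]
        have h4 : 1 ≤ addVal B c := one_le_addVal_iff.2 hcu
        calc min (addVal B (s • c - c)) ((n + 1 : ℕ) : ℕ∞)
            ≤ 1 + min (addVal B (s • c - c)) n := by
              rw [← min_add_add_left]
              exact min_le_min le_add_self (by push_cast; rw [add_comm])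
          _ ≤ _ := add_le_add h4 (ih b' h2)
      · rw [addVal_mul]
        exact (min_le_left _ _).trans le_self_add
  refine ENat.forall_natCast_le_iff_le.1 fun n hn => ?_
  exact (le_min hn le_rfl).trans (key n b hb)

/-- The ramification function can be computed on a uniformizer. -/
theorem ram_eq_addVal {ϖ : B} (hϖ : Irreducible ϖ)
    (hres : ∀ b : B, ∃ a : B, (∀ t : G, t • a = a) ∧ ¬ IsUnit (b - a)) (s : G) :
    ram B s = addVal B (s • ϖ - ϖ) := by
  refine le_antisymm (ram_le s ϖ) (le_iInf fun b => ?_)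
  refine addVal_sub_le_of_fixed (H := ⊥) hϖ.ne_zero hϖ.not_isUnit ?_ ?_ hres s ?_
  · simp
  · intro b _ hb
    rwa [← Ideal.mem_span_singleton, ← hϖ.maximalIdeal_eq]
  · simp

/-- The relation between the ramification function of a group and that of a quotient. -/
theorem ramSum_eq_addVal {A : Type*} [CommRing A] [Algebra A B] [SMulCommClass G A B]
    [FaithfulSMul G B] (hadj : ∀ ϖ : B, Irreducible ϖ → Algebra.adjoin A {ϖ} = ⊤)
    (hres : ∀ b : B, ∃ a : B, (∀ t : G, t • a = a) ∧ ¬ IsUnit (b - a))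
    (H : Subgroup G) [Fintype H] {c : B} (hc0 : c ≠ 0) (hcu : ¬ IsUnit c)
    (hc : ∀ t ∈ H, t • c = c)
    (hdvd : ∀ b : B, (∀ t ∈ H, t • b = b) → ¬ IsUnit b → c ∣ b) (s : G) :
    ramSum B H s = addVal B (s • c - c) := by
  obtain ⟨ϖ, hϖ⟩ := exists_irreducible B
  -- The orbit polynomial of ϖ under H has H-invariant coefficients. Its conjugate by s takes at ϖ
  -- the value ∏(ϖ - stϖ), whose valuation is the sum over the coset sH.
  let g : B[X] := ∏ t : H, (X - C ((t : G) • ϖ))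
  have hginv : ∀ t ∈ H, g.map (MulSemiringAction.toRingHom G B t) = g := by
    intro t ht
    rw [Polynomial.map_prod]
    refine Fintype.prod_equiv (Equiv.mulLeft (⟨t, ht⟩ : H)) _ _ fun r => ?_
    simp [mul_smul]
  have hgs : (g.map (MulSemiringAction.toRingHom G B s)).eval ϖ =
      ∏ t : H, (ϖ - (s * t : G) • ϖ) := by
    simp [g, Polynomial.map_prod, eval_prod, mul_smul]
  have hsum : ramSum B H s = addVal B ((g.map (MulSemiringAction.toRingHom G B s)).eval ϖ) := by
    rw [hgs, addVal_prod]
    refine Finset.sum_congr rfl fun t _ => ?_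
    rw [ram_eq_addVal hϖ hres, addVal_sub_comm]
  rw [hsum]
  apply le_antisymm
  -- Write c = P(ϖ) with G-invariant coefficients. All H-conjugates of ϖ are roots of P - c, so g
  -- divides P - c. Applying s to the coefficients and evaluating at ϖ shows that the value of the
  -- conjugate of g divides c - sc.
  · rw [addVal_sub_comm, addVal_le_iff_dvd]
    obtain ⟨P, hP⟩ : ∃ P : A[X], aeval ϖ P = c := by
      have : c ∈ Algebra.adjoin A {ϖ} := hadj ϖ hϖ ▸ Algebra.mem_top
      rwa [Algebra.adjoin_singleton_eq_range_aeval] at this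
    let Q : B[X] := P.map (algebraMap A B) - C c
    have hfix : ∀ t : G, (P.map (algebraMap A B)).map (MulSemiringAction.toRingHom G B t) =
        P.map (algebraMap A B) := by
      intro t
      rw [Polynomial.map_map]
      congr 1
      ext a
      simp [Algebra.algebraMap_eq_smul_one, smul_comm t a (1 : B)]
    have hgQ : g ∣ Q := by
      apply Finset.prod_dvd_of_isRelPrime
      · intro t _ t' _ htt
        have hne : (t : G) • ϖ ≠ (t' : G) • ϖ := by
          intro h
          apply htt
          have h1 : ram B ((t' : G)⁻¹ * t) = ⊤ := by
            rw [ram_eq_addVal hϖ hres, mul_smul, h, inv_smul_smul, sub_self, addVal_zero]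
          rw [ram_eq_top_iff, inv_mul_eq_one] at h1
          exact Subtype.ext h1.symm
        refine ((irreducible_X_sub_C _).isRelPrime_iff_not_dvd).2 ?_
        rw [dvd_iff_isRoot]
        simpa [sub_eq_zero] using hne
      · intro t _
        rw [dvd_iff_isRoot, IsRoot, eval_sub, eval_C]
        have h1 := congrArg (MulSemiringAction.toRingHom G B t) hP
        rw [aeval_def, eval₂_eq_eval_map, ← Polynomial.eval_map_apply, hfix] at h1
        simp only [MulSemiringAction.toRingHom_apply] at h1
        rw [h1, hc t t.2, sub_self]
    have h1 := Polynomial.map_dvd (MulSemiringAction.toRingHom G B s) hgQ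
    have h2 := Polynomial.eval_dvd (x := ϖ) h1
    rw [Polynomial.map_sub, hfix, eval_sub, eval_map_algebraMap, hP, map_C, eval_C] at h2
    exact h2
  -- Conversely, sc - c divides the change under s of every H-invariant, hence all coefficients of
  -- the difference of g and its conjugate, and g(ϖ) = 0.
  · rw [addVal_le_iff_dvd]
    have h0 : g.eval ϖ = 0 := by
      rw [eval_prod]
      exact Finset.prod_eq_zero (Finset.mem_univ (1 : H)) (by simp)
    have h1 : C (s • c - c) ∣ g.map (MulSemiringAction.toRingHom G B s) - g := by
      rw [C_dvd_iff_dvd_coeff]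
      intro i
      rw [coeff_sub, coeff_map, ← addVal_le_iff_dvd]
      refine addVal_sub_le_of_fixed hc0 hcu hc hdvd hres s fun t ht => ?_
      conv_rhs => rw [← hginv t ht, coeff_map]
      rfl
    have h2 := Polynomial.eval_dvd (x := ϖ) h1
    rwa [eval_C, eval_sub, h0, sub_zero] at h2

variable (B) in
/-- The sum of the ramification function of a group, truncated at its value at `s`. -/
def ramTot [Fintype G] (s : G) : ℕ∞ := ∑ s' : G, min (ram B s') (ram B s)

/-- Right translation by t in H permutes G, so averaging over H replaces each truncated value by the
truncated sum over its coset. These coset sums are what descends to a quotient. -/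
theorem card_mul_ramTot [Fintype G] (H : Subgroup G) [Fintype H] {s₀ : G}
    (h : ∀ t : H, ram B (s₀ * t) ≤ ram B s₀) :
    (Fintype.card H : ℕ∞) * ramTot B s₀ = ∑ s' : G, min (ramSum B H s') (ramSum B H s₀) := by
  simp_rw [← sum_min_ram_eq_min H h]
  rw [Finset.sum_comm]
  have h1 : ∀ t : H, ∑ s' : G, min (ram B (s' * t)) (ram B s₀) = ramTot B s₀ := fun t =>
    Fintype.sum_equiv (Equiv.mulRight (t : G)) _ _ fun s' => rfl
  simp [h1]

theorem ramTot_mono [Fintype G] {s s' : G} (h : ram B s ≤ ram B s') :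
    ramTot B s ≤ ramTot B s' :=
  Finset.sum_le_sum fun _ _ => min_le_min le_rfl h

theorem ramTot_ne_top [Fintype G] {s : G} (h : ram B s ≠ ⊤) : ramTot B s ≠ ⊤ := by
  have h1 : ramTot B s ≤ Fintype.card G * ram B s := by
    refine (Finset.sum_le_card_nsmul _ _ (ram B s) fun _ _ => min_le_right _ _).trans ?_
    rw [nsmul_eq_mul, Finset.card_univ]
  exact ne_top_of_le_ne_top (WithTop.mul_ne_top (ENat.natCast_ne_top _) h) h1

/-- The upper numbering does not decrease under passage to a quotient. -/
theorem ramTot_le_of_quotient {B' Q : Type*} [CommRing B'] [IsDomain B']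
    [IsDiscreteValuationRing B'] [Group Q] [MulSemiringAction Q B'] [Fintype G] [Fintype Q]
    (π : G →* Q) (hπ : Function.Surjective π) [Fintype π.ker]
    (h : ∀ s : G, ramSum B π.ker s = Fintype.card π.ker * ram B' (π s)) (s : G) :
    ramTot B s ≤ Fintype.card π.ker * ramTot B' (π s) := by
  -- Replacing s by the element of its coset with the largest value leaves the image unchanged and
  -- can only increase the left side.
  obtain ⟨t₀, ht₀⟩ := exists_max_ram B π.ker s
  have h' : ∀ t : π.ker, ram B (s * t₀ * t) ≤ ram B (s * t₀) := fun t => by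
    rw [mul_assoc]; exact ht₀ (t₀ * t)
  have hs : ram B s ≤ ram B (s * t₀) := by simpa using ht₀ 1
  refine (ramTot_mono hs).trans ?_
  have hN0 : (Fintype.card π.ker : ℕ∞) ≠ 0 := by exact_mod_cast Fintype.card_ne_zero
  have hN : (Fintype.card π.ker : ℕ∞) ≠ ⊤ := ENat.natCast_ne_top _
  rw [← ENat.mul_le_mul_left_iff hN0 hN, card_mul_ramTot _ h', ramSum_mul]
  simp_rw [h]
  have h1 : ∀ a b : ℕ∞, min (Fintype.card π.ker * a) (Fintype.card π.ker * b) =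
      Fintype.card π.ker * min a b := fun a b =>
    ((mul_right_mono (a := (Fintype.card π.ker : ℕ∞))).map_min).symm
  simp_rw [h1]
  rw [← Finset.mul_sum]
  gcongr
  classical
  rw [← Finset.sum_fiberwise Finset.univ π, ramTot, Finset.mul_sum]
  refine (Finset.sum_congr rfl fun q _ => ?_).le
  obtain ⟨s₁, rfl⟩ := hπ q
  rw [Finset.sum_congr rfl (g := fun _ => min (ram B' (π s₁)) (ram B' (π s))) (by
    intro i hi; rw [(Finset.mem_filter.1 hi).2]), Finset.sum_const, nsmul_eq_mul]
  congr 2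
  rw [← Fintype.card_subtype]
  refine Fintype.card_congr ⟨fun i => ⟨s₁⁻¹ * i, by simp [MonoidHom.mem_ker, i.2]⟩,
    fun t => ⟨s₁ * t, by simp [MonoidHom.mem_ker.1 t.2]⟩, fun i => by simp, fun t => by simp⟩

/-- The upper numbering of a group with a subgroup `H₁`, outside of which it is trivial, and a
subgroup `H₂` of `H₁` with one jump. -/
theorem ramTot_of_one_jump [Fintype G] (H₁ H₂ : Subgroup G) [Fintype H₂] [Fintype H₁]
    {h : ℕ} (hle : H₂ ≤ H₁) (h₀ : ∀ s ∉ H₁, ram B s = 1)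
    (h₁ : ∀ s ∈ H₁, s ∉ H₂ → ramSum B H₂ s = Fintype.card H₂ * (h + 1))
    {s₀ : G} (hs₀ : s₀ ∈ H₁) (hs₀' : s₀ ∉ H₂) (hmax : ∀ t : H₂, ram B (s₀ * t) ≤ ram B s₀) :
    ramTot B s₀ = Fintype.card G + Fintype.card H₁ * h := by
  classical
  have hN0 : (Fintype.card H₂ : ℕ∞) ≠ 0 := by exact_mod_cast Fintype.card_ne_zero
  have hN : (Fintype.card H₂ : ℕ∞) ≠ ⊤ := ENat.natCast_ne_top _
  -- Outside H₁ the coset sum is |H₂|, and on H₁ away from H₂ it is |H₂|(h + 1). On H₂ it is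
  -- infinite because of the identity, and the truncation brings it down to |H₂|(h + 1).
  have hval : ∀ s' : G, min (ramSum B H₂ s') (ramSum B H₂ s₀) =
      Fintype.card H₂ * (1 + if s' ∈ H₁ then (h : ℕ∞) else 0) := by
    intro s'
    rw [h₁ s₀ hs₀ hs₀']
    by_cases hs1 : s' ∈ H₁
    · rw [if_pos hs1, add_comm 1]
      by_cases hs2 : s' ∈ H₂
      · apply min_eq_right
        have h2 : ramSum B H₂ s' = ⊤ := by
          rw [← top_le_iff]
          refine le_trans ?_ (Finset.single_le_sum (fun _ _ => bot_le)
            (Finset.mem_univ (⟨s', hs2⟩⁻¹ : H₂)))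
          simp [ram_one]
        rw [h2]
        exact le_top
      · rw [h₁ s' hs1 hs2, min_self]
    · rw [if_neg hs1, add_zero, mul_one]
      have h2 : ramSum B H₂ s' = Fintype.card H₂ := by
        rw [ramSum, Finset.sum_congr rfl (g := fun _ => 1)]
        · simp
        · intro t _
          exact h₀ _ fun h3 => hs1 ((Subgroup.mul_mem_cancel_right _ (hle t.2)).1 h3)
      rw [h2]
      exact min_eq_left (le_mul_of_one_le_right bot_le le_add_self)
  have h3 := card_mul_ramTot H₂ hmax
  simp_rw [hval] at h3
  rw [← Finset.mul_sum] at h3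
  rw [(ENat.mul_right_strictMono hN0 hN).injective h3, Finset.sum_add_distrib, ← Finset.sum_filter,
    Finset.sum_const, Finset.sum_const, nsmul_eq_mul, nsmul_eq_mul, mul_one, Finset.card_univ,
    ← Fintype.card_subtype]

end RamificationFunction

/-! ### Towers of extensions of k((t)) and restriction of automorphisms -/

section GaloisRamification

open IsDiscreteValuationRing hiding maximalIdeal

universe w

variable {k : Type w} [Field k]

instance {L : Type*} [Field L] [Algebra (LaurentSeries k) L] [Algebra (PowerSeries k) L]
    [IsScalarTower (PowerSeries k) (LaurentSeries k) L] :
    SMulCommClass (L ≃ₐ[LaurentSeries k] L) (PowerSeries k) L where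
  smul_comm σ a x := by
    rw [algebra_compatible_smul (LaurentSeries k) a x,
      algebra_compatible_smul (LaurentSeries k) a (σ • x), smul_comm]

variable {L : Type w} [Field L] [Algebra (LaurentSeries k) L] [Algebra (PowerSeries k) L]
    [IsScalarTower (PowerSeries k) (LaurentSeries k) L]

theorem coe_gal_smul (σ : L ≃ₐ[LaurentSeries k] L) (b : integralClosure (PowerSeries k) L) :
    ((σ • b : integralClosure (PowerSeries k) L) : L) = σ (b : L) := rfl

instance [FiniteDimensional (LaurentSeries k) L] :
    FaithfulSMul (L ≃ₐ[LaurentSeries k] L) (integralClosure (PowerSeries k) L) where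
  eq_of_smul_eq_smul {σ τ} h := by
    have : IsFractionRing (integralClosure (PowerSeries k) L) L :=
      integralClosure.isFractionRing_of_finite_extension (LaurentSeries k) L
    ext x
    obtain ⟨a, b, hb, rfl⟩ := IsFractionRing.div_surjective
      (A := integralClosure (PowerSeries k) L) x
    have h1 : ∀ a : integralClosure (PowerSeries k) L, σ (algebraMap _ L a) =
        τ (algebraMap _ L a) := fun a => congrArg Subtype.val (h a)
    rw [map_div₀, map_div₀, h1, h1]

variable [FiniteDimensional (LaurentSeries k) L] [Algebra.IsSeparable (LaurentSeries k) L]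

theorem exists_fixed_sub_not_isUnit [IsAlgClosed k] (b : integralClosure (PowerSeries k) L) :
    ∃ a : integralClosure (PowerSeries k) L,
      (∀ σ : L ≃ₐ[LaurentSeries k] L, σ • a = a) ∧ ¬ IsUnit (b - a) := by
  obtain ⟨a, ha⟩ := exists_C_sub_mem b
  refine ⟨_, fun σ => ?_, ha⟩
  rw [Algebra.algebraMap_eq_smul_one, smul_comm, smul_one]

/-- The inclusion of rings of integers. -/
abbrev intMap (k : Type w) [Field k] (M L : Type w) [Field M] [Field L]
    [Algebra (PowerSeries k) M] [Algebra (PowerSeries k) L] [Algebra M L]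
    [IsScalarTower (PowerSeries k) M L] :
    integralClosure (PowerSeries k) M →ₐ[PowerSeries k] integralClosure (PowerSeries k) L :=
  (IsScalarTower.toAlgHom (PowerSeries k) M L).mapIntegralClosure

variable {M : Type w} [Field M] [Algebra (LaurentSeries k) M] [Algebra (PowerSeries k) M]
    [IsScalarTower (PowerSeries k) (LaurentSeries k) M]
    [FiniteDimensional (LaurentSeries k) M] [Algebra.IsSeparable (LaurentSeries k) M]
    [Algebra M L] [IsScalarTower (PowerSeries k) M L]

theorem addVal_intMap {ϖ : integralClosure (PowerSeries k) M} (hϖ : Irreducible ϖ)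
    (b : integralClosure (PowerSeries k) M) :
    addVal _ (intMap k M L b) = addVal _ (intMap k M L ϖ) * addVal _ b := by
  by_cases hb : b = 0
  · subst hb
    -- In `ℕ∞` the product of 0 and ⊤ is 0, so b = 0 needs a positive ramification index. It is
    -- positive because X, up to a unit a power of ϖ, stays a non-unit in L.
    have h0 : addVal _ (intMap k M L ϖ) ≠ 0 := by
      rw [Ne, addVal_eq_zero_iff]
      intro hu
      have hX :
          algebraMap (PowerSeries k) (integralClosure (PowerSeries k) M) PowerSeries.X ≠ 0 := by
        rw [← map_zero (algebraMap (PowerSeries k) _)]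
        exact injective_algebraMap_integralClosure.ne PowerSeries.X_ne_zero
      obtain ⟨n, u, hn⟩ := eq_unit_mul_pow_irreducible hX hϖ
      have h1 := congrArg (intMap k M L) hn
      rw [AlgHom.commutes, map_mul, map_pow] at h1
      have h2 := algebraMap_X_mem_maximalIdeal (k := k) (L := L)
      rw [h1, IsLocalRing.mem_maximalIdeal] at h2
      exact h2 ((u.isUnit.map (intMap k M L)).mul (hu.pow n))
    rw [map_zero, addVal_zero, addVal_zero, ENat.mul_top h0]
  · obtain ⟨n, u, rfl⟩ := eq_unit_mul_pow_irreducible hb hϖ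
    rw [addVal_def' u hϖ n, map_mul, addVal_mul, map_pow, addVal_pow,
      addVal_eq_zero_iff.2 (u.isUnit.map (intMap k M L)), zero_add, nsmul_eq_mul, mul_comm]

/-- Both fields are totally ramified over k((t)), so comparing the two valuations of X gives the
ramification index of L over M. -/
theorem finrank_mul_addVal_intMap [IsAlgClosed k] {ϖ : integralClosure (PowerSeries k) M}
    (hϖ : Irreducible ϖ) :
    addVal _ (intMap k M L ϖ) * Module.finrank (LaurentSeries k) M =
      Module.finrank (LaurentSeries k) L := by
  rw [← addVal_X_eq_finrank (L := M), ← addVal_intMap hϖ, AlgHom.commutes, addVal_X_eq_finrank]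

theorem addVal_intMap_eq [IsAlgClosed k] {ϖ : integralClosure (PowerSeries k) M}
    (hϖ : Irreducible ϖ) {d : ℕ} (hd : Module.finrank (LaurentSeries k) M * d =
      Module.finrank (LaurentSeries k) L) :
    addVal _ (intMap k M L ϖ) = d := by
  have h := finrank_mul_addVal_intMap (L := L) hϖ
  rw [← hd, mul_comm, Nat.cast_mul] at h
  refine (ENat.mul_right_strictMono ?_ (ENat.natCast_ne_top _)).injective h
  exact_mod_cast Module.finrank_pos.ne'

/-- By total ramification |H| is the valuation in L of a uniformizer of the fixed field of H, and b
is a non-unit integer of that field. Only the valuation of c matters: c itself need not be fixed. -/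
theorem dvd_of_fixed [IsAlgClosed k] (H : Subgroup (L ≃ₐ[LaurentSeries k] L)) [Fintype H]
    {c : integralClosure (PowerSeries k) L} (hcv : addVal _ c = Fintype.card H)
    (b : integralClosure (PowerSeries k) L) (hb : ∀ t ∈ H, t • b = b) (hbu : ¬ IsUnit b) :
    c ∣ b := by
  let M := IntermediateField.fixedField H
  have : IsScalarTower (PowerSeries k) M L := IsScalarTower.of_algebraMap_eq fun a => rfl
  obtain ⟨ϖ, hϖ⟩ := exists_irreducible (integralClosure (PowerSeries k) M)
  have h1 : addVal _ (intMap k M L ϖ) = Fintype.card H := by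
    apply addVal_intMap_eq hϖ
    rw [← Nat.card_eq_fintype_card, ← IntermediateField.finrank_fixedField_eq_card,
      Module.finrank_mul_finrank]
  have hbM : (b : L) ∈ M := fun t => congrArg Subtype.val (hb t t.2)
  have hbi : IsIntegral (PowerSeries k) (⟨b, hbM⟩ : M) :=
    (isIntegral_algHom_iff (IsScalarTower.toAlgHom (PowerSeries k) M L)
      (algebraMap M L).injective).1 b.2
  have hbe : intMap k M L ⟨_, hbi⟩ = b := rfl
  have h2 : ϖ ∣ ⟨_, hbi⟩ := by
    rw [← Ideal.mem_span_singleton, ← hϖ.maximalIdeal_eq, IsLocalRing.mem_maximalIdeal]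
    exact fun h => hbu (hbe ▸ h.map (intMap k M L))
  have h3 := (intMap k M L).toRingHom.map_dvd h2
  have h4 : addVal _ c ≤ addVal _ b := by
    rw [hcv, ← h1, addVal_le_iff_dvd]
    exact h3
  exact addVal_le_iff_dvd.1 h4

theorem ramSum_eq_of_addVal_eq_card [IsAlgClosed k] (H : Subgroup (L ≃ₐ[LaurentSeries k] L))
    [Fintype H] {c : integralClosure (PowerSeries k) L} (hcv : addVal _ c = Fintype.card H)
    (hc : ∀ t ∈ H, t • c = c) (s : L ≃ₐ[LaurentSeries k] L) :
    ramSum (integralClosure (PowerSeries k) L) H s = addVal _ (s • c - c) := by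
  have hc0 : c ≠ 0 := by
    rintro rfl
    rw [addVal_zero] at hcv
    exact ENat.natCast_ne_top _ hcv.symm
  have hcu : ¬ IsUnit c := by
    rw [← one_le_addVal_iff, hcv]
    exact_mod_cast Fintype.card_pos
  have h1 := dvd_of_fixed H hcv
  have h2 := exists_fixed_sub_not_isUnit (k := k) (L := L)
  have h3 : ∀ ϖ : integralClosure (PowerSeries k) L, Irreducible ϖ →
      Algebra.adjoin (PowerSeries k) {ϖ} = ⊤ := fun ϖ hϖ => adjoin_uniformizer_eq_top hϖ
  exact ramSum_eq_addVal h3 h2 H hc0 hcu hc h1 s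

/-- The upper numbering does not decrease under restriction to a Galois subextension. -/
theorem ramTot_le_of_restrict [IsAlgClosed k] [IsGalois (LaurentSeries k) L]
    [IsGalois (LaurentSeries k) M] [IsScalarTower (LaurentSeries k) M L]
    [Fintype (L ≃ₐ[LaurentSeries k] L)] [Fintype (M ≃ₐ[LaurentSeries k] M)]
    (s : L ≃ₐ[LaurentSeries k] L) :
    ramTot (integralClosure (PowerSeries k) L) s * Fintype.card (M ≃ₐ[LaurentSeries k] M) ≤
      Fintype.card (L ≃ₐ[LaurentSeries k] L) * ramTot (integralClosure (PowerSeries k) M)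
        (AlgEquiv.restrictNormalHom M s) := by
  classical
  let π : (L ≃ₐ[LaurentSeries k] L) →* (M ≃ₐ[LaurentSeries k] M) := AlgEquiv.restrictNormalHom M
  have hπ : Function.Surjective π := AlgEquiv.restrictNormalHom_surjective L
  have hcard : Fintype.card (M ≃ₐ[LaurentSeries k] M) * Fintype.card π.ker =
      Fintype.card (L ≃ₐ[LaurentSeries k] L) := by
    have h1 := π.ker.card_eq_card_quotient_mul_card_subgroup
    rw [Nat.card_congr (QuotientGroup.quotientKerEquivOfSurjective π hπ).toEquiv] at h1
    simpa using h1.symm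
  obtain ⟨ϖ, hϖ⟩ := exists_irreducible (integralClosure (PowerSeries k) M)
  have hsm : ∀ s : L ≃ₐ[LaurentSeries k] L, ∀ b : integralClosure (PowerSeries k) M,
      s • intMap k M L b = intMap k M L (π s • b) := by
    intro s b
    apply Subtype.ext
    exact (AlgEquiv.restrictNormal_commutes s M (b : M)).symm
  have hc : addVal _ (intMap k M L ϖ) = Fintype.card π.ker := by
    apply addVal_intMap_eq hϖ
    rw [← IsGalois.card_aut_eq_finrank (LaurentSeries k) M,
      ← IsGalois.card_aut_eq_finrank (LaurentSeries k) L]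
    simpa using hcard
  -- A uniformizer of M is fixed by the kernel and has valuation |ker| in L, so it serves as c, and
  -- the factor |ker| is the ramification index.
  have h := ramTot_le_of_quotient (B' := integralClosure (PowerSeries k) M) π hπ (fun s => by
    rw [ramSum_eq_of_addVal_eq_card π.ker hc, hsm, ← map_sub, addVal_intMap hϖ, hc,
      ram_eq_addVal hϖ exists_fixed_sub_not_isUnit]
    intro t ht
    rw [hsm, MonoidHom.mem_ker.1 ht, one_smul]) s
  calc _ ≤ _ := mul_le_mul_left h _
    _ = _ := by
      rw [← hcard]
      push_cast
      ring

end GaloisRamification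

/-! ### The Herbrand function and membership in the upper numbering groups -/

section UpperNumbering

open IsDiscreteValuationRing hiding maximalIdeal

variable {k : Type*} [Field k] [IsAlgClosed k]
  (L : IntermediateField (LaurentSeries k) (AlgebraicClosure (LaurentSeries k)))
  [FiniteDimensional (LaurentSeries k) L] [IsGalois (LaurentSeries k) L]

theorem mem_lowerRam_iff {i : ℕ} {σ : L ≃ₐ[LaurentSeries k] L} :
    σ ∈ lowerRam L i ↔ ((i + 1 : ℕ) : ℕ∞) ≤ ram (integralClosure (PowerSeries k) L) σ := by
  obtain ⟨ϖ, hϖ⟩ := exists_irreducible (integralClosure (PowerSeries k) L)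
  rw [ram, le_iInf_iff]
  refine forall_congr' fun x => ?_
  rw [IsLocalRing.jacobson_eq_maximalIdeal _ bot_ne_top, hϖ.maximalIdeal_eq,
    Ideal.span_singleton_pow, ← hϖ.addVal_pow, addVal_le_iff_dvd, ← Ideal.mem_span_singleton]
  constructor
  · rintro ⟨z, hz, hzx⟩
    have : z = σ • x - x := Subtype.ext hzx
    rwa [← this]
  · exact fun h => ⟨_, h, rfl⟩

/-- The residue field consists of constants, which are fixed, so the whole group is inertia: G = G₀.
-/
theorem one_le_ram (σ : L ≃ₐ[LaurentSeries k] L) :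
    1 ≤ ram (integralClosure (PowerSeries k) L) σ := by
  refine le_iInf fun b => ?_
  obtain ⟨a, ha, hb⟩ := exists_fixed_sub_not_isUnit b
  have h : σ • b - b = σ • (b - a) - (b - a) := by rw [smul_sub, ha]; ring
  rw [h]
  refine (le_min ?_ ?_).trans (AddValuation.map_sub _ _ _)
  · rw [addVal_smul]; exact one_le_addVal_iff.2 hb
  · exact one_le_addVal_iff.2 hb

/-- The contribution of an element with ramification number `r` to the Herbrand function. -/
def herbrandTerm (r : ℕ∞) (x : ℝ) : ℝ := if r = ⊤ then x else min ((r.toNat : ℝ) - 1) x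

/-- An element with ramification number r belongs to G_i exactly for i ≤ r - 1, so its share of the
integral from 0 to x is the length min(r - 1, x). -/
theorem sum_indicator_add_eq_herbrandTerm {r : ℕ∞} (hr : 1 ≤ r) {x : ℝ} (hx : 0 ≤ x) :
    (∑ i ∈ Finset.range ⌊x⌋₊, (if ((i + 1 + 1 : ℕ) : ℕ∞) ≤ r then (1 : ℝ) else 0)) +
      (x - ⌊x⌋₊) * (if ((⌊x⌋₊ + 1 + 1 : ℕ) : ℕ∞) ≤ r then (1 : ℝ) else 0) =
      herbrandTerm r x := by
  have hfl := Nat.floor_le hx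
  have hlt := Nat.lt_floor_add_one x
  unfold herbrandTerm
  induction r using ENat.recTopCoe with
  | top => simp
  | coe r =>
    rw [if_neg (ENat.natCast_ne_top r), ENat.toNat_natCast]
    simp only [Nat.cast_le]
    have hr1 : 1 ≤ r := by exact_mod_cast hr
    obtain ⟨r, rfl⟩ := Nat.exists_eq_add_of_le' hr1
    have hsum : ∀ n : ℕ, ∑ i ∈ Finset.range n, (if i + 1 + 1 ≤ r + 1 then (1 : ℝ) else 0) =
        min n r := by
      intro n
      induction n with
      | zero => simp
      | succ n ih =>
        rw [Finset.sum_range_succ, ih]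
        rcases le_or_gt (n + 1) r with h | h
        · rw [if_pos (by omega), min_eq_left (by exact_mod_cast (by omega : n ≤ r)),
            min_eq_left (by exact_mod_cast h)]
          push_cast; ring
        · rw [if_neg (by omega), min_eq_right (by exact_mod_cast (by omega : r ≤ n)),
            min_eq_right (by exact_mod_cast h.le), add_zero]
    rw [hsum]
    push_cast
    rcases le_or_gt (⌊x⌋₊ + 1) r with h | h
    · have h1 : ((⌊x⌋₊ : ℝ) + 1) ≤ r := by exact_mod_cast h
      rw [if_pos (by omega), min_eq_left (by linarith), min_eq_right (by linarith)]
      ring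
    · have h1 : (r : ℝ) ≤ ⌊x⌋₊ := by exact_mod_cast (by omega : r ≤ ⌊x⌋₊)
      rw [if_neg (by omega), min_eq_right h1, min_eq_left (by linarith)]
      ring

/-- Exchanging the sum over levels with the sum over group elements, and using G₀ = G, turns the
integral into one term per element. Monotonicity and continuity can then be read off term by term.
-/
theorem herbrand_eq [Fintype (L ≃ₐ[LaurentSeries k] L)] {x : ℝ} (hx : 0 ≤ x) :
    herbrand L x = (∑ σ : L ≃ₐ[LaurentSeries k] L,
      herbrandTerm (ram (integralClosure (PowerSeries k) L) σ) x) /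
        Nat.card (L ≃ₐ[LaurentSeries k] L) := by
  classical
  have hcard : ∀ i : ℕ, (Nat.card (lowerRam L i) : ℝ) = ∑ σ : L ≃ₐ[LaurentSeries k] L,
      if ((i + 1 : ℕ) : ℕ∞) ≤ ram (integralClosure (PowerSeries k) L) σ then (1 : ℝ) else 0 := by
    intro i
    rw [Finset.sum_boole, Nat.card_eq_fintype_card]
    congr 1
    rw [Fintype.card_subtype]
    congr 1
    ext σ
    simp only [Finset.mem_filter, Finset.mem_univ, true_and]
    exact mem_lowerRam_iff L
  have h0 : (Nat.card (lowerRam L 0) : ℝ) = Nat.card (L ≃ₐ[LaurentSeries k] L) := by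
    rw [hcard, Nat.card_eq_fintype_card, Finset.sum_congr rfl (g := fun _ => 1)]
    · simp
    · intro σ _
      rw [if_pos]
      exact_mod_cast one_le_ram L σ
  rw [herbrand, h0]
  congr 1
  simp_rw [hcard]
  rw [Finset.sum_comm, Finset.mul_sum, ← Finset.sum_add_distrib]
  exact Finset.sum_congr rfl fun σ _ => sum_indicator_add_eq_herbrandTerm (one_le_ram L σ) hx

theorem monotone_herbrandTerm (r : ℕ∞) : Monotone (herbrandTerm r) := by
  intro x y h
  unfold herbrandTerm
  split_ifs
  · exact h
  · exact min_le_min le_rfl h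

theorem continuous_herbrandTerm (r : ℕ∞) : Continuous (herbrandTerm r) := by
  unfold herbrandTerm
  split_ifs <;> fun_prop

theorem herbrandTerm_nonneg {r : ℕ∞} (hr : 1 ≤ r) {x : ℝ} (hx : 0 ≤ x) :
    0 ≤ herbrandTerm r x := by
  rw [← sum_indicator_add_eq_herbrandTerm hr hx]
  have := Nat.floor_le hx
  refine add_nonneg (Finset.sum_nonneg fun i _ => by positivity) (mul_nonneg (by linarith) ?_)
  positivity

/-- At x one less than the ramification number of σ, each term becomes the truncated ramification
number minus 1; the units add up to |G|. As σ ≠ 1, the numbers converted by `toNat` are finite. -/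
theorem herbrand_toNat_ram [Fintype (L ≃ₐ[LaurentSeries k] L)] {σ : L ≃ₐ[LaurentSeries k] L}
    (hσ : σ ≠ 1) :
    herbrand L ((ram (integralClosure (PowerSeries k) L) σ).toNat - 1) =
      ((ramTot (integralClosure (PowerSeries k) L) σ).toNat : ℝ) /
        Fintype.card (L ≃ₐ[LaurentSeries k] L) - 1 := by
  set r := ram (integralClosure (PowerSeries k) L) σ with hr
  have hr1 : 1 ≤ r := one_le_ram L σ
  have hrt : r ≠ ⊤ := mt ram_eq_top_iff.1 hσ
  have hr1' : (1 : ℝ) ≤ r.toNat := by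
    rw [← ENat.natCast_toNat hrt] at hr1
    exact_mod_cast hr1
  have hterm : ∀ τ : L ≃ₐ[LaurentSeries k] L,
      herbrandTerm (ram (integralClosure (PowerSeries k) L) τ) (r.toNat - 1) =
        (min (ram (integralClosure (PowerSeries k) L) τ) r).toNat - 1 := by
    intro τ
    unfold herbrandTerm
    split_ifs with h
    · rw [h, min_eq_right le_top]
    · obtain ⟨a, ha⟩ := ENat.ne_top_iff_exists.1 h
      obtain ⟨b, hb⟩ := ENat.ne_top_iff_exists.1 hrt
      rw [← ha, ← hb, ← (Nat.mono_cast (α := ℕ∞)).map_min, ENat.toNat_natCast,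
        ENat.toNat_natCast, ENat.toNat_natCast, Nat.cast_min, min_sub_sub_right]
  have hsum : ((ramTot (integralClosure (PowerSeries k) L) σ).toNat : ℝ) =
      ∑ τ : L ≃ₐ[LaurentSeries k] L,
        ((min (ram (integralClosure (PowerSeries k) L) τ) r).toNat : ℝ) := by
    rw [← Nat.cast_sum]
    congr 1
    have h1 : ramTot (integralClosure (PowerSeries k) L) σ =
        ((∑ τ : L ≃ₐ[LaurentSeries k] L,
          (min (ram (integralClosure (PowerSeries k) L) τ) r).toNat : ℕ) : ℕ∞) := by
      rw [Nat.cast_sum]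
      refine Finset.sum_congr rfl fun τ _ => ?_
      rw [ENat.natCast_toNat]
      exact ne_top_of_le_ne_top hrt (min_le_right _ _)
    rw [h1, ENat.toNat_natCast]
  have hc : (Fintype.card (L ≃ₐ[LaurentSeries k] L) : ℝ) ≠ 0 := by
    exact_mod_cast Fintype.card_ne_zero
  rw [herbrand_eq L (by linarith), hsum, Nat.card_eq_fintype_card]
  have h2 : ∀ f : (L ≃ₐ[LaurentSeries k] L) → ℝ, ∑ τ, (f τ - 1) =
      (∑ τ, f τ) - Fintype.card (L ≃ₐ[LaurentSeries k] L) := fun f => by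
    simp
  rw [Finset.sum_congr rfl (fun τ _ => hterm τ), h2, sub_div, div_self hc]

theorem monotoneOn_herbrand : MonotoneOn (herbrand L) (Set.Ici 0) := by
  have := Fintype.ofFinite (L ≃ₐ[LaurentSeries k] L)
  intro x hx y hy h
  rw [herbrand_eq L hx, herbrand_eq L hy]
  gcongr with σ _
  exact monotone_herbrandTerm _ h

theorem continuousOn_herbrand : ContinuousOn (herbrand L) (Set.Ici 0) := by
  have := Fintype.ofFinite (L ≃ₐ[LaurentSeries k] L)
  refine ContinuousOn.congr (f := fun x => (∑ σ : L ≃ₐ[LaurentSeries k] L,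
      herbrandTerm (ram (integralClosure (PowerSeries k) L) σ) x) /
        Nat.card (L ≃ₐ[LaurentSeries k] L)) ?_ fun x hx => herbrand_eq L hx
  refine Continuous.continuousOn (Continuous.div_const
    (continuous_finsetSum _ fun σ _ => continuous_herbrandTerm _) _)

theorem herbrand_zero : herbrand L 0 = 0 := by
  simp [herbrand]

/-- An element lies in the upper numbering group `G^y` if and only if `y` does not exceed its upper
ramification number. -/
theorem mem_upperRamFin_iff [Fintype (L ≃ₐ[LaurentSeries k] L)] {σ : L ≃ₐ[LaurentSeries k] L}
    (hσ : σ ≠ 1) {y : ℝ} (hy : 0 ≤ y) :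
    σ ∈ upperRamFin L y ↔ (y + 1) * Fintype.card (L ≃ₐ[LaurentSeries k] L) ≤
      (ramTot (integralClosure (PowerSeries k) L) σ).toNat := by
  have hc : (0 : ℝ) < Fintype.card (L ≃ₐ[LaurentSeries k] L) := by
    exact_mod_cast Fintype.card_pos
  have hv := herbrand_toNat_ram L hσ
  have hr1 : 1 ≤ ram (integralClosure (PowerSeries k) L) σ := one_le_ram L σ
  have hrt : ram (integralClosure (PowerSeries k) L) σ ≠ ⊤ := mt ram_eq_top_iff.1 hσ
  obtain ⟨n, hn⟩ := ENat.ne_top_iff_exists.1 hrt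
  rw [← hn, ENat.toNat_natCast] at hv
  rw [← hn] at hr1
  have hn1 : 1 ≤ n := by exact_mod_cast hr1
  have hn1' : (1 : ℝ) ≤ n := by exact_mod_cast hn1
  rw [← le_div_iff₀ hc, ← le_sub_iff_add_le, ← hv]
  constructor
  · rintro ⟨x, hx, rfl, h⟩
    rw [mem_lowerRam_iff, ← hn, Nat.cast_le] at h
    refine monotoneOn_herbrand L hx (Set.mem_Ici.2 (by linarith)) ?_
    have h1 := Nat.le_ceil x
    have h2 : ((⌈x⌉₊ : ℝ) + 1) ≤ n := by exact_mod_cast h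
    linarith
  · intro h
    -- The intermediate value theorem provides a preimage x ≤ n - 1 of y, and then the ceiling of x
    -- is small enough for σ to lie in that lower group.
    have h1 : y ∈ herbrand L '' Set.Icc 0 ((n : ℝ) - 1) :=
      intermediate_value_Icc (by linarith)
        ((continuousOn_herbrand L).mono Set.Icc_subset_Ici_self) ⟨by rwa [herbrand_zero], h⟩
    obtain ⟨x, hx, rfl⟩ := h1
    refine ⟨x, hx.1, rfl, ?_⟩
    rw [mem_lowerRam_iff, ← hn, Nat.cast_le]
    have h2 : ⌈x⌉₊ ≤ n - 1 := by
      rw [Nat.ceil_le, Nat.cast_sub hn1]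
      simpa using hx.2
    omega

/-- The point is that y is attained by the Herbrand function. The term of the identity alone
contributes x/|G|, so the value at x = |G|y is already at least y. -/
theorem one_mem_upperRamFin {y : ℝ} (hy : 0 ≤ y) :
    (1 : L ≃ₐ[LaurentSeries k] L) ∈ upperRamFin L y := by
  have := Fintype.ofFinite (L ≃ₐ[LaurentSeries k] L)
  obtain ⟨c, hcdef⟩ : ∃ c : ℝ, (Nat.card (L ≃ₐ[LaurentSeries k] L) : ℝ) = c := ⟨_, rfl⟩
  have hc : 0 < c := hcdef ▸ Nat.cast_pos.2 Nat.card_pos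
  have hle : y ≤ herbrand L (c * y) := by
    rw [herbrand_eq L (by positivity), hcdef, le_div_iff₀ hc, mul_comm]
    have h1 : herbrandTerm (ram (integralClosure (PowerSeries k) L)
        (1 : L ≃ₐ[LaurentSeries k] L)) (c * y) = c * y := by
      rw [ram_one]; simp [herbrandTerm]
    refine h1.symm.le.trans ?_
    exact Finset.single_le_sum (f := fun σ : L ≃ₐ[LaurentSeries k] L =>
      herbrandTerm (ram (integralClosure (PowerSeries k) L) σ) (c * y))
      (fun σ _ => herbrandTerm_nonneg (one_le_ram L σ) (by positivity)) (Finset.mem_univ 1)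
  obtain ⟨x, hx, rfl⟩ : y ∈ herbrand L '' Set.Icc 0 (c * y) :=
    intermediate_value_Icc (by positivity)
      ((continuousOn_herbrand L).mono Set.Icc_subset_Ici_self) ⟨by rwa [herbrand_zero], hle⟩
  refine ⟨x, hx.1, rfl, ?_⟩
  rw [mem_lowerRam_iff, ram_one]
  exact le_top

end UpperNumbering

/-! ### Upper numbering groups of the absolute Galois group -/

section UpperRam

variable {k : Type*} [Field k]

/-- Restriction of automorphisms to a normal subextension of the algebraic closure. -/
abbrev galRes (L : IntermediateField (LaurentSeries k) (AlgebraicClosure (LaurentSeries k)))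
    [Normal (LaurentSeries k) L] : Inertia k →* (L ≃ₐ[LaurentSeries k] L) :=
  AlgEquiv.restrictNormalHom L

theorem coe_galRes (L : IntermediateField (LaurentSeries k) (AlgebraicClosure (LaurentSeries k)))
    [Normal (LaurentSeries k) L] (σ : Inertia k) (x : L) :
    ((galRes L σ x : L) : AlgebraicClosure (LaurentSeries k)) = σ x :=
  AlgEquiv.restrictNormal_commutes σ L x

theorem galRes_surjective
    (L : IntermediateField (LaurentSeries k) (AlgebraicClosure (LaurentSeries k)))
    [Normal (LaurentSeries k) L] : Function.Surjective (galRes L) :=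
  AlgEquiv.restrictNormalHom_surjective _

theorem galRes_eq_galRes_iff
    (L : IntermediateField (LaurentSeries k) (AlgebraicClosure (LaurentSeries k)))
    [Normal (LaurentSeries k) L] {σ τ : Inertia k} :
    galRes L σ = galRes L τ ↔ ∀ x ∈ L, σ x = τ x := by
  constructor
  · intro h x hx
    have h1 := congrArg Subtype.val (DFunLike.congr_fun h ⟨x, hx⟩)
    rwa [coe_galRes, coe_galRes] at h1
  · intro h
    ext x
    rw [coe_galRes, coe_galRes, h x x.2]

variable [IsAlgClosed k]

/-- The criterion `mem_upperRamFin_iff` turns this into the comparison of `ramTot` in L and in M. A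
trivial restriction to M is treated separately, since there `ramTot` is infinite and its `toNat` is
0. -/
theorem galRes_mem_upperRamFin_of_le
    {M L : IntermediateField (LaurentSeries k) (AlgebraicClosure (LaurentSeries k))}
    [FiniteDimensional (LaurentSeries k) L] [IsGalois (LaurentSeries k) L]
    [FiniteDimensional (LaurentSeries k) M] [IsGalois (LaurentSeries k) M] (hML : M ≤ L)
    {y : ℝ} (hy : 0 ≤ y) {σ : Inertia k} (h : galRes L σ ∈ upperRamFin L y) :
    galRes M σ ∈ upperRamFin M y := by
  by_cases hM : galRes M σ = 1
  · rw [hM]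
    exact one_mem_upperRamFin M hy
  have hL : galRes L σ ≠ 1 := by
    intro h1
    apply hM
    rw [← map_one (galRes M), galRes_eq_galRes_iff]
    rw [← map_one (galRes L), galRes_eq_galRes_iff] at h1
    exact fun x hx => h1 x (hML hx)
  let : Algebra M L := (IntermediateField.inclusion hML).toAlgebra
  have : IsScalarTower (LaurentSeries k) M L :=
    IsScalarTower.of_algebraMap_eq fun a => ((IntermediateField.inclusion hML).commutes a).symm
  have : IsScalarTower (PowerSeries k) M L := IsScalarTower.of_algebraMap_eq fun a => rfl
  have := Fintype.ofFinite (L ≃ₐ[LaurentSeries k] L)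
  have := Fintype.ofFinite (M ≃ₐ[LaurentSeries k] M)
  have hres : AlgEquiv.restrictNormalHom M (galRes L σ) = galRes M σ := by
    ext x
    rw [coe_galRes]
    have h1 := AlgEquiv.restrictNormal_commutes (galRes L σ) M x
    have h2 := congrArg Subtype.val h1
    rw [coe_galRes] at h2
    exact h2
  rw [mem_upperRamFin_iff L hL hy] at h
  rw [mem_upperRamFin_iff M hM hy]
  have hle := ramTot_le_of_restrict (M := M) (galRes L σ)
  rw [hres] at hle
  obtain ⟨a, ha⟩ := ENat.ne_top_iff_exists.1 (ramTot_ne_top (mt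
    (ram_eq_top_iff (B := integralClosure (PowerSeries k) L)).1 hL))
  obtain ⟨b, hb⟩ := ENat.ne_top_iff_exists.1 (ramTot_ne_top (mt
    (ram_eq_top_iff (B := integralClosure (PowerSeries k) M)).1 hM))
  rw [← ha, ← hb] at hle
  rw [← ha, ENat.toNat_natCast] at h
  rw [← hb, ENat.toNat_natCast]
  have hle' : a * Fintype.card (M ≃ₐ[LaurentSeries k] M) ≤
    Fintype.card (L ≃ₐ[LaurentSeries k] L) * b := by exact_mod_cast hle
  have hle2 : (a : ℝ) * Fintype.card (M ≃ₐ[LaurentSeries k] M) ≤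
    Fintype.card (L ≃ₐ[LaurentSeries k] L) * b := by exact_mod_cast hle'
  have hc : (0 : ℝ) < Fintype.card (L ≃ₐ[LaurentSeries k] L) := by
    exact_mod_cast Fintype.card_pos
  have hc' : (0 : ℝ) < Fintype.card (M ≃ₐ[LaurentSeries k] M) := by
    exact_mod_cast Fintype.card_pos
  refine le_of_mul_le_mul_left ?_ hc
  nlinarith

/-- An element of a finite Galois group that lies in the upper numbering groups of all larger
finite extensions comes from the upper numbering group of the absolute Galois group. -/
theorem exists_mem_upperRam
    (E : IntermediateField (LaurentSeries k) (AlgebraicClosure (LaurentSeries k)))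
    [FiniteDimensional (LaurentSeries k) E] [IsGalois (LaurentSeries k) E]
    {y : ℝ} (hy : 0 ≤ y) (T : Set (E ≃ₐ[LaurentSeries k] E))
    (h : ∀ (L : IntermediateField (LaurentSeries k) (AlgebraicClosure (LaurentSeries k)))
      [FiniteDimensional (LaurentSeries k) L] [IsGalois (LaurentSeries k) L], E ≤ L →
      ∃ σ : Inertia k, galRes L σ ∈ upperRamFin L y ∧ galRes E σ ∈ T) :
    ∃ σ ∈ upperRam k y, galRes E σ ∈ T := by
  -- All finite Galois subextensions lie in Ω, which is Galois over k((t)), so its automorphism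
  -- group is compact. The sets D L of admissible automorphisms will be nonempty, closed and
  -- directed.
  let Ω := separableClosure (LaurentSeries k) (AlgebraicClosure (LaurentSeries k))
  let ι := {L : IntermediateField (LaurentSeries k) (AlgebraicClosure (LaurentSeries k)) //
    FiniteDimensional (LaurentSeries k) L ∧ IsGalois (LaurentSeries k) L ∧ E ≤ L}
  have hfin : ∀ L : ι, FiniteDimensional (LaurentSeries k) L.1 := fun L => L.2.1
  have hgal : ∀ L : ι, IsGalois (LaurentSeries k) L.1 := fun L => L.2.2.1
  have hsep : ∀ L : ι, L.1 ≤ Ω := fun L => le_separableClosure _ _ _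
  let D : ι → Set (Ω ≃ₐ[LaurentSeries k] Ω) := fun L =>
    galRes Ω '' {σ | galRes L.1 σ ∈ upperRamFin L.1 y ∧ galRes E σ ∈ T}
  have hEsep : E ≤ Ω := le_separableClosure _ _ _
  have hmem : ∀ (L : ι) (σ : Inertia k), galRes Ω σ ∈ D L ↔
      galRes L.1 σ ∈ upperRamFin L.1 y ∧ galRes E σ ∈ T := by
    intro L σ
    refine ⟨?_, fun h => ⟨σ, h, rfl⟩⟩
    rintro ⟨τ, hτ, hτσ⟩
    rw [galRes_eq_galRes_iff] at hτσ
    rwa [← (galRes_eq_galRes_iff L.1).2 fun x hx => hτσ x (hsep L hx),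
      ← (galRes_eq_galRes_iff E).2 fun x hx => hτσ x (hEsep hx)]
  -- Membership in D L depends only on the restriction to L (which contains E), so the complement is
  -- a union of cosets of an open subgroup.
  have hclosed : ∀ L : ι, IsClosed (D L) := by
    intro L
    let U := (IntermediateField.restrict (hsep L)).fixingSubgroup
    have hU : IsOpen (U : Set (Ω ≃ₐ[LaurentSeries k] Ω)) := by
      have : FiniteDimensional (LaurentSeries k) (IntermediateField.restrict (hsep L)) :=
        LinearEquiv.finiteDimensional
          (IntermediateField.restrictAlgEquiv (hsep L)).toLinearEquiv
      exact IntermediateField.fixingSubgroup_isOpen _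
    rw [← isOpen_compl_iff, isOpen_iff_mem_nhds]
    intro τ hτ
    refine Filter.mem_of_superset ((hU.preimage (continuous_const_mul τ⁻¹)).mem_nhds
      (by simp [U.one_mem])) ?_
    intro τ' hτ' hτ'D
    apply hτ
    obtain ⟨σ, rfl⟩ := galRes_surjective Ω τ
    obtain ⟨σ', rfl⟩ := galRes_surjective Ω τ'
    rw [hmem] at hτ'D ⊢
    have h1 : ∀ x ∈ L.1, σ' x = σ x := by
      intro x hx
      have h2 : (galRes Ω σ)⁻¹ * galRes Ω σ' ∈ U := hτ'
      rw [← map_inv, ← map_mul, IntermediateField.mem_fixingSubgroup_iff] at h2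
      have h3 := h2 ⟨x, hsep L hx⟩ ((IntermediateField.mem_restrict (hsep L) _).2 hx)
      have h4 := congrArg Subtype.val h3
      rw [coe_galRes] at h4
      have h5 := congrArg σ h4
      simpa [AlgEquiv.mul_apply] using h5
    rwa [← (galRes_eq_galRes_iff L.1).2 h1,
      ← (galRes_eq_galRes_iff E).2 fun x hx => h1 x (L.2.2.2 hx)]
  have : Nonempty ι := ⟨⟨E, inferInstance, inferInstance, le_rfl⟩⟩
  have hdir : Directed (· ⊇ ·) D := by
    intro L L'
    have : IsGalois (LaurentSeries k) (L.1 ⊔ L'.1 : IntermediateField _ _) := inferInstance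
    let N : ι := ⟨L.1 ⊔ L'.1, inferInstance, this, L.2.2.2.trans le_sup_left⟩
    refine ⟨N, ?_, ?_⟩
    · rintro _ ⟨σ, hσ, rfl⟩
      exact ⟨σ, ⟨galRes_mem_upperRamFin_of_le (L := N.1) le_sup_left hy hσ.1, hσ.2⟩, rfl⟩
    · rintro _ ⟨σ, hσ, rfl⟩
      exact ⟨σ, ⟨galRes_mem_upperRamFin_of_le (L := N.1) le_sup_right hy hσ.1, hσ.2⟩, rfl⟩
  have hne : ∀ L, (D L).Nonempty := by
    intro L
    obtain ⟨σ, hσ⟩ := h L.1 L.2.2.2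
    exact ⟨_, σ, hσ, rfl⟩
  obtain ⟨τ, hτ⟩ := IsCompact.nonempty_iInter_of_directed_nonempty_isCompact_isClosed D hdir hne
    (fun L => (hclosed L).isCompact) hclosed
  obtain ⟨σ, rfl⟩ := galRes_surjective Ω τ
  rw [Set.mem_iInter] at hτ
  refine ⟨σ, fun L _ _ => ?_, ((hmem ⟨E, inferInstance, inferInstance, le_rfl⟩ σ).1 (hτ _)).2⟩
  -- An arbitrary finite Galois L need not contain E; the compositum does, and upper groups restrict
  -- from it to L.
  have hN : IsGalois (LaurentSeries k) (L ⊔ E : IntermediateField _ _) := inferInstance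
  let N : ι := ⟨L ⊔ E, inferInstance, hN, le_sup_right⟩
  exact galRes_mem_upperRamFin_of_le (L := N.1) le_sup_left hy ((hmem N σ).1 (hτ N)).1

end UpperRam

/-! ### Wild automorphisms fix tame elements -/

section Tame

open IsDiscreteValuationRing hiding maximalIdeal

universe w

variable {k : Type w} [Field k] [IsAlgClosed k]
variable {L : Type w} [Field L] [Algebra (LaurentSeries k) L] [Algebra (PowerSeries k) L]
    [IsScalarTower (PowerSeries k) (LaurentSeries k) L]
    [FiniteDimensional (LaurentSeries k) L] [Algebra.IsSeparable (LaurentSeries k) L]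

/-- The embedding of the constants. -/
abbrev constInt (k L : Type w) [Field k] [Field L] [Algebra (PowerSeries k) L] :
    k →+* integralClosure (PowerSeries k) L :=
  (algebraMap (PowerSeries k) (integralClosure (PowerSeries k) L)).comp PowerSeries.C

theorem coe_constInt (a : k) : ((constInt k L a : integralClosure (PowerSeries k) L) : L) =
    algebraMap (LaurentSeries k) L (HahnSeries.C a) := by
  rw [← HahnSeries.ofPowerSeries_C, ← LaurentSeries.coe_algebraMap,
    ← IsScalarTower.algebraMap_apply]
  rfl

theorem smul_constInt (σ : L ≃ₐ[LaurentSeries k] L) (a : k) :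
    σ • constInt k L a = constInt k L a := by
  rw [RingHom.comp_apply, Algebra.algebraMap_eq_smul_one, smul_comm, smul_one]

/-- A root of unity of order prime to `p` that is congruent to `1` is trivial. -/
theorem eq_one_of_pow_eq_one {r : ℕ} (hr : (r : k) ≠ 0)
    {x : integralClosure (PowerSeries k) L} (hx : ¬ IsUnit (x - 1)) (hxr : x ^ r = 1) : x = 1 := by
  have h1 := mul_geom_sum x r
  rw [hxr, sub_self, mul_eq_zero] at h1
  refine sub_eq_zero.1 (h1.resolve_right fun h2 => ?_)
  -- If x ≠ 1, the geometric sum vanishes. It is congruent to r modulo x - 1, so x - 1 would divide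
  -- the unit r.
  have h3 : x - 1 ∣ (∑ i ∈ Finset.range r, x ^ i) - r := by
    have : (∑ i ∈ Finset.range r, x ^ i) - r = ∑ i ∈ Finset.range r, (x ^ i - 1) := by simp
    rw [this]
    exact Finset.dvd_sum fun i _ => by simpa using sub_dvd_pow_sub_pow x 1 i
  obtain ⟨z, hz⟩ := h3
  apply hx
  refine isUnit_of_dvd_unit (y := (r : integralClosure (PowerSeries k) L))
    ⟨-z, by linear_combination h2 - hz⟩ ?_
  rw [← map_natCast (constInt k L)]
  exact (isUnit_iff_ne_zero.2 hr).map _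

/-- An automorphism that is trivial modulo the square of the maximal ideal fixes the elements with
a fixed power of exponent prime to `p`. -/
theorem smul_eq_of_two_le_ram {σ : L ≃ₐ[LaurentSeries k] L}
    (hσ : 2 ≤ ram (integralClosure (PowerSeries k) L) σ) {r : ℕ} (hr : (r : k) ≠ 0)
    {x : integralClosure (PowerSeries k) L} (hx : σ • x ^ r = x ^ r) : σ • x = x := by
  by_cases hx0 : x = 0
  · rw [hx0, smul_zero]
  obtain ⟨ϖ, hϖ⟩ := exists_irreducible (integralClosure (PowerSeries k) L)
  have hdvd : ∀ b : integralClosure (PowerSeries k) L, ϖ ^ 2 ∣ σ • b - b := fun b => by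
    rw [← addVal_le_iff_dvd, hϖ.addVal_pow]
    exact hσ.trans (ram_le σ b)
  obtain ⟨n, v, rfl⟩ := eq_unit_mul_pow_irreducible hx0 hϖ
  obtain ⟨a, ha⟩ := hdvd ϖ
  obtain ⟨b, hb⟩ := hdvd v
  set x := (v : integralClosure (PowerSeries k) L) * ϖ ^ n with hxdef
  -- This w is the quotient of σx by x. It is congruent to 1 modulo ϖ, and its r-th power is 1.
  let w := (1 + ϖ * (ϖ * b * ((v⁻¹ : _ˣ) : integralClosure (PowerSeries k) L))) * (1 + ϖ * a) ^ n
  have hw : σ • x = w * x := by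
    have h1 : σ • ϖ = ϖ * (1 + ϖ * a) := by linear_combination ha
    have h2 : σ • (v : integralClosure (PowerSeries k) L) =
        v * (1 + ϖ * (ϖ * b * ((v⁻¹ : _ˣ) : integralClosure (PowerSeries k) L))) := by
      linear_combination hb - ϖ ^ 2 * b * v.mul_inv
    rw [hxdef, smul_mul', smul_pow', h1, h2, mul_pow]
    ring
  have hw1 : w = 1 := by
    refine eq_one_of_pow_eq_one hr ?_ ?_
    · have h1 : ϖ ∣ w - 1 := by
        have h2 : ϖ ∣ (1 + ϖ * a) ^ n - 1 := by
          have h3 := sub_dvd_pow_sub_pow (1 + ϖ * a) 1 n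
          rw [one_pow] at h3
          exact (Dvd.intro a (by ring)).trans h3
        obtain ⟨z, hz⟩ := h2
        refine ⟨(ϖ * b * ((v⁻¹ : _ˣ) : integralClosure (PowerSeries k) L)) * (1 + ϖ * a) ^ n + z,
          ?_⟩
        simp only [w]
        linear_combination hz
      exact fun hu => hϖ.not_isUnit (isUnit_of_dvd_unit h1 hu)
    · rw [smul_pow', hw, mul_pow] at hx
      exact mul_right_cancel₀ (pow_ne_zero r hx0) (by rw [hx, one_mul])
  rw [hw, hw1, one_mul]

theorem ramTot_of_ram_eq_one [Fintype (L ≃ₐ[LaurentSeries k] L)] {σ : L ≃ₐ[LaurentSeries k] L}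
    (hσ : ram (integralClosure (PowerSeries k) L) σ = 1)
    (h1 : ∀ σ : L ≃ₐ[LaurentSeries k] L, 1 ≤ ram (integralClosure (PowerSeries k) L) σ) :
    ramTot (integralClosure (PowerSeries k) L) σ = Fintype.card (L ≃ₐ[LaurentSeries k] L) := by
  rw [ramTot, hσ, Finset.sum_congr rfl fun s' _ => min_eq_right (h1 s')]
  simp

end Tame

/-! ### Positive upper numbering groups act trivially on tame roots -/

section WildElements

variable {k : Type*} [Field k] [IsAlgClosed k]

/-- If the ramification number is 1, all truncations are 1 and `ramTot` is |G|, so the upper number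
is 0 and cannot reach y > 0. -/
theorem two_le_ram_of_mem_upperRamFin
    (L : IntermediateField (LaurentSeries k) (AlgebraicClosure (LaurentSeries k)))
    [FiniteDimensional (LaurentSeries k) L] [IsGalois (LaurentSeries k) L]
    {y : ℝ} (hy : 0 < y) {σ : L ≃ₐ[LaurentSeries k] L} (h : σ ∈ upperRamFin L y) :
    2 ≤ ram (integralClosure (PowerSeries k) L) σ := by
  by_cases hσ : σ = 1
  · rw [hσ, ram_one]; exact le_top
  have := Fintype.ofFinite (L ≃ₐ[LaurentSeries k] L)
  by_contra hlt
  have h1 : ram (integralClosure (PowerSeries k) L) σ = 1 := by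
    refine le_antisymm ?_ (one_le_ram L σ)
    rw [not_le, show (2 : ℕ∞) = 1 + 1 from one_add_one_eq_two.symm] at hlt
    exact (ENat.lt_add_one_iff ENat.one_ne_top).1 hlt
  rw [mem_upperRamFin_iff L hσ hy.le, ramTot_of_ram_eq_one h1 (one_le_ram L),
    ENat.toNat_natCast] at h
  have hc : (0 : ℝ) < Fintype.card (L ≃ₐ[LaurentSeries k] L) := by
    exact_mod_cast Fintype.card_pos
  nlinarith

theorem exists_finite_galois_mem {K : Type*} [Field K] {S : Set (AlgebraicClosure K)}
    (hS : S.Finite) (hsep : ∀ x ∈ S, IsSeparable K x) :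
    ∃ L : IntermediateField K (AlgebraicClosure K),
      FiniteDimensional K L ∧ IsGalois K L ∧ S ⊆ L := by
  have := hS.to_subtype
  have h1 : FiniteDimensional K (IntermediateField.adjoin K S) :=
    IntermediateField.finiteDimensional_adjoin fun x _ => Algebra.IsIntegral.isIntegral x
  have h2 : Algebra.IsSeparable K (IntermediateField.adjoin K S) :=
    (IntermediateField.isSeparable_adjoin_iff_isSeparable K _).2 hsep
  have h3 : IntermediateField.normalClosure K (IntermediateField.adjoin K S) (AlgebraicClosure K) ≤
      separableClosure K (AlgebraicClosure K) := by
    rw [← separableClosure.normalClosure_eq_self]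
    exact IntermediateField.normalClosure_mono _ _ (le_separableClosure _ _ _)
  have h4 := (le_separableClosure_iff K _ _).1 h3
  refine ⟨IntermediateField.normalClosure K (IntermediateField.adjoin K S) (AlgebraicClosure K),
    inferInstance, ⟨⟩, ?_⟩
  exact (IntermediateField.subset_adjoin K S).trans
    (IntermediateField.le_normalClosure (IntermediateField.adjoin K S))

theorem isSeparable_of_pow_eq {K E : Type*} [Field K] [Field E] [Algebra K E] {n : ℕ}
    (hn : (n : K) ≠ 0) {u : E} {a : K} (ha : a ≠ 0) (hu : u ^ n = algebraMap K E a) :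
    IsSeparable K u := by
  have h1 : (X ^ n - C a : K[X]).Separable := separable_X_pow_sub_C a hn ha
  exact h1.of_dvd (minpoly.dvd K u (by simp [hu]))

theorem unif_ne_zero (k : Type*) [Field k] : unif k ≠ 0 := by
  simp [unif]

theorem algebraMap_X_eq_unif (k : Type*) [Field k] :
    algebraMap (PowerSeries k) (LaurentSeries k) PowerSeries.X = unif k := by
  rw [LaurentSeries.coe_algebraMap, HahnSeries.ofPowerSeries_X]
  rfl

theorem natCast_laurentSeries_ne_zero {n : ℕ} (hn : (n : k) ≠ 0) : (n : LaurentSeries k) ≠ 0 := by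
  rw [← map_natCast (HahnSeries.C : k →+* LaurentSeries k)]
  exact (_root_.map_ne_zero _).2 hn

theorem isIntegral_of_pow_eq_unif {L : Type*} [Field L] [Algebra (LaurentSeries k) L]
    [Algebra (PowerSeries k) L] [IsScalarTower (PowerSeries k) (LaurentSeries k) L] {n : ℕ}
    (hn : n ≠ 0) {u : L} (hu : u ^ n = algebraMap (LaurentSeries k) L (unif k)) :
    IsIntegral (PowerSeries k) u := by
  refine IsIntegral.of_pow (Nat.pos_of_ne_zero hn) ?_
  rw [hu, ← algebraMap_X_eq_unif, ← IsScalarTower.algebraMap_apply]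
  exact isIntegral_algebraMap

/-- The upper numbering groups of positive index fix the tame roots of the uniformizer. -/
theorem apply_eq_of_mem_upperRam {y : ℝ} (hy : 0 < y) {σ : Inertia k} (h : σ ∈ upperRam k y)
    {n : ℕ} (hn : (n : k) ≠ 0) {u : AlgebraicClosure (LaurentSeries k)} (hu : u ^ n = unifCl k) :
    σ u = u := by
  obtain ⟨L, _, _, hL⟩ := exists_finite_galois_mem (S := {u}) (Set.finite_singleton u) (by
    rintro _ rfl
    exact isSeparable_of_pow_eq (natCast_laurentSeries_ne_zero hn) (unif_ne_zero k) hu)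
  have huL : u ∈ L := hL rfl
  have h2 := two_le_ram_of_mem_upperRamFin L hy (h L)
  have hn0 : n ≠ 0 := by rintro rfl; simp at hn
  have hu' : (⟨u, huL⟩ : L) ^ n = algebraMap (LaurentSeries k) L (unif k) := Subtype.ext hu
  have hui : IsIntegral (PowerSeries k) (⟨u, huL⟩ : L) := isIntegral_of_pow_eq_unif hn0 hu'
  have h3 := smul_eq_of_two_le_ram (x := ⟨⟨u, huL⟩, hui⟩) h2 hn (by
    apply Subtype.ext
    change galRes L σ (_ ^ n) = (⟨u, huL⟩ : L) ^ n
    change galRes L σ ((⟨u, huL⟩ : L) ^ n) = (⟨u, huL⟩ : L) ^ n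
    rw [hu', AlgEquiv.commutes])
  have h4 : galRes L σ ⟨u, huL⟩ = ⟨u, huL⟩ := congrArg Subtype.val h3
  have h5 := congrArg Subtype.val h4
  rwa [coe_galRes] at h5

end WildElements

/-! ### A uniformizer adapted to an Artin-Schreier extension -/

section ArtinSchreier

open IsDiscreteValuationRing hiding maximalIdeal

universe w

variable {k : Type w} [Field k]
variable {L : Type w} [Field L] [Algebra (LaurentSeries k) L] [Algebra (PowerSeries k) L]
    [IsScalarTower (PowerSeries k) (LaurentSeries k) L]
    [FiniteDimensional (LaurentSeries k) L] [Algebra.IsSeparable (LaurentSeries k) L]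

/-- The inverse of an Artin-Schreier root with a pole is a non-unit of the ring of integers. -/
theorem exists_inverse_asRoot {p h : ℕ} (hp : 1 < p) (hh : 0 < h)
    {U ε : integralClosure (PowerSeries k) L} (hU : ¬ IsUnit U) (hε : IsUnit ε) {y : L}
    (hy : (U : L) ^ h * (y ^ p - y) = ε) :
    ∃ Y : integralClosure (PowerSeries k) L, (Y : L) * y = 1 ∧ ¬ IsUnit Y ∧
      U ^ h * (1 - Y ^ (p - 1)) = ε * Y ^ p := by
  have hfr : IsFractionRing (integralClosure (PowerSeries k) L) L :=
    integralClosure.isFractionRing_of_finite_extension (LaurentSeries k) L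
  have hUh : ¬ IsUnit (U ^ h) := fun hu => hU ((isUnit_pow_iff hh.ne').1 hu)
  have hε0 : (ε : L) ≠ 0 := fun h0 => hε.ne_zero (Subtype.ext h0)
  have hy0 : y ≠ 0 := by
    rintro rfl
    rw [zero_pow (by omega), sub_zero, mul_zero] at hy
    exact hε0 hy.symm
  -- In a valuation ring y or its inverse is integral. If y were, the non-unit U^h would divide the
  -- unit ε. The equation for Y = 1/y is the Artin-Schreier equation multiplied by U^h Y^p.
  rcases ValuationRing.isInteger_or_isInteger (integralClosure (PowerSeries k) L) y with
    ⟨z, hz⟩ | ⟨Y, hY⟩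
  · exfalso
    have h1 : U ^ h * (z ^ p - z) = ε := by
      apply Subtype.ext
      rw [← hy, ← hz]
      rfl
    exact hUh (isUnit_of_dvd_unit ⟨_, h1.symm⟩ hε)
  · have hYy : (Y : L) * y = 1 := by
      change algebraMap (integralClosure (PowerSeries k) L) L Y * y = 1
      rw [hY, inv_mul_cancel₀ hy0]
    have heq : U ^ h * (1 - Y ^ (p - 1)) = ε * Y ^ p := by
      apply Subtype.ext
      change (U : L) ^ h * (1 - (Y : L) ^ (p - 1)) = ε * (Y : L) ^ p
      obtain ⟨q, rfl⟩ := Nat.exists_eq_add_of_le' hp.le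
      have h2 : (Y : L) ^ (q + 1) * y ^ (q + 1) = 1 := by rw [← mul_pow, hYy, one_pow]
      rw [← hy, Nat.add_sub_cancel]
      linear_combination (-(U : L) ^ h) * h2 + (U : L) ^ h * (Y : L) ^ q * hYy
    refine ⟨Y, hYy, fun hu => ?_, heq⟩
    exact hUh (isUnit_of_dvd_unit ⟨_, heq.symm⟩ (hε.mul (hu.pow p)))

/-- Because Y is a non-unit, 1 - Y^(p-1) is a unit and drops out of the valuations. -/
theorem mul_addVal_eq_mul_addVal {p h : ℕ} (hp : 1 < p)
    {U Y ε : integralClosure (PowerSeries k) L} (hε : IsUnit ε) (hY : ¬ IsUnit Y)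
    (heq : U ^ h * (1 - Y ^ (p - 1)) = ε * Y ^ p) :
    p * addVal _ Y = h * addVal _ U := by
  have h1 : IsUnit (1 - Y ^ (p - 1)) := by
    rcases IsLocalRing.isUnit_or_isUnit_one_sub_self (Y ^ (p - 1)) with h | h
    · exact absurd ((isUnit_pow_iff (by omega)).1 h) hY
    · exact h
  have h2 := congrArg (addVal _) heq
  rw [addVal_mul, addVal_mul, addVal_pow, addVal_pow, addVal_eq_zero_iff.2 h1,
    addVal_eq_zero_iff.2 hε, add_zero, zero_add, nsmul_eq_mul, nsmul_eq_mul] at h2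
  exact h2.symm

theorem card_le_mul_card_stabilizer {G X : Type*} [Group G] [Finite G] [MulAction G X] (x : X)
    {s : Finset X} (hs : ∀ g : G, g • x ∈ s) :
    Nat.card G ≤ s.card * Nat.card (MulAction.stabilizer G x) := by
  rw [← (MulAction.stabilizer G x).card_mul_index, mul_comm, MulAction.index_stabilizer]
  gcongr
  rw [← Set.ncard_coe_finset]
  refine Set.ncard_le_ncard ?_ s.finite_toSet
  rintro _ ⟨g, rfl⟩
  exact hs g

theorem card_roots_pow_sub_le {p : ℕ} (hp : 1 < p) (a : L) :
    ∃ s : Finset L, s.card ≤ p ∧ ∀ y, y ^ p - y = a → y ∈ s := by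
  classical
  have hd : (X ^ p - X - C a : L[X]).natDegree = p := by
    have h1 : (X ^ p - X - C a : L[X]) = X ^ p - (X + C a) := by ring
    rw [h1, natDegree_sub_eq_left_of_natDegree_lt]
    · simp
    · simpa using hp
  have hne : (X ^ p - X - C a : L[X]) ≠ 0 := by
    intro h0
    rw [h0, natDegree_zero] at hd
    omega
  refine ⟨(X ^ p - X - C a : L[X]).roots.toFinset,
    (Multiset.toFinset_card_le _).trans ((card_roots' _).trans hd.le), fun y hy => ?_⟩
  rw [Multiset.mem_toFinset, mem_roots hne]
  simp [IsRoot, hy]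

variable [IsAlgClosed k]

/-- The data attached to a Galois extension of `k((t))` that contains a root `u` of `t` of order
`r` and an Artin-Schreier root `y` with a pole of order `h` in `u`. -/
theorem exists_uniformizer_of_asRoot [IsGalois (LaurentSeries k) L] {p h r : ℕ}
    (hp : p.Prime) (hh : ¬ p ∣ h) (hr : 0 < r)
    {U Y ε : integralClosure (PowerSeries k) L}
    (hUr : U ^ r = algebraMap (PowerSeries k) _ PowerSeries.X) (hε : IsUnit ε)
    (hεfix : ∀ σ : L ≃ₐ[LaurentSeries k] L, σ • U = U → σ • ε = ε)
    {y : L} (hy : (U : L) ^ h * (y ^ p - y) = ε) (hYy : (Y : L) * y = 1) (hY : ¬ IsUnit Y)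
    (heq : U ^ h * (1 - Y ^ (p - 1)) = ε * Y ^ p)
    (H₁ H₂ : Subgroup (L ≃ₐ[LaurentSeries k] L)) (hH₁ : ∀ σ, σ ∈ H₁ ↔ σ • U = U)
    (hH₂ : ∀ σ, σ ∈ H₂ ↔ σ • U = U ∧ σ y = y) :
    ∃ (n a b : ℕ) (c : integralClosure (PowerSeries k) L), 0 < n ∧ h * b = 1 + p * a ∧
      U ^ a * c = Y ^ b ∧ addVal _ c = n ∧ addVal _ Y = (h * n : ℕ) ∧ (∀ t ∈ H₂, t • c = c) ∧
      Nat.card (L ≃ₐ[LaurentSeries k] L) = r * (p * n) ∧ Nat.card H₁ = p * n ∧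
      Nat.card H₂ = n := by
  have := Fintype.ofFinite H₂
  set e := Nat.card (L ≃ₐ[LaurentSeries k] L) with he
  have hepos : 0 < e := Nat.card_pos
  have hU0 : U ≠ 0 := by
    rintro rfl
    rw [zero_pow hr.ne', ← map_zero (algebraMap (PowerSeries k) _)] at hUr
    exact PowerSeries.X_ne_zero (injective_algebraMap_integralClosure hUr).symm
  have hY0 : Y ≠ 0 := by
    rintro rfl
    simp at hYy
  have hvX : r * addVal _ U = (e : ℕ∞) := by
    rw [he, IsGalois.card_aut_eq_finrank, ← addVal_X_eq_finrank, ← hUr,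
      addVal_pow, nsmul_eq_mul]
  obtain ⟨mU, hmU⟩ := ENat.ne_top_iff_exists.1 (mt addVal_eq_top_iff.1 hU0)
  obtain ⟨mY, hmY⟩ := ENat.ne_top_iff_exists.1 (mt addVal_eq_top_iff.1 hY0)
  have hpY := mul_addVal_eq_mul_addVal hp.one_lt hε hY heq
  rw [← hmU, ← hmY] at hpY
  rw [← hmU] at hvX
  have hpY' : p * mY = h * mU := by exact_mod_cast hpY
  have hvX' : r * mU = e := by exact_mod_cast hvX
  have hcop : Nat.Coprime p h := (Nat.Prime.coprime_iff_not_dvd hp).2 hh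
  obtain ⟨n, rfl⟩ : p ∣ mU := hcop.dvd_of_dvd_mul_left (Dvd.intro _ hpY')
  obtain rfl : mY = h * n := by
    apply Nat.eq_of_mul_eq_mul_left hp.pos
    rw [hpY']; ring
  have hn : 0 < n := by
    rcases Nat.eq_zero_or_pos n with rfl | hn
    · simp at hvX'; omega
    · exact hn
  -- Now v(U) = pn and v(Y) = hn. With b an inverse of h modulo p, the quotient c of Y^b by U^a has
  -- valuation (hb - pa)n = n.
  obtain ⟨a, b, hab⟩ : ∃ a b : ℕ, h * b = 1 + p * a := by
    obtain ⟨b, hb⟩ := Nat.exists_mul_mod_eq_one_of_coprime hcop.symm hp.one_lt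
    refine ⟨h * b / p, b, ?_⟩
    conv_lhs => rw [← Nat.mod_add_div (h * b) p]
    rw [hb.2]
  have hdvd : U ^ a ∣ Y ^ b := by
    rw [← addVal_le_iff_dvd, addVal_pow, addVal_pow, ← hmU, ← hmY, nsmul_eq_mul, nsmul_eq_mul]
    norm_cast
    calc a * (p * n) ≤ (1 + p * a) * n := by ring_nf; omega
      _ = b * (h * n) := by rw [← hab]; ring
  obtain ⟨c, hc⟩ := hdvd
  have hvc : addVal _ c = n := by
    have h1 := congrArg (addVal _) hc
    rw [addVal_mul, addVal_pow, addVal_pow, ← hmU, ← hmY, nsmul_eq_mul, nsmul_eq_mul] at h1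
    have h2 : ((b : ℕ∞) * ((h * n : ℕ) : ℕ∞)) = (a : ℕ∞) * ((p * n : ℕ) : ℕ∞) + n := by
      norm_cast
      calc b * (h * n) = (h * b) * n := by ring
        _ = _ := by rw [hab]; ring
    rw [h2] at h1
    exact (ENat.add_right_injective_of_ne_top (by exact_mod_cast ENat.natCast_ne_top (a * (p * n)))
      h1).symm
  have hcfix : ∀ t ∈ H₂, t • c = c := by
    intro t ht
    obtain ⟨htU, hty⟩ := (hH₂ t).1 ht
    have htY : t • Y = Y := by
      have h1 : ((t • Y : integralClosure (PowerSeries k) L) : L) * y = 1 := by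
        rw [coe_gal_smul]
        conv_lhs => rw [← hty]
        rw [← map_mul, hYy, map_one]
      apply Subtype.ext
      have hy0 : y ≠ 0 := right_ne_zero_of_mul_eq_one hYy
      exact mul_right_cancel₀ hy0 (h1.trans hYy.symm)
    have h1 := congrArg (t • ·) hc
    simp only [smul_mul', smul_pow', htU, htY] at h1
    exact (mul_left_cancel₀ (pow_ne_zero a hU0) (hc.symm.trans h1)).symm
  -- Three upper bounds, |G| ≤ r|H₁|, |H₁| ≤ p|H₂| and |H₂| ≤ n, together with |G| = rpn force
  -- equality everywhere. The first two count roots of polynomials.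
  have hb1 : e ≤ r * Nat.card H₁ := by
    classical
    have hst : MulAction.stabilizer (L ≃ₐ[LaurentSeries k] L) U = H₁ := by
      ext σ
      rw [MulAction.mem_stabilizer_iff, hH₁]
    have h1 := card_le_mul_card_stabilizer (G := L ≃ₐ[LaurentSeries k] L) U
      (s := (nthRoots r (U ^ r)).toFinset) (fun σ => by
        rw [Multiset.mem_toFinset, mem_nthRoots hr, ← smul_pow', hUr,
          Algebra.algebraMap_eq_smul_one, smul_comm, smul_one])
    rw [hst] at h1
    exact h1.trans (Nat.mul_le_mul_right _ ((Multiset.toFinset_card_le _).trans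
      (card_nthRoots r _)))
  have hb2 : Nat.card H₁ ≤ p * Nat.card H₂ := by
    obtain ⟨s, hs, hsy⟩ := card_roots_pow_sub_le hp.one_lt (y ^ p - y)
    have h1 := card_le_mul_card_stabilizer (G := H₁) y (s := s) (fun σ => hsy _ (by
      have h2 := congrArg (σ : L ≃ₐ[LaurentSeries k] L) hy
      have h3 : (σ : L ≃ₐ[LaurentSeries k] L) (U : L) = U := congrArg Subtype.val ((hH₁ _).1 σ.2)
      have h4 : (σ : L ≃ₐ[LaurentSeries k] L) (ε : L) = ε :=
        congrArg Subtype.val (hεfix _ ((hH₁ _).1 σ.2))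
      rw [map_mul, map_pow, h3, h4, ← hy, map_sub, map_pow] at h2
      exact mul_left_cancel₀ (pow_ne_zero h fun h0 => hU0 (Subtype.ext h0)) h2))
    have h2 : Nat.card (MulAction.stabilizer H₁ y) = Nat.card H₂ :=
      Nat.card_congr
        ⟨fun σ => ⟨σ.1.1, (hH₂ _).2 ⟨(hH₁ _).1 σ.1.2, σ.2⟩⟩,
          fun σ => ⟨⟨σ.1, (hH₁ _).2 ((hH₂ _).1 σ.2).1⟩, ((hH₂ _).1 σ.2).2⟩,
          fun σ => rfl, fun σ => rfl⟩
    rw [h2] at h1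
    exact h1.trans (Nat.mul_le_mul_right _ hs)
  have hb3 : Nat.card H₂ ≤ n := by
    obtain ⟨ϖ, hϖ⟩ := exists_irreducible (integralClosure (PowerSeries k) L)
    -- The H₂-norm of ϖ has valuation |H₂| and divides c, which has valuation n.
    have h1 := dvd_of_fixed H₂ (c := ∏ t : H₂, (t : L ≃ₐ[LaurentSeries k] L) • ϖ) (by
      rw [addVal_prod, Finset.sum_congr rfl fun t _ => by rw [addVal_smul, addVal_uniformizer hϖ]]
      simp) c hcfix (by rw [← one_le_addVal_iff, hvc]; exact_mod_cast hn)
    rw [← addVal_le_iff_dvd, hvc, addVal_prod,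
      Finset.sum_congr rfl fun t _ => by rw [addVal_smul, addVal_uniformizer hϖ]] at h1
    simpa using h1
  have hH2 : Nat.card H₂ = n := by
    refine le_antisymm hb3 ?_
    have h1 : r * (p * n) ≤ r * (p * Nat.card H₂) := by
      rw [hvX']; exact hb1.trans (Nat.mul_le_mul_left r hb2)
    exact Nat.le_of_mul_le_mul_left (Nat.le_of_mul_le_mul_left h1 hr) hp.pos
  have hH1 : Nat.card H₁ = p * n := by
    refine le_antisymm (hH2 ▸ hb2) ?_
    rw [← hvX'] at hb1
    exact Nat.le_of_mul_le_mul_left hb1 hr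
  exact ⟨n, a, b, c, hn, hab, hc.symm, hvc, hmY.symm, hcfix, hvX'.symm, hH1, hH2⟩

end ArtinSchreier

/-! ### The upper jump h/r of an Artin-Schreier root -/

section UpperJump

open IsDiscreteValuationRing hiding maximalIdeal

universe w

variable {k : Type w} [Field k]
variable {L : Type w} [Field L] [Algebra (LaurentSeries k) L] [Algebra (PowerSeries k) L]
    [IsScalarTower (PowerSeries k) (LaurentSeries k) L]
    [FiniteDimensional (LaurentSeries k) L] [Algebra.IsSeparable (LaurentSeries k) L]

/-- From σy = y + j follows σY = Y/(1 + jY), hence σc = c(1 + jY)^(-b). The linear term -bjYc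
dominates σc - c, because b and j are non-zero in k. -/
theorem addVal_smul_sub_self {a b : ℕ} (hb : (b : k) ≠ 0)
    {U Y c : integralClosure (PowerSeries k) L} (hU0 : U ≠ 0) (hY : ¬ IsUnit Y)
    (hc : U ^ a * c = Y ^ b) {y : L} (hYy : (Y : L) * y = 1) {σ : L ≃ₐ[LaurentSeries k] L}
    (hσU : σ • U = U) {j : k} (hj : j ≠ 0)
    (hσy : σ y = y + (constInt k L j : integralClosure (PowerSeries k) L)) :
    addVal _ (σ • c - c) = addVal _ c + addVal _ Y := by
  set J := constInt k L j
  have hJ : IsUnit J := (isUnit_iff_ne_zero.2 hj).map (constInt k L)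
  have hbu : IsUnit (b : integralClosure (PowerSeries k) L) := by
    rw [← map_natCast (constInt k L)]
    exact (isUnit_iff_ne_zero.2 hb).map (constInt k L)
  have hY0 : Y ≠ 0 := by
    rintro rfl
    simp at hYy
  have h1 : (1 + J * Y) * σ • Y = Y := by
    apply Subtype.ext
    change (1 + (J : L) * (Y : L)) * σ (Y : L) = Y
    have h2 : σ (Y : L) * (y + J) = 1 := by rw [← hσy, ← map_mul, hYy, map_one]
    linear_combination (Y : L) * h2 - σ (Y : L) * hYy
  have h3 : (1 + J * Y) ^ b * σ • c = c := by
    have h4 := congrArg (σ • ·) hc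
    simp only [smul_mul', smul_pow', hσU] at h4
    refine mul_left_cancel₀ (pow_ne_zero a hU0) ?_
    rw [hc, mul_left_comm, h4, ← mul_pow, h1]
  obtain ⟨z, hz⟩ : ∃ z, (1 + J * Y) ^ b = 1 + b * (J * Y) + (J * Y) ^ 2 * z := by
    have hd := (Polynomial.X ^ b : (integralClosure (PowerSeries k) L)[X]).binomExpansion 1 (J * Y)
    obtain ⟨z, hz⟩ := hd
    refine ⟨z, ?_⟩
    simp only [eval_pow, eval_X, one_pow, derivative_X_pow, eval_mul, mul_one] at hz
    simp at hz
    linear_combination hz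
  have hnu : ∀ d, IsUnit d → ∀ z, IsUnit (d + Y * z) := by
    intro d hd z
    have h5 : Y * z ∈ IsLocalRing.maximalIdeal (integralClosure (PowerSeries k) L) :=
      Ideal.mul_mem_right _ _ hY
    by_contra h6
    exact ((IsLocalRing.maximalIdeal _).sub_mem (show d + Y * z ∈ _ from h6) h5 :
      d + Y * z - Y * z ∈ _) (by simpa using hd)
  have hu1 : IsUnit ((1 + J * Y) ^ b) := by
    rw [mul_comm]
    exact (hnu 1 isUnit_one J).pow b
  have h7 : (1 + J * Y) ^ b * (σ • c - c) = -(c * (Y * (b * J + Y * (J ^ 2 * z)))) := by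
    rw [mul_sub, h3, hz]
    ring
  have h8 := congrArg (addVal _) h7
  rw [addVal_neg, addVal_mul, addVal_mul, addVal_mul, addVal_eq_zero_iff.2 hu1,
    addVal_eq_zero_iff.2 (hnu _ (hbu.mul hJ) _), zero_add, add_zero] at h8
  exact h8

theorem isUnit_eval₂_of_coeff_zero_ne {U : integralClosure (PowerSeries k) L} (hU : ¬ IsUnit U)
    {q : k[X]} (hq : q.coeff 0 ≠ 0) : IsUnit (q.eval₂ (constInt k L) U) := by
  have h1 : U ∣ q.eval₂ (constInt k L) U - constInt k L (q.coeff 0) := by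
    have h2 : X ∣ q - C (q.coeff 0) := by rw [X_dvd_iff]; simp
    obtain ⟨g, hg⟩ := h2
    refine ⟨g.eval₂ (constInt k L) U, ?_⟩
    have h3 := congrArg (eval₂ (constInt k L) U) hg
    rwa [eval₂_sub, eval₂_C, eval₂_mul, eval₂_X] at h3
  have h2 : IsUnit (constInt k L (q.coeff 0)) := (isUnit_iff_ne_zero.2 hq).map _
  by_contra h3
  have h4 : q.eval₂ (constInt k L) U - constInt k L (q.coeff 0) ∈
      IsLocalRing.maximalIdeal (integralClosure (PowerSeries k) L) := by
    obtain ⟨z, hz⟩ := h1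
    rw [hz]
    exact Ideal.mul_mem_right _ _ hU
  have h5 := (IsLocalRing.maximalIdeal (integralClosure (PowerSeries k) L)).sub_mem
    (show q.eval₂ (constInt k L) U ∈
      IsLocalRing.maximalIdeal (integralClosure (PowerSeries k) L) from h3) h4
  rw [sub_sub_cancel] at h5
  exact h5 h2

variable [IsAlgClosed k]

/-- The ramification of an extension of `k((t))` containing a root `u` of `t` of order `r` and an
Artin-Schreier root `y` with a pole of order `h` in `u`: the upper jump of `y` is `h / r`. -/
theorem ramTot_of_asRoot [IsGalois (LaurentSeries k) L] [Fintype (L ≃ₐ[LaurentSeries k] L)]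
    {p r : ℕ} [hp : Fact p.Prime] [CharP k p] (hr : ¬ p ∣ r) {φ : k[X]} (hh : ¬ p ∣ φ.natDegree)
    {u y : L} (hu : u ^ r = algebraMap (LaurentSeries k) L (unif k))
    (hy : y ^ p - y = φ.eval₂ ((algebraMap (LaurentSeries k) L).comp HahnSeries.C) u⁻¹) :
    (∃ σ : L ≃ₐ[LaurentSeries k] L, σ u = u ∧ σ y ≠ y ∧
      ramTot (integralClosure (PowerSeries k) L) σ * r =
        (r + φ.natDegree : ℕ) * Fintype.card (L ≃ₐ[LaurentSeries k] L)) ∧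
    ∀ σ : L ≃ₐ[LaurentSeries k] L, σ u = u → σ y ≠ y →
      ramTot (integralClosure (PowerSeries k) L) σ * r ≤
        (r + φ.natDegree : ℕ) * Fintype.card (L ≃ₐ[LaurentSeries k] L) := by
  have hr0 : r ≠ 0 := by rintro rfl; exact hr (dvd_zero p)
  have hrk : (r : k) ≠ 0 := by rwa [Ne, CharP.cast_eq_zero_iff k p]
  have hh0 : 0 < φ.natDegree := Nat.pos_of_ne_zero (by intro h; exact hh (h ▸ dvd_zero p))
  set h := φ.natDegree with hhdef
  let U : integralClosure (PowerSeries k) L := ⟨u, isIntegral_of_pow_eq_unif hr0 hu⟩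
  have hUr : U ^ r = algebraMap (PowerSeries k) _ PowerSeries.X := by
    apply Subtype.ext
    change u ^ r = algebraMap (PowerSeries k) L PowerSeries.X
    rw [hu, ← algebraMap_X_eq_unif, ← IsScalarTower.algebraMap_apply]
  have hU : ¬ IsUnit U := by
    intro hu
    have h1 := hu.pow r
    rw [hUr] at h1
    exact algebraMap_X_mem_maximalIdeal h1
  have hu0 : u ≠ 0 := by
    rintro rfl
    rw [zero_pow hr0, ← map_zero (algebraMap (LaurentSeries k) L)] at hu
    exact unif_ne_zero k ((algebraMap (LaurentSeries k) L).injective hu).symm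
  have hU0 : U ≠ 0 := fun h0 => hu0 (congrArg Subtype.val h0)
  -- This is u^h φ(1/u), a unit because its constant term is the leading coefficient of φ.
  let ε := φ.reverse.eval₂ (constInt k L) U
  have hε : IsUnit ε := by
    refine isUnit_eval₂_of_coeff_zero_ne hU ?_
    rw [coeff_zero_reverse, leadingCoeff_ne_zero]
    rintro rfl
    simp [hhdef] at hh0
  have hyε : (U : L) ^ h * (y ^ p - y) = ε := by
    have h1 : (ε : L) = φ.reverse.eval₂ ((algebraMap (LaurentSeries k) L).comp HahnSeries.C) u := by
      change (integralClosure (PowerSeries k) L).val (φ.reverse.eval₂ (constInt k L) U) = _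
      have h2 := hom_eval₂ φ.reverse (constInt k L)
        ((integralClosure (PowerSeries k) L).val : _ →+* L) U
      have h3 : ((integralClosure (PowerSeries k) L).val : _ →+* L).comp (constInt k L) =
          (algebraMap (LaurentSeries k) L).comp HahnSeries.C := by
        ext a
        exact coe_constInt a
      rw [h3] at h2
      exact h2
    let : Invertible u⁻¹ := invertibleOfNonzero (inv_ne_zero hu0)
    have h2 := eval₂_reverse_mul_pow ((algebraMap (LaurentSeries k) L).comp HahnSeries.C) u⁻¹ φ
    rw [invOf_eq_inv, inv_inv] at h2
    rw [hy, ← h2, h1, mul_comm, mul_assoc, ← mul_pow, inv_mul_cancel₀ hu0, one_pow, mul_one]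
  have hεfix : ∀ σ : L ≃ₐ[LaurentSeries k] L, σ • U = U → σ • ε = ε := by
    intro σ hσ
    have h1 := hom_eval₂ φ.reverse (constInt k L) (MulSemiringAction.toRingHom _ _ σ) U
    have h2 : (MulSemiringAction.toRingHom _ _ σ).comp (constInt k L) = constInt k L := by
      ext1 a
      exact smul_constInt σ a
    rw [h2] at h1
    simpa [hσ] using h1
  obtain ⟨Y, hYy, hY, heq⟩ := exists_inverse_asRoot hp.out.one_lt hh0 hU hε hyε
  let H₁ : Subgroup (L ≃ₐ[LaurentSeries k] L) := MulAction.stabilizer _ U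
  let H₂ : Subgroup (L ≃ₐ[LaurentSeries k] L) := MulAction.stabilizer _ U ⊓ MulAction.stabilizer _ y
  have hH₁ : ∀ σ, σ ∈ H₁ ↔ σ • U = U := fun σ => Iff.rfl
  have hH₂ : ∀ σ, σ ∈ H₂ ↔ σ • U = U ∧ σ y = y := fun σ => Iff.rfl
  obtain ⟨n, a, b, c, hn, hab, hc, hvc, hvY, hcfix, hG, hc1, hc2⟩ :=
    exists_uniformizer_of_asRoot hp.out hh (Nat.pos_of_ne_zero hr0) hUr hε hεfix hyε hYy hY heq
      H₁ H₂ hH₁ hH₂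
  have := Fintype.ofFinite H₁
  have := Fintype.ofFinite H₂
  rw [Nat.card_eq_fintype_card] at hc1 hc2 hG
  -- By choice hb = 1 + pa, so b is invertible modulo p.
  have hbk : (b : k) ≠ 0 := by
    intro h0
    have h1 := congrArg (Nat.cast : ℕ → k) hab
    push_cast at h1
    rw [h0, CharP.cast_eq_zero k p] at h1
    simp at h1
  have hmemH₁ : ∀ σ, σ ∈ H₁ ↔ σ u = u := fun σ =>
    ⟨fun h => congrArg Subtype.val h, fun h => Subtype.ext h⟩
  have hout : ∀ σ ∉ H₁, ram (integralClosure (PowerSeries k) L) σ = 1 := by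
    intro σ hσ
    have h1 : 1 ≤ ram (integralClosure (PowerSeries k) L) σ := by
      refine le_iInf fun b => ?_
      obtain ⟨a, ha, hb⟩ := exists_fixed_sub_not_isUnit b
      have h : σ • b - b = σ • (b - a) - (b - a) := by rw [smul_sub, ha]; ring
      rw [h]
      refine (le_min ?_ ?_).trans (AddValuation.map_sub _ _ _)
      · rw [addVal_smul]; exact one_le_addVal_iff.2 hb
      · exact one_le_addVal_iff.2 hb
    refine le_antisymm ?_ h1
    by_contra hlt
    rw [not_le] at hlt
    apply hσ
    refine smul_eq_of_two_le_ram ?_ hrk (x := U) ?_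
    · rw [← one_add_one_eq_two]
      exact Order.add_one_le_of_lt hlt
    · rw [hUr, Algebra.algebraMap_eq_smul_one, smul_comm, smul_one]
  -- Here σy - y lies in the prime field and is non-zero, so σc - c has valuation n + hn, where n =
  -- |H₂|.
  have hjump : ∀ σ ∈ H₁, σ ∉ H₂ → ramSum (integralClosure (PowerSeries k) L) H₂ σ =
      Fintype.card H₂ * (h + 1) := by
    intro σ hσ1 hσ2
    have hσu : σ u = u := (hmemH₁ σ).1 hσ1
    have hfix : σ (y ^ p - y) = y ^ p - y := by
      have h2 := congrArg σ hyε
      have h3 : σ (U : L) = U := hσu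
      have h4 : σ (ε : L) = ε := congrArg Subtype.val (hεfix _ hσ1)
      rw [map_mul, map_pow, h3, h4, ← hyε] at h2
      exact mul_left_cancel₀ (pow_ne_zero h hu0) h2
    obtain ⟨j, hj⟩ : ∃ j : k, σ y = y + algebraMap (LaurentSeries k) L (HahnSeries.C j) := by
      let : Algebra (ZMod p) k := ZMod.algebra k p
      let : Algebra (ZMod p) L := (((algebraMap (LaurentSeries k) L).comp
        (HahnSeries.C : k →+* LaurentSeries k)).comp (algebraMap (ZMod p) k)).toAlgebra
      have : CharP L p := charP_of_injective_algebraMap (algebraMap (ZMod p) L).injective p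
      obtain ⟨c, hc⟩ := exists_primeField p (σ y - y) (by
        rw [sub_pow_char]
        rw [map_sub, map_pow] at hfix
        linear_combination hfix)
      refine ⟨algebraMap (ZMod p) k c, ?_⟩
      rw [← sub_eq_iff_eq_add', ← hc]
      rfl
    have hj0 : j ≠ 0 := by
      rintro rfl
      rw [map_zero, map_zero, add_zero] at hj
      exact hσ2 ⟨hσ1, hj⟩
    rw [ramSum_eq_of_addVal_eq_card H₂ (by rw [hvc, hc2]) hcfix,
      addVal_smul_sub_self hbk hU0 hY hc hYy hσ1 hj0 (by rw [hj, coe_constInt]), hvc, hvY, hc2]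
    push_cast
    ring
  -- With |G| = rpn and |H₁| = pn, the value |G| + |H₁|h is (1 + h/r)|G|, which is upper number h/r.
  have hmax : ∀ σ ∈ H₁, σ ∉ H₂ → (∀ t : H₂, ram (integralClosure (PowerSeries k) L) (σ * t) ≤
      ram (integralClosure (PowerSeries k) L) σ) →
      ramTot (integralClosure (PowerSeries k) L) σ * r =
        (r + h : ℕ) * Fintype.card (L ≃ₐ[LaurentSeries k] L) := by
    intro σ hσ1 hσ2 hσ
    rw [ramTot_of_one_jump H₁ H₂ inf_le_left hout hjump hσ1 hσ2 hσ, hG, hc1]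
    push_cast
    ring
  have hex : ∀ σ ∈ H₁, σ ∉ H₂ → ∃ σ₀ ∈ H₁, σ₀ ∉ H₂ ∧
      ram (integralClosure (PowerSeries k) L) σ ≤ ram (integralClosure (PowerSeries k) L) σ₀ ∧
      ramTot (integralClosure (PowerSeries k) L) σ₀ * r =
        (r + h : ℕ) * Fintype.card (L ≃ₐ[LaurentSeries k] L) := by
    intro σ hσ1 hσ2
    obtain ⟨t₀, ht₀⟩ := exists_max_ram (integralClosure (PowerSeries k) L) H₂ σ
    have h1 : σ * t₀ ∈ H₁ := H₁.mul_mem hσ1 t₀.2.1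
    have h2 : σ * t₀ ∉ H₂ := fun h3 => hσ2 ((Subgroup.mul_mem_cancel_right _ t₀.2).1 h3)
    refine ⟨σ * t₀, h1, h2, by simpa using ht₀ 1, hmax _ h1 h2 fun t => ?_⟩
    rw [mul_assoc]
    exact ht₀ (t₀ * t)
  constructor
  · obtain ⟨σ, hσ1, hσ2⟩ : ∃ σ ∈ H₁, σ ∉ H₂ := by
      by_contra! hcon
      have h1 : Fintype.card H₁ ≤ Fintype.card H₂ :=
        Fintype.card_le_of_injective _ (Set.inclusion_injective hcon)
      rw [hc1, hc2] at h1
      have := hp.out.one_lt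
      nlinarith
    obtain ⟨σ₀, h1, h2, -, h3⟩ := hex σ hσ1 hσ2
    exact ⟨σ₀, (hmemH₁ _).1 h1, fun h4 => h2 ⟨h1, h4⟩, h3⟩
  · intro σ hσu hσy
    obtain ⟨σ₀, -, -, h1, h2⟩ := hex σ ((hmemH₁ _).2 hσu) fun h4 => hσy h4.2
    exact (mul_le_mul_left (ramTot_mono h1) _).trans h2.le

end UpperJump

/-! ### Action of the upper numbering groups on Artin-Schreier roots -/

section UpperJumpInfinite

variable {k : Type*} [Field k] {p : ℕ} [hp : Fact p.Prime] [Algebra (ZMod p) k]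

theorem charP_of_algebra_zmod (k : Type*) [Field k] (p : ℕ) [Fact p.Prime] [Algebra (ZMod p) k] :
    CharP k p :=
  charP_of_injective_algebraMap (algebraMap (ZMod p) k).injective p

theorem natCast_ne_zero_of_coprime {r : ℕ} (hr : r.Coprime p) : (r : k) ≠ 0 := by
  have := charP_of_algebra_zmod k p
  rw [Ne, CharP.cast_eq_zero_iff k p]
  exact (hp.out.coprime_iff_not_dvd).1 hr.symm

theorem coe_eval₂_inv (L : IntermediateField (LaurentSeries k) (AlgebraicClosure (LaurentSeries k)))
    (φ : k[X]) (u : L) :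
    ((φ.eval₂ ((algebraMap (LaurentSeries k) L).comp HahnSeries.C) u⁻¹ : L) :
      AlgebraicClosure (LaurentSeries k)) = evalInv u φ := by
  have h := hom_eval₂ φ ((algebraMap (LaurentSeries k) L).comp
    (HahnSeries.C : k →+* LaurentSeries k)) (L.val : L →+* AlgebraicClosure (LaurentSeries k)) u⁻¹
  rw [map_inv₀] at h
  exact h

theorem isSeparable_of_pow_sub_eq {M E : Type*} [Field M] [Field E] [Algebra M E] [CharP M p]
    {a : M} {y : E} (hy : y ^ p - y = algebraMap M E a) : IsSeparable M y := by
  have h1 : (X ^ p - X - C a : M[X]).Separable := by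
    rw [separable_def]
    refine ⟨0, -1, ?_⟩
    simp [derivative_X_pow]
  exact h1.of_dvd (minpoly.dvd M y (by simp [hy]))

variable [IsAlgClosed k]

theorem isSeparable_asRoot {r : ℕ} (hr : r.Coprime p)
    {u y : AlgebraicClosure (LaurentSeries k)} (hu : u ^ r = unifCl k) {φ : k[X]}
    (hy : y ^ p - y = evalInv u φ) : IsSeparable (LaurentSeries k) y := by
  have hsu : IsSeparable (LaurentSeries k) u :=
    isSeparable_of_pow_eq (natCast_laurentSeries_ne_zero (natCast_ne_zero_of_coprime hr))
      (unif_ne_zero k) hu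
  let M := IntermediateField.adjoin (LaurentSeries k) {u}
  have hM : Algebra.IsSeparable (LaurentSeries k) M :=
    (IntermediateField.isSeparable_adjoin_simple_iff_isSeparable _ _).2 hsu
  have : CharP (LaurentSeries k) p := by
    have := charP_of_algebra_zmod k p
    exact charP_of_injective_ringHom (HahnSeries.C : k →+* LaurentSeries k).injective p
  have : CharP M p := charP_of_injective_algebraMap (algebraMap (LaurentSeries k) M).injective p
  let u' : M := ⟨u, IntermediateField.mem_adjoin_simple_self _ u⟩
  have hy' : y ^ p - y = algebraMap M (AlgebraicClosure (LaurentSeries k))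
      (φ.eval₂ ((algebraMap (LaurentSeries k) M).comp HahnSeries.C) u'⁻¹) := by
    rw [hy]
    exact (coe_eval₂_inv M φ u').symm
  exact IsSeparable.of_algebra_isSeparable_of_isSeparable (LaurentSeries k)
    (isSeparable_of_pow_sub_eq hy')

/-- Artin-Schreier roots are fixed by the upper numbering groups beyond their pole order. -/
theorem asRoot_fixed_of_lt {r : ℕ} (hr : r.Coprime p)
    {u y : AlgebraicClosure (LaurentSeries k)} (hu : u ^ r = unifCl k) {φ : k[X]}
    (hφ : ¬ p ∣ φ.natDegree) (hy : y ^ p - y = evalInv u φ) {x : ℝ} (hx : 0 < x)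
    (hxr : φ.natDegree < x * r) {σ : Inertia k} (hσ : σ ∈ upperRam k x) : σ y = y := by
  have := charP_of_algebra_zmod k p
  have hσu := apply_eq_of_mem_upperRam hx hσ (natCast_ne_zero_of_coprime hr) hu
  obtain ⟨L, _, _, hL⟩ := exists_finite_galois_mem (S := {u, y}) (Set.toFinite _) (by
    rintro _ (rfl | rfl)
    · exact isSeparable_of_pow_eq (natCast_laurentSeries_ne_zero (natCast_ne_zero_of_coprime hr))
        (unif_ne_zero k) hu
    · exact isSeparable_asRoot hr hu hy)
  let u' : L := ⟨u, hL (by simp)⟩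
  let y' : L := ⟨y, hL (by simp)⟩
  have := Fintype.ofFinite (L ≃ₐ[LaurentSeries k] L)
  by_contra hσy
  have hσy' : galRes L σ y' ≠ y' := by
    intro h1
    have h2 := congrArg Subtype.val h1
    rw [coe_galRes] at h2
    exact hσy h2
  have hσu' : galRes L σ u' = u' := Subtype.ext (by rw [coe_galRes]; exact hσu)
  have hne : galRes L σ ≠ 1 := by
    intro h1
    rw [h1] at hσy'
    exact hσy' rfl
  have h1 := (ramTot_of_asRoot (hp.out.coprime_iff_not_dvd.1 hr.symm) hφ (u := u') (y := y')
    (Subtype.ext hu) (Subtype.ext (by rw [coe_eval₂_inv]; exact hy))).2 _ hσu' hσy'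
  have h2 := (mem_upperRamFin_iff L hne hx.le).1 (hσ L)
  obtain ⟨a, ha⟩ := ENat.ne_top_iff_exists.1 (ramTot_ne_top (mt
    (ram_eq_top_iff (B := integralClosure (PowerSeries k) L)).1 hne))
  rw [← ha] at h1
  rw [show AlgEquiv.restrictNormalHom L σ = galRes L σ from rfl, ← ha, ENat.toNat_natCast] at h2
  have h1' : a * r ≤ (r + φ.natDegree) * Fintype.card (L ≃ₐ[LaurentSeries k] L) := by
    exact_mod_cast h1
  have h3 : (a : ℝ) * r ≤ (r + φ.natDegree) * Fintype.card (L ≃ₐ[LaurentSeries k] L) := by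
    exact_mod_cast h1'
  have hc : (0 : ℝ) < Fintype.card (L ≃ₐ[LaurentSeries k] L) := by
    exact_mod_cast Fintype.card_pos
  have h4 := mul_le_mul_of_nonneg_right h2 (Nat.cast_nonneg (α := ℝ) r)
  nlinarith

/-- The Artin-Schreier root of a polynomial of degree `h` in `u⁻¹` is moved by the upper numbering
group of index `h / r`. -/
theorem exists_mem_upperRam_asRoot_ne {r : ℕ} (hr : r.Coprime p)
    {u y : AlgebraicClosure (LaurentSeries k)} (hu : u ^ r = unifCl k) {φ : k[X]}
    (hφ : ¬ p ∣ φ.natDegree) (hy : y ^ p - y = evalInv u φ) (hr0 : 0 < r) :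
    ∃ σ ∈ upperRam k (φ.natDegree / r : ℝ), σ u = u ∧ σ y ≠ y := by
  have := charP_of_algebra_zmod k p
  have hr0' : (0 : ℝ) < r := by exact_mod_cast hr0
  obtain ⟨E, _, _, hE⟩ := exists_finite_galois_mem (S := {u, y}) (Set.toFinite _) (by
    rintro _ (rfl | rfl)
    · exact isSeparable_of_pow_eq (natCast_laurentSeries_ne_zero (natCast_ne_zero_of_coprime hr))
        (unif_ne_zero k) hu
    · exact isSeparable_asRoot hr hu hy)
  have huE : u ∈ E := hE (by simp)
  have hyE : y ∈ E := hE (by simp)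
  have hpos : (0 : ℝ) ≤ (φ.natDegree / r : ℝ) := by positivity
  obtain ⟨σ, hσ, h1, h2⟩ := exists_mem_upperRam E hpos
    {s | s ⟨u, huE⟩ = ⟨u, huE⟩ ∧ s ⟨y, hyE⟩ ≠ ⟨y, hyE⟩} (by
    intro L _ _ hEL
    have := Fintype.ofFinite (L ≃ₐ[LaurentSeries k] L)
    let u' : L := ⟨u, hEL huE⟩
    let y' : L := ⟨y, hEL hyE⟩
    obtain ⟨s, hsu, hsy, hs⟩ := (ramTot_of_asRoot (hp.out.coprime_iff_not_dvd.1 hr.symm) hφ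
      (u := u') (y := y') (Subtype.ext hu) (Subtype.ext (by rw [coe_eval₂_inv]; exact hy))).1
    obtain ⟨σ, rfl⟩ := galRes_surjective L s
    have hne : galRes L σ ≠ 1 := by
      intro h1
      rw [h1] at hsy
      exact hsy rfl
    have hσu : σ u = u := by
      have h2 := congrArg Subtype.val hsu
      rwa [coe_galRes] at h2
    have hσy : σ y ≠ y := by
      intro h1
      exact hsy (Subtype.ext (by rw [coe_galRes]; exact h1))
    refine ⟨σ, ?_, Subtype.ext (by rw [coe_galRes]; exact hσu), fun h3 => hσy ?_⟩
    · rw [mem_upperRamFin_iff L hne hpos]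
      obtain ⟨a, ha⟩ := ENat.ne_top_iff_exists.1 (ramTot_ne_top (mt
        (ram_eq_top_iff (B := integralClosure (PowerSeries k) L)).1 hne))
      rw [← ha] at hs
      rw [← ha, ENat.toNat_natCast]
      have h1' : a * r = (r + φ.natDegree) * Fintype.card (L ≃ₐ[LaurentSeries k] L) := by
        exact_mod_cast hs
      have h3 : (a : ℝ) * r = (r + φ.natDegree) * Fintype.card (L ≃ₐ[LaurentSeries k] L) := by
        exact_mod_cast h1'
      refine le_of_mul_le_mul_right (le_of_eq ?_) hr0'
      rw [h3]
      field_simp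
      ring
    · have h4 := congrArg Subtype.val h3
      rwa [coe_galRes] at h4)
  refine ⟨σ, hσ, ?_, fun h3 => h2 (Subtype.ext (by rw [coe_galRes]; exact h3))⟩
  have h4 := congrArg Subtype.val h1
  rwa [coe_galRes] at h4

/-- For constant φ the equation is already solvable in the algebraically closed field k, and any
other root differs by an element of the prime field. -/
theorem asRoot_fixed_of_natDegree_eq_zero {u y : AlgebraicClosure (LaurentSeries k)} {φ : k[X]}
    (hφ : φ.natDegree = 0) (hy : y ^ p - y = evalInv u φ) (σ : Inertia k) : σ y = y := by
  obtain ⟨a, ha⟩ := exists_asRoot hp.out.one_lt (φ.coeff 0)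
  let f : k →+* AlgebraicClosure (LaurentSeries k) :=
    (algebraMap (LaurentSeries k) (AlgebraicClosure (LaurentSeries k))).comp HahnSeries.C
  have hfσ : ∀ c, σ (f c) = f c := fun c => σ.commutes _
  let : Algebra (ZMod p) (AlgebraicClosure (LaurentSeries k)) :=
    (f.comp (algebraMap (ZMod p) k)).toAlgebra
  have : CharP (AlgebraicClosure (LaurentSeries k)) p :=
    charP_of_injective_algebraMap (algebraMap (ZMod p) _).injective p
  have hev : evalInv u φ = f (φ.coeff 0) := by
    rw [eq_C_of_natDegree_eq_zero hφ, evalInv, eval₂_C, coeff_C_zero]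
  obtain ⟨c, hc⟩ := exists_primeField p (y - f a) (by
    rw [sub_pow_char, ← map_pow]
    have h1 : f (a ^ p) - f a = f (φ.coeff 0) := by rw [← map_sub, ha]
    rw [hev] at hy
    linear_combination hy - h1)
  have hc' : f (algebraMap (ZMod p) k c) = y - f a := hc
  rw [sub_eq_iff_eq_add'.1 hc'.symm, map_add, hfσ, hfσ]

/-- Lower-order terms are invisible to I^(h/r). The bound h < p ensures that a positive degree below
h is prime to p, so that its jump lies strictly below h/r. -/
theorem asRoot_fixed_of_natDegree_lt {r : ℕ} (hr : r.Coprime p)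
    {u y : AlgebraicClosure (LaurentSeries k)} (hu : u ^ r = unifCl k) {φ : k[X]} {h : ℕ}
    (hh : h < p) (hh0 : 0 < h) (hr0 : 0 < r) (hφ : φ.natDegree < h)
    (hy : y ^ p - y = evalInv u φ) {σ : Inertia k} (hσ : σ ∈ upperRam k (h / r : ℝ)) :
    σ y = y := by
  by_cases h0 : φ.natDegree = 0
  · exact asRoot_fixed_of_natDegree_eq_zero h0 hy σ
  · have hr0' : (0 : ℝ) < r := by exact_mod_cast hr0
    have hh0' : (0 : ℝ) < h := by exact_mod_cast hh0
    refine asRoot_fixed_of_lt hr hu (fun hd => ?_) hy (x := h / r) (by positivity) ?_ hσ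
    · have := Nat.le_of_dvd (Nat.pos_of_ne_zero h0) hd
      omega
    · rw [div_mul_cancel₀ _ hr0'.ne']
      exact_mod_cast hφ

end UpperJumpInfinite

/-! ### Wild inertia is normal and contained in I(r) -/

section WildInertia

variable {k : Type*} [Field k] {p : ℕ}

theorem apply_eq_of_mem_wildInertia {σ : Inertia k} (hσ : σ ∈ wildInertia k p) {n : ℕ}
    (hn : n.Coprime p) {u : AlgebraicClosure (LaurentSeries k)} (hu : u ^ n = unifCl k) :
    σ u = u := by
  rw [wildInertia, IntermediateField.mem_fixingSubgroup_iff] at hσ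
  exact hσ u (IntermediateField.subset_adjoin _ _ ⟨n, hn, hu⟩)

theorem mem_wildInertia_iff {σ : Inertia k} : σ ∈ wildInertia k p ↔
    ∀ (n : ℕ) (u : AlgebraicClosure (LaurentSeries k)), n.Coprime p → u ^ n = unifCl k →
      σ u = u := by
  refine ⟨fun hσ n u hn hu => apply_eq_of_mem_wildInertia hσ hn hu, fun h => ?_⟩
  rw [wildInertia, IntermediateField.mem_fixingSubgroup_iff]
  have h1 : tameClosure k p ≤ IntermediateField.fixedField (Subgroup.zpowers σ) := by
    rw [tameClosure, IntermediateField.adjoin_le_iff]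
    rintro u ⟨n, hn, hu⟩
    rw [SetLike.mem_coe, IntermediateField.mem_fixedField_iff]
    intro τ hτ
    have h3 : Subgroup.zpowers σ ≤ MulAction.stabilizer (Inertia k) u := by
      rw [Subgroup.zpowers_le]
      exact h n u hn hu
    exact h3 hτ
  intro x hx
  exact (IntermediateField.mem_fixedField_iff _ _).1 (h1 hx) σ (Subgroup.mem_zpowers σ)

instance wildInertia_normal : (wildInertia k p).Normal where
  conj_mem σ hσ g := by
    rw [mem_wildInertia_iff] at hσ ⊢
    intro n u hn hu
    have h1 : (g⁻¹ u) ^ n = unifCl k := by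
      rw [← map_pow, hu]
      exact AlgEquiv.commutes _ _
    have h2 := congrArg g (hσ n _ hn h1)
    have h3 : g (g⁻¹ u) = u := by rw [← AlgEquiv.mul_apply, mul_inv_cancel, AlgEquiv.one_apply]
    rw [h3] at h2
    exact h2

/-- The upper numbering groups of positive index are contained in wild inertia. -/
theorem upperRam_subset_wildInertia [Fact p.Prime] [Algebra (ZMod p) k] [IsAlgClosed k] {x : ℝ}
    (hx : 0 < x) {σ : Inertia k} (hσ : σ ∈ upperRam k x) : σ ∈ wildInertia k p :=
  mem_wildInertia_iff.2 fun _ _ hn hu =>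
    apply_eq_of_mem_upperRam hx hσ (natCast_ne_zero_of_coprime hn) hu

theorem mem_rootSubgroup_iff {u : AlgebraicClosure (LaurentSeries k)} {σ : Inertia k} :
    σ ∈ rootSubgroup k u ↔ σ u = u := by
  rw [rootSubgroup, IntermediateField.mem_fixingSubgroup_iff]
  refine ⟨fun h => h u (IntermediateField.mem_adjoin_simple_self _ u), fun h => ?_⟩
  have h1 : IntermediateField.adjoin (LaurentSeries k) {u} ≤
      IntermediateField.fixedField (Subgroup.zpowers σ) := by
    rw [IntermediateField.adjoin_simple_le_iff, IntermediateField.mem_fixedField_iff]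
    intro τ hτ
    have h3 : Subgroup.zpowers σ ≤ MulAction.stabilizer (Inertia k) u := by
      rw [Subgroup.zpowers_le]
      exact h
    exact h3 hτ
  intro x hx
  exact (IntermediateField.mem_fixedField_iff _ _).1 (h1 hx) σ (Subgroup.mem_zpowers σ)

theorem wildInertia_le_rootSubgroup {n : ℕ} (hn : n.Coprime p)
    {u : AlgebraicClosure (LaurentSeries k)} (hu : u ^ n = unifCl k) :
    wildInertia k p ≤ rootSubgroup k u := fun _ hσ =>
  mem_rootSubgroup_iff.2 (apply_eq_of_mem_wildInertia hσ hn hu)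

end WildInertia

/-! ### Conjugates of Artin-Schreier characters under u ↦ ζu -/

section Conjugation

/-- The embedding of the constants. -/
abbrev constCl (k : Type*) [Field k] : k →+* AlgebraicClosure (LaurentSeries k) :=
  (algebraMap (LaurentSeries k) (AlgebraicClosure (LaurentSeries k))).comp HahnSeries.C

variable {k : Type*} [Field k]

theorem apply_constCl (σ : Inertia k) (c : k) : σ (constCl k c) = constCl k c :=
  σ.commutes _

theorem apply_evalInv (σ : Inertia k) (u : AlgebraicClosure (LaurentSeries k)) (φ : k[X]) :
    σ (evalInv u φ) = evalInv (σ u) φ := by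
  have h := hom_eval₂ φ (constCl k) (RingHomClass.toRingHom σ) u⁻¹
  have h1 : (RingHomClass.toRingHom σ).comp (constCl k) = constCl k := by
    ext c
    exact apply_constCl σ c
  rw [h1] at h
  change σ (evalInv u φ) = φ.eval₂ (constCl k) (σ u)⁻¹
  rw [← map_inv₀]
  exact h

theorem unifCl_ne_zero (k : Type*) [Field k] : unifCl k ≠ 0 :=
  (_root_.map_ne_zero _).2 (unif_ne_zero k)

theorem ne_zero_of_pow_eq_unifCl {r : ℕ} (hr0 : 0 < r)
    {u : AlgebraicClosure (LaurentSeries k)} (hu : u ^ r = unifCl k) : u ≠ 0 := by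
  rintro rfl
  rw [zero_pow hr0.ne'] at hu
  exact unifCl_ne_zero k hu.symm

/-- Total ramification of the field generated by u gives r·v(u) = v(t) = degree, so the degree is at
least r and the Kummer polynomial is irreducible. -/
theorem minpoly_of_pow_eq_unifCl [IsAlgClosed k] {r : ℕ} (hr : (r : k) ≠ 0) (hr0 : 0 < r)
    {u : AlgebraicClosure (LaurentSeries k)} (hu : u ^ r = unifCl k) :
    minpoly (LaurentSeries k) u = X ^ r - C (unif k) := by
  have hsu : IsSeparable (LaurentSeries k) u :=
    isSeparable_of_pow_eq (natCast_laurentSeries_ne_zero hr) (unif_ne_zero k) hu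
  let M := IntermediateField.adjoin (LaurentSeries k) {u}
  have hM : Algebra.IsSeparable (LaurentSeries k) M :=
    (IntermediateField.isSeparable_adjoin_simple_iff_isSeparable _ _).2 hsu
  have hint : IsIntegral (LaurentSeries k) u := Algebra.IsIntegral.isIntegral u
  have hfd : FiniteDimensional (LaurentSeries k) M :=
    IntermediateField.adjoin.finiteDimensional hint
  have hfr : Module.finrank (LaurentSeries k) M = (minpoly (LaurentSeries k) u).natDegree :=
    IntermediateField.adjoin.finrank hint
  let u' : M := ⟨u, IntermediateField.mem_adjoin_simple_self _ u⟩
  have hu' : u' ^ r = algebraMap (LaurentSeries k) M (unif k) := Subtype.ext hu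
  let U : integralClosure (PowerSeries k) M := ⟨u', isIntegral_of_pow_eq_unif hr0.ne' hu'⟩
  have hUr : U ^ r = algebraMap (PowerSeries k) _ PowerSeries.X := by
    apply Subtype.ext
    change u' ^ r = algebraMap (PowerSeries k) M PowerSeries.X
    rw [hu', ← algebraMap_X_eq_unif, ← IsScalarTower.algebraMap_apply]
  have hv := addVal_X_eq_finrank (k := k) (L := M)
  rw [← hUr, AddValuation.map_pow, hfr] at hv
  have hmonic : (X ^ r - C (unif k)).Monic := monic_X_pow_sub_C _ hr0.ne'
  have hdvd : minpoly (LaurentSeries k) u ∣ X ^ r - C (unif k) :=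
    minpoly.dvd _ _ (by simp [hu, unifCl])
  have hpos := minpoly.natDegree_pos hint
  have hle : r ≤ (minpoly (LaurentSeries k) u).natDegree := by
    by_contra hlt
    generalize (minpoly (LaurentSeries k) u).natDegree = m at hv hpos hlt
    rw [nsmul_eq_mul] at hv
    generalize IsDiscreteValuationRing.addVal _ U = a at hv
    induction a with
    | top =>
      rw [ENat.mul_top (by exact_mod_cast hr0.ne')] at hv
      exact ENat.top_ne_natCast m hv
    | coe a =>
      have h1 : r * a = m := by exact_mod_cast hv
      rcases Nat.eq_zero_or_pos a with rfl | ha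
      · omega
      · nlinarith
  exact (eq_of_monic_of_dvd_of_natDegree_le (minpoly.monic hint) hmonic hdvd
    (by rw [natDegree_X_pow_sub_C]; exact hle)).symm

/-- The inertia group acts transitively on the roots of the uniformizer of order prime to `p`. -/
theorem exists_apply_eq_mul [IsAlgClosed k] {r : ℕ} (hr : (r : k) ≠ 0) (hr0 : 0 < r)
    {u : AlgebraicClosure (LaurentSeries k)} (hu : u ^ r = unifCl k) {ζ : k} (hζ : ζ ^ r = 1) :
    ∃ g : Inertia k, g u = constCl k ζ * u := by
  have hu' : (constCl k ζ * u) ^ r = unifCl k := by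
    rw [mul_pow, ← map_pow, hζ, map_one, one_mul, hu]
  refine isConjRoot_iff_exists_algEquiv.1 ?_
  rw [isConjRoot_def, minpoly_of_pow_eq_unifCl hr hr0 hu, minpoly_of_pow_eq_unifCl hr hr0 hu']

variable {p : ℕ} [hp : Fact p.Prime] [Algebra (ZMod p) k]

/-- The substitution multiplies the leading coefficient by ζ^h = 1, so the leading terms cancel. -/
theorem natDegree_comp_sub_lt {φ : k[X]} {ζ : k} (h0 : 0 < φ.natDegree)
    (hζ : ζ ^ φ.natDegree = 1) : (φ.comp (C ζ * X) - φ).natDegree < φ.natDegree := by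
  have h1 : (φ.comp (C ζ * X) - φ).natDegree ≤ φ.natDegree := by
    rw [natDegree_le_iff_coeff_eq_zero]
    intro N hN
    rw [coeff_sub, comp_C_mul_X_coeff, coeff_eq_zero_of_natDegree_lt hN, zero_mul, sub_zero]
  refine lt_of_le_of_ne h1 fun h2 => ?_
  have h3 : (φ.comp (C ζ * X) - φ).leadingCoeff = 0 := by
    rw [leadingCoeff, h2, coeff_sub, comp_C_mul_X_coeff, hζ, mul_one, sub_self]
  rw [leadingCoeff_eq_zero] at h3
  rw [h3, natDegree_zero] at h2
  omega

/-- Conjugation by `g` with `g u = ζ u`, where `ζ` is a root of unity of order dividing the degree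
`h` of `φ`, preserves the Artin-Schreier character of `φ` on the upper numbering group of index
`h / r`. -/
theorem cocycle_conj [IsAlgClosed k] {r : ℕ} (hr : r.Coprime p) (hr0 : 0 < r)
    {u : AlgebraicClosure (LaurentSeries k)} (hu : u ^ r = unifCl k) {φ : k[X]}
    (h0 : 0 < φ.natDegree) (hlt : φ.natDegree < p) {ζ : k} (hζ : ζ ^ φ.natDegree = 1)
    {g : Inertia k} (hg : g u = constCl k ζ * u)
    {σ : Inertia k} (hσ : σ ∈ upperRam k (φ.natDegree / r : ℝ))
    (h1 : σ (evalInv u φ) = evalInv u φ)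
    (h2 : (g * σ * g⁻¹) (evalInv u φ) = evalInv u φ) :
    cocycle p (evalInv u φ) (g * σ * g⁻¹) h2 = cocycle p (evalInv u φ) σ h1 := by
  have hu0 := ne_zero_of_pow_eq_unifCl hr0 hu
  have hinv : ∀ x, g⁻¹ (g x) = x := fun x => by
    rw [← AlgEquiv.mul_apply, inv_mul_cancel, AlgEquiv.one_apply]
  have hinv' : ∀ x, g (g⁻¹ x) = x := fun x => by
    rw [← AlgEquiv.mul_apply, mul_inv_cancel, AlgEquiv.one_apply]
  have hginv : (g⁻¹ u)⁻¹ = constCl k ζ * u⁻¹ := by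
    have h3 := congrArg (⇑(g⁻¹)) hg
    rw [hinv, map_mul, apply_constCl] at h3
    have hg0 : g⁻¹ u ≠ 0 := (_root_.map_ne_zero _).2 hu0
    nth_rewrite 2 [h3]
    rw [mul_inv, ← mul_assoc, mul_inv_cancel₀, one_mul]
    intro h4
    rw [h4, zero_mul] at h3
    exact hu0 h3
  set y := asRoot p (evalInv u φ) with hy
  have hys : y ^ p - y = evalInv u φ := asRoot_spec p _
  have : CharP (AlgebraicClosure (LaurentSeries k)) p := by
    have := charP_of_algebra_zmod k p
    exact charP_of_injective_ringHom (constCl k).injective p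
  -- The difference of the two roots belongs to the polynomial φ(ζX) - φ(X), of degree less than h,
  -- hence is fixed by σ. So σ moves the conjugate root by the same element of the prime field as y,
  -- and g fixes that element.
  have hz : (g⁻¹ y - y) ^ p - (g⁻¹ y - y) = evalInv u (φ.comp (C ζ * X) - φ) := by
    have h3 := congrArg (⇑(g⁻¹)) hys
    rw [apply_evalInv, map_sub, map_pow] at h3
    have h4 : evalInv (g⁻¹ u) φ = evalInv u (φ.comp (C ζ * X)) := by
      rw [evalInv, hginv, evalInv, eval₂_comp, eval₂_mul, eval₂_C, eval₂_X]
    rw [sub_pow_char, evalInv, eval₂_sub]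
    change _ = evalInv u (φ.comp (C ζ * X)) - evalInv u φ
    rw [← h4, ← h3, ← hys]
    ring
  have hσz := asRoot_fixed_of_natDegree_lt hr hu hlt h0 hr0 (natDegree_comp_sub_lt h0 hζ) hz hσ
  apply (algebraMap (ZMod p) (AlgebraicClosure (LaurentSeries k))).injective
  have hc := cocycle_spec p (evalInv u φ) σ h1
  rw [cocycle_spec, hc]
  rw [← hy] at hc ⊢
  have h5 : σ (g⁻¹ y) = g⁻¹ y + (σ y - y) := by
    rw [map_sub] at hσz
    linear_combination hσz
  rw [AlgEquiv.mul_apply, AlgEquiv.mul_apply, h5, map_add, hinv', ← hc,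
    IsScalarTower.algebraMap_apply (ZMod p) (LaurentSeries k) (AlgebraicClosure (LaurentSeries k)),
    AlgEquiv.commutes, add_sub_cancel_left]

end Conjugation

/-! ### Functions supported on one coset in a coinduced representation -/

section Coinduced

variable {F G W : Type*} [Field F] [Group G] [AddCommGroup W] [Module F W]
  {H : Subgroup G} (A : Representation F H W)

open Classical in
/-- The function in the coinduced representation that is supported on the coset `H g` and takes
the value `v` at `g`. -/
def coindSingle (g : G) (v : W) : Representation.coindV H.subtype A :=
  ⟨fun x => if hx : x * g⁻¹ ∈ H then A ⟨x * g⁻¹, hx⟩ v else 0, by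
    intro h x
    have h1 : H.subtype h * x * g⁻¹ ∈ H ↔ x * g⁻¹ ∈ H := by
      rw [mul_assoc]
      exact Subgroup.mul_mem_cancel_left H h.2
    by_cases hx : x * g⁻¹ ∈ H
    · have hx' := h1.2 hx
      simp only [dif_pos hx, dif_pos hx']
      rw [← Module.End.mul_apply, ← map_mul]
      congr 2
      exact Subtype.ext (mul_assoc _ _ _)
    · have hx' := mt h1.1 hx
      simp only [dif_neg hx, dif_neg hx', map_zero]⟩

open Classical in
theorem coindSingle_self (g : G) (v : W) : (coindSingle A g v).1 g = v := by
  have h : g * g⁻¹ ∈ H := by rw [mul_inv_cancel]; exact H.one_mem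
  have h1 : (⟨g * g⁻¹, h⟩ : H) = 1 := Subtype.ext (mul_inv_cancel g)
  change (if hx : g * g⁻¹ ∈ H then A ⟨g * g⁻¹, hx⟩ v else 0) = v
  rw [dif_pos h, h1, map_one, Module.End.one_apply]

theorem coindSingle_of_notMem {g x : G} (hx : x * g⁻¹ ∉ H) (v : W) :
    (coindSingle A g v).1 x = 0 :=
  dif_neg hx

open Classical in
theorem coind_coindSingle {g σ : G} {v : W} {c : F} (hσ : g * σ * g⁻¹ ∈ H)
    (hc : A ⟨g * σ * g⁻¹, hσ⟩ v = c • v) :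
    Representation.coind H.subtype A σ (coindSingle A g v) = c • coindSingle A g v := by
  apply Subtype.ext
  funext x
  change (if hx : x * σ * g⁻¹ ∈ H then A ⟨x * σ * g⁻¹, hx⟩ v else 0) =
    c • (if hx : x * g⁻¹ ∈ H then A ⟨x * g⁻¹, hx⟩ v else 0)
  have h1 : x * σ * g⁻¹ = x * g⁻¹ * (g * σ * g⁻¹) := by group
  have h2 : x * σ * g⁻¹ ∈ H ↔ x * g⁻¹ ∈ H := by
    rw [h1]
    exact Subgroup.mul_mem_cancel_right H hσ
  by_cases hx : x * g⁻¹ ∈ H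
  · have hx' := h2.2 hx
    have h3 : (⟨x * σ * g⁻¹, hx'⟩ : H) = ⟨x * g⁻¹, hx⟩ * ⟨g * σ * g⁻¹, hσ⟩ := Subtype.ext h1
    rw [dif_pos hx, dif_pos hx', h3, map_mul, Module.End.mul_apply, hc, map_smul]
  · rw [dif_neg hx, dif_neg (mt h2.1 hx), smul_zero]

/-- The functions live on distinct cosets of H, so evaluation at g i isolates the i-th coefficient.
-/
theorem linearIndependent_coindSingle {ι : Type*} {g : ι → G} {v : W} (hv : v ≠ 0)
    (hg : ∀ i j, i ≠ j → g i * (g j)⁻¹ ∉ H) :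
    LinearIndependent F fun i => coindSingle A (g i) v := by
  rw [linearIndependent_iff']
  intro s c hc i hi
  have h1 := congrArg (fun f : Representation.coindV H.subtype A => f.1 (g i)) hc
  simp only [Submodule.coe_sum, Finset.sum_apply, Submodule.coe_smul, Pi.smul_apply,
    ZeroMemClass.coe_zero, Pi.zero_apply] at h1
  rw [Finset.sum_eq_single i, coindSingle_self] at h1
  · exact (smul_eq_zero.1 h1).resolve_right hv
  · intro j _ hj
    rw [coindSingle_of_notMem A (hg i j hj.symm), smul_zero]
  · exact fun h => absurd hi h

end Coinduced

/-- Any non-zero c generates the additive group of the prime field. -/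
theorem addChar_ne_one {p : ℕ} [Fact p.Prime] {F : Type*} [Field F] {ψ : AddChar (ZMod p) F}
    (hψ : ψ ≠ 1) {c : ZMod p} (hc : c ≠ 0) : ψ c ≠ 1 := by
  intro h
  apply hψ
  ext a
  have h1 : a = (a * c⁻¹).val • c := by
    rw [nsmul_eq_mul, ZMod.natCast_zmod_val, mul_assoc, inv_mul_cancel₀ hc, mul_one]
  rw [h1, AddChar.map_nsmul_eq_pow, h, one_pow, AddChar.one_apply]

theorem addChar_pow_card {p : ℕ} {F : Type*} [Field F] (ψ : AddChar (ZMod p) F) (c : ZMod p) :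
    ψ c ^ p = 1 := by
  rw [← AddChar.map_nsmul_eq_pow, nsmul_eq_mul, CharP.cast_eq_zero, zero_mul,
    AddChar.map_zero_eq_one]

/-! ### Eigenvectors of a wild element in the induced representation -/

section Elementary

variable {k : Type*} [Field k] [IsAlgClosed k] {p : ℕ} [hp : Fact p.Prime] [Algebra (ZMod p) k]
  {F : Type*} [Field F]

/-- Wild inertia is normal, lies in I(r) and acts trivially through κ. It is therefore diagonal on
the functions supported on one coset, acting by conjugates of the Artin-Schreier character. -/
theorem elementary_coindSingle {ψ : AddChar (ZMod p) F} {r : ℕ} (hr : r.Coprime p)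
    {u : AlgebraicClosure (LaurentSeries k)} (hu : u ^ r = unifCl k) {φ : k[X]} {n : ℕ}
    {κ : rootSubgroup k u →* GL (Fin n) F}
    (hκ : ∀ σ : rootSubgroup k u, (σ : Inertia k) ∈ wildInertia k p → κ σ = 1)
    {σ : Inertia k} (hσ : σ ∈ wildInertia k p) (g : Inertia k)
    (hfix : (g * σ * g⁻¹) (evalInv u φ) = evalInv u φ) (v : Fin n → F) :
    elementary ψ u φ κ σ (coindSingle _ g v) =
      ψ (cocycle p (evalInv u φ) (g * σ * g⁻¹) hfix) • coindSingle _ g v := by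
  have h1 : g * σ * g⁻¹ ∈ wildInertia k p := wildInertia_normal.conj_mem σ hσ g
  have h2 := wildInertia_le_rootSubgroup hr hu h1
  refine coind_coindSingle _ h2 ?_
  change (ψ (cocycle p (evalInv u φ) (g * σ * g⁻¹) _) • toRep κ ⟨g * σ * g⁻¹, h2⟩) v = _
  rw [LinearMap.smul_apply, toRep_apply, hκ _ h1, Units.val_one, Matrix.one_mulVec]

/-- If `φ`, of degree `h` prime to `p`, appears in a representation of dimension less than `p`
all of whose slopes are inverses of integers, then some element of inertia has an eigenvalue that
is a primitive `p`-th root of unity, of multiplicity at least `h`. -/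
theorem AppearsIn.exists_eigenvectors [TopologicalSpace F] {ψ : AddChar (ZMod p) F} (hψ : ψ ≠ 1)
    {φ : k[X]} (hφ : ¬ p ∣ φ.natDegree) {V : Type*} [AddCommGroup V] [Module F V]
    [FiniteDimensional F V] (hV : Module.finrank F V < p) {ρ : Representation F (Inertia k) V}
    (hρ : ∀ y : ℝ, IsSlope p ρ y → y ≠ 0 → ∃ d : ℕ, 0 < d ∧ y = 1 / (d : ℝ))
    (h : AppearsIn ψ φ ρ) :
    ∃ (σ : Inertia k) (ω : F), ω ≠ 1 ∧ ω ^ p = 1 ∧ ∃ w : Fin φ.natDegree → V,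
      LinearIndependent F w ∧ ∀ i, ρ σ (w i) = ω • w i := by
  obtain ⟨r, u, n, κ, hr, hu, hn, -, hκ, i, q, hiq⟩ := h
  have hi : Function.Injective i := Function.LeftInverse.injective hiq
  have h0 : 0 < φ.natDegree := Nat.pos_of_ne_zero fun h => hφ (h ▸ dvd_zero p)
  have hr0 : 0 < r := by
    refine Nat.pos_of_ne_zero ?_
    rintro rfl
    rw [Nat.coprime_zero_left] at hr
    exact hp.out.one_lt.ne' hr
  have hrk : (r : k) ≠ 0 := natCast_ne_zero_of_coprime hr
  have hr0' : (0 : ℝ) < r := by exact_mod_cast hr0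
  have h0' : (0 : ℝ) < φ.natDegree := by exact_mod_cast h0
  let v : Fin n → F := fun _ => 1
  have hv : v ≠ 0 := fun h1 => one_ne_zero (congrFun h1 ⟨0, hn⟩)
  set A := twist (asChar ψ (rootSubgroup k u) (evalInv u φ) (evalInv_fixed u φ)) (toRep κ) with hA
  have hact : ∀ σ ∈ wildInertia k p, ∀ g hfix,
      ρ σ (i (coindSingle A g v)) =
        ψ (cocycle p (evalInv u φ) (g * σ * g⁻¹) hfix) • i (coindSingle A g v) := by
    intro σ hσ g hfix
    have h1 := congrArg i (elementary_coindSingle (ψ := ψ) hr hu hκ hσ g hfix v)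
    rw [i.isIntertwining, map_smul] at h1
    exact h1
  have hfix : ∀ σ ∈ wildInertia k p, σ (evalInv u φ) = evalInv u φ := fun σ hσ =>
    evalInv_fixed u φ σ (wildInertia_le_rootSubgroup hr hu hσ)
  have hconj : ∀ σ ∈ wildInertia k p, ∀ g, g * σ * g⁻¹ ∈ wildInertia k p := fun σ hσ g =>
    wildInertia_normal.conj_mem σ hσ g
  obtain ⟨σ, hσ, -, hσy⟩ := exists_mem_upperRam_asRoot_ne hr hu hφ (asRoot_spec p _) hr0
  have hσP : σ ∈ wildInertia k p := upperRam_subset_wildInertia (by positivity) hσ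
  set ω := ψ (cocycle p (evalInv u φ) σ (hfix σ hσP)) with hω
  have hω1 : ω ≠ 1 := by
    refine addChar_ne_one hψ fun hc => hσy ?_
    have h1 := cocycle_spec p (evalInv u φ) σ (hfix σ hσP)
    rw [hc, map_zero] at h1
    exact (sub_eq_zero.1 h1.symm)
  have hone : ∀ τ ∈ wildInertia k p, ∀ hτ : τ (evalInv u φ) = evalInv u φ,
      ρ τ (i (coindSingle A 1 v)) =
        ψ (cocycle p (evalInv u φ) τ hτ) • i (coindSingle A 1 v) := by
    intro τ hτP hτ
    have h1 := hact τ hτP 1 (by simpa using hτ)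
    simpa using h1
  -- The function supported on the identity coset is a witness: groups beyond h/r fix the
  -- Artin-Schreier root and thus this vector, while σ multiplies it by ω ≠ 1.
  have hslope : IsSlope p ρ (φ.natDegree / r : ℝ) := by
    refine Or.inr ⟨by positivity, i (coindSingle A 1 v), ?_, σ, hσ, ?_⟩
    · intro x hx τ hτ
      have hx0 : 0 < x := lt_trans (by positivity) hx
      have hτP : τ ∈ wildInertia k p := upperRam_subset_wildInertia hx0 hτ
      rw [div_lt_iff₀ hr0'] at hx
      have h1 := asRoot_fixed_of_lt hr hu hφ (asRoot_spec p _) hx0 hx hτ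
      have h2 : cocycle p (evalInv u φ) τ (hfix τ hτP) = 0 := by
        apply (algebraMap (ZMod p) (AlgebraicClosure (LaurentSeries k))).injective
        rw [cocycle_spec, h1, sub_self, map_zero]
      rw [hone τ hτP (hfix τ hτP), h2, AddChar.map_zero_eq_one, one_smul]
    · rw [hone σ hσP (hfix σ hσP), ← hω]
      intro h1
      have h2 : (ω - 1) • i (coindSingle A 1 v) = 0 := by rw [sub_smul, h1, one_smul, sub_self]
      rcases smul_eq_zero.1 h2 with h3 | h3
      · exact hω1 (sub_eq_zero.1 h3)
      · rw [← map_zero i] at h3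
        have h4 := congrArg (fun f => f.1 1) (hi h3)
        exact hv ((coindSingle_self A 1 v).symm.trans h4)
  obtain ⟨d, hd0, hd⟩ := hρ _ hslope (by positivity)
  have hd0' : (0 : ℝ) < d := by exact_mod_cast hd0
  have hrd : r = d * φ.natDegree := by
    rw [div_eq_div_iff hr0'.ne' hd0'.ne', one_mul] at hd
    have h1 : φ.natDegree * d = r := by exact_mod_cast hd
    rw [← h1, mul_comm]
  have : NeZero (r : k) := ⟨hrk⟩
  -- The r powers of ζ give representatives of different cosets of I(r), hence r independent
  -- vectors. This yields h ≤ r ≤ dim V < p, the bound needed for `cocycle_conj`.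
  obtain ⟨ζ, hζ⟩ := HasEnoughRootsOfUnity.exists_primitiveRoot k r
  have hg : ∀ j : Fin r, ∃ g : Inertia k, g u = constCl k (ζ ^ (j : ℕ)) * u := fun j =>
    exists_apply_eq_mul hrk hr0 hu (by rw [← pow_mul, mul_comm, pow_mul, hζ.pow_eq_one, one_pow])
  choose g hg using hg
  have hu0 := ne_zero_of_pow_eq_unifCl hr0 hu
  have hli : LinearIndependent F fun j => i (coindSingle A (g j) v) := by
    refine (linearIndependent_coindSingle A hv fun j j' hjj hmem => hjj ?_).map'
      i.toLinearMap (LinearMap.ker_eq_bot.2 hi)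
    have h1 : g j ((g j')⁻¹ u) = u := mem_rootSubgroup_iff.1 hmem
    have h2 : g j u = g j' u := by
      have h3 := congrArg (⇑(g j * (g j')⁻¹)) (hg j')
      rw [map_mul, apply_constCl, AlgEquiv.mul_apply, AlgEquiv.mul_apply, h1,
        ← AlgEquiv.mul_apply (g j')⁻¹, inv_mul_cancel, AlgEquiv.one_apply, ← hg] at h3
      exact h3
    rw [hg, hg] at h2
    have h3 := (constCl k).injective (mul_right_cancel₀ hu0 h2)
    exact Fin.ext (hζ.pow_inj j.2 j'.2 h3)
  have hrV : r ≤ Module.finrank F V := by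
    have h1 := hli.fintype_card_le_finrank
    rwa [Fintype.card_fin] at h1
  have hhr : φ.natDegree ≤ r := by
    rw [hrd]
    exact Nat.le_mul_of_pos_left _ hd0
  -- Since r = dh, the powers ζ^(dm) with m < h are h-th roots of unity; on their cosets σ has the
  -- same eigenvalue ω.
  refine ⟨σ, ω, hω1, addChar_pow_card _ _, fun m => i (coindSingle A (g ⟨d * m, ?_⟩) v), ?_, ?_⟩
  · rw [hrd]
    exact Nat.mul_lt_mul_of_pos_left m.2 hd0
  · refine hli.comp _ fun m m' hmm => ?_
    have h1 := congrArg Fin.val hmm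
    exact Fin.ext (Nat.eq_of_mul_eq_mul_left hd0 h1)
  · intro m
    rw [hact σ hσP _ (hfix _ (hconj σ hσP _)), hω]
    congr 2
    refine cocycle_conj hr hr0 hu h0 (by omega) ?_ (hg _) hσ _ _
    rw [← pow_mul, mul_right_comm, ← hrd, pow_mul, hζ.pow_eq_one, one_pow]

end Elementary

/-! ### Eigenvalue multiplicities of automorphisms of the cross product -/

section OctCross

variable {F : Type*} [Field F]

theorem octCross_add_left (x y z : Fin 7 → F) :
    octCross (x + y) z = octCross x z + octCross y z := by
  funext m
  simp only [octCross, Pi.add_apply]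
  ring

theorem octCross_add_right (x y z : Fin 7 → F) :
    octCross x (y + z) = octCross x y + octCross x z := by
  funext m
  simp only [octCross, Pi.add_apply]
  ring

theorem octCross_smul_left (c : F) (x y : Fin 7 → F) :
    octCross (c • x) y = c • octCross x y := by
  funext m
  simp only [octCross, Pi.smul_apply, smul_eq_mul]
  ring

theorem octCross_smul_right (c : F) (x y : Fin 7 → F) :
    octCross x (c • y) = c • octCross x y := by
  funext m
  simp only [octCross, Pi.smul_apply, smul_eq_mul]
  ring

/-- The polarization of `octCross_octCross`. -/
theorem octCross_octCross_add (w x y : Fin 7 → F) :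
    octCross w (octCross x y) + octCross x (octCross w y) =
      (w ⬝ᵥ y) • x + (x ⬝ᵥ y) • w - (2 * (w ⬝ᵥ x)) • y := by
  have h := octCross_octCross (w + x) y
  rw [octCross_add_left, octCross_add_left, octCross_add_right, octCross_add_right,
    octCross_octCross, octCross_octCross, add_dotProduct, add_dotProduct, dotProduct_add,
    dotProduct_add, dotProduct_comm x w] at h
  have h1 : octCross w (octCross x y) + octCross x (octCross w y) =
      ((w ⬝ᵥ y + x ⬝ᵥ y) • (w + x) -
        (w ⬝ᵥ w + w ⬝ᵥ x + (w ⬝ᵥ x + x ⬝ᵥ x)) • y) -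
      ((w ⬝ᵥ y) • w - (w ⬝ᵥ w) • y) - ((x ⬝ᵥ y) • x - (x ⬝ᵥ x) • y) := by
    rw [← h]
    abel
  rw [h1]
  module

variable {T : Module.End F (Fin 7 → F)}

/-- Applying T to the identity for x × (x × y) gives (Tx·Tx - x·x)Ty as a multiple of Tx. If the
factor were non-zero, every y would be a multiple of x, impossible in dimension 7. -/
theorem dotProduct_self_of_octCross (hT : ∀ x y, T (octCross x y) = octCross (T x) (T y))
    (hinj : Function.Injective T) (x : Fin 7 → F) : T x ⬝ᵥ T x = x ⬝ᵥ x := by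
  by_contra hne
  have h1 : ∀ y, ∃ c : F, c • x = y := by
    intro y
    have h2 := congrArg T (octCross_octCross x y)
    rw [hT, hT, octCross_octCross, map_sub, map_smul, map_smul] at h2
    have h3 : T y = ((T x ⬝ᵥ T x - x ⬝ᵥ x)⁻¹ * (T x ⬝ᵥ T y - x ⬝ᵥ y)) • T x := by
      rw [mul_smul, eq_inv_smul_iff₀ (sub_ne_zero.2 hne), sub_smul, sub_smul]
      linear_combination (exp := 1) -h2
    exact ⟨_, hinj (by rw [map_smul, h3])⟩
  have h2 := finrank_le_one x h1
  rw [Module.finrank_fin_fun] at h2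
  omega

theorem dotProduct_of_octCross (h2 : (2 : F) ≠ 0)
    (hT : ∀ x y, T (octCross x y) = octCross (T x) (T y))
    (hinj : Function.Injective T) (x y : Fin 7 → F) : T x ⬝ᵥ T y = x ⬝ᵥ y := by
  have h := dotProduct_self_of_octCross hT hinj (x + y)
  rw [map_add, add_dotProduct, add_dotProduct, dotProduct_add, dotProduct_add, dotProduct_add,
    dotProduct_add, dotProduct_self_of_octCross hT hinj, dotProduct_self_of_octCross hT hinj,
    dotProduct_comm (T y) (T x), dotProduct_comm y x] at h
  refine mul_left_cancel₀ h2 ?_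
  linear_combination h

/-- The standard symmetric bilinear form. -/
abbrev dotForm (F : Type*) [Field F] : LinearMap.BilinForm F (Fin 7 → F) := dotProductBilin F F

theorem dotForm_nondegenerate : (dotForm F).Nondegenerate :=
  ⟨fun x h => dotProduct_eq_zero x h,
    fun x h => dotProduct_eq_zero x fun y => by rw [dotProduct_comm]; exact h y⟩

/-- T is orthogonal, so the eigenspace of the inverse of μ is the orthogonal complement of the image
of T - μ, whose codimension is the dimension of the kernel. -/
theorem finrank_eigenspace_inv (h2 : (2 : F) ≠ 0)
    (hT : ∀ x y, T (octCross x y) = octCross (T x) (T y))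
    (hinj : Function.Injective T) {μ : F} (hμ : μ ≠ 0) :
    Module.finrank F (T.eigenspace μ⁻¹) = Module.finrank F (T.eigenspace μ) := by
  have h1 : T.eigenspace μ⁻¹ =
      (dotForm F).orthogonal (LinearMap.range (T - algebraMap F (Module.End F (Fin 7 → F)) μ)) := by
    have hsurj : Function.Surjective T := LinearMap.injective_iff_surjective.1 hinj
    ext x
    rw [Module.End.mem_eigenspace_iff, LinearMap.BilinForm.mem_orthogonal_iff]
    have hdot := dotProduct_of_octCross h2 hT hinj
    constructor
    · rintro hx _ ⟨y, rfl⟩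
      change (T y - μ • y) ⬝ᵥ x = 0
      have h3 := hdot y x
      rw [hx, dotProduct_smul, smul_eq_mul, inv_mul_eq_iff_eq_mul₀ hμ] at h3
      rw [sub_dotProduct, h3, smul_dotProduct, smul_eq_mul, sub_self]
    · intro hx
      rw [eq_inv_smul_iff₀ hμ, ← sub_eq_zero]
      refine dotProduct_eq_zero _ fun z => ?_
      obtain ⟨y, rfl⟩ := hsurj z
      have h3 : (T y - μ • y) ⬝ᵥ x = 0 := hx _ ⟨y, rfl⟩
      rw [sub_dotProduct, smul_dotProduct, smul_eq_mul, ← hdot y x] at h3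
      rw [dotProduct_comm, dotProduct_sub, dotProduct_smul, smul_eq_mul]
      linear_combination -h3
  have h3 := LinearMap.BilinForm.finrank_orthogonal dotForm_nondegenerate
    (LinearMap.range (T - algebraMap F (Module.End F (Fin 7 → F)) μ))
  have h4 := LinearMap.finrank_range_add_finrank_ker
    (T - algebraMap F (Module.End F (Fin 7 → F)) μ)
  rw [h1, h3, Module.End.eigenspace_def, ← Algebra.algebraMap_eq_smul_one]
  omega

theorem octCross_mem_eigenspace (hT : ∀ x y, T (octCross x y) = octCross (T x) (T y)) {μ ν : F}
    {x y : Fin 7 → F} (hx : x ∈ T.eigenspace μ) (hy : y ∈ T.eigenspace ν) :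
    octCross x y ∈ T.eigenspace (μ * ν) := by
  rw [Module.End.mem_eigenspace_iff] at hx hy ⊢
  rw [hT, hx, hy, octCross_smul_left, octCross_smul_right, smul_smul]

/-- An element of `G₂` has no eigenvalue of order larger than `4` with multiplicity `3`. -/
theorem finrank_eigenspace_lt_three (h2 : (2 : F) ≠ 0)
    (hT : ∀ x y, T (octCross x y) = octCross (T x) (T y)) (hinj : Function.Injective T)
    {ω : F} (hω0 : ω ≠ 0) (hω1 : ω ≠ 1) (hω2 : ω ^ 2 ≠ 1) (hω3 : ω ^ 3 ≠ 1) (hω4 : ω ^ 4 ≠ 1) :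
    Module.finrank F (T.eigenspace ω) < 3 := by
  by_contra! hA
  have hdot := dotProduct_of_octCross h2 hT hinj
  have hB : 3 ≤ Module.finrank F (T.eigenspace ω⁻¹) := by
    rwa [finrank_eigenspace_inv h2 hT hinj hω0]
  have hind := T.eigenspaces_iSupIndep
  have hωinv : ω ≠ ω⁻¹ := fun h => hω2 (by
    rw [pow_two]
    nth_rewrite 2 [h]
    exact mul_inv_cancel₀ hω0)
  set D := T.eigenspace ω ⊔ T.eigenspace ω⁻¹ with hD
  have hdisj : ∀ μ (s : Submodule F (Fin 7 → F)), s ≤ ⨆ j, ⨆ (_ : j ≠ μ), T.eigenspace j →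
      Module.finrank F (s ⊔ T.eigenspace μ : Submodule F _) =
        Module.finrank F s + Module.finrank F (T.eigenspace μ) := by
    intro μ s hs
    have h1 := Submodule.finrank_sup_add_finrank_inf_eq s (T.eigenspace μ)
    have h3 : s ⊓ T.eigenspace μ = ⊥ := (((hind μ).mono_right hs).symm).eq_bot
    rw [h3, finrank_bot, add_zero] at h1
    exact h1
  have hle : ∀ {μ ν : F}, ν ≠ μ → T.eigenspace ν ≤ ⨆ j, ⨆ (_ : j ≠ μ), T.eigenspace j :=
    fun {μ ν} h => le_iSup₂_of_le ν h le_rfl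
  have hDr : 6 ≤ Module.finrank F D := by
    rw [hD, hdisj ω⁻¹ _ (hle hωinv)]
    omega
  have hbound : ∀ s : Submodule F (Fin 7 → F), Module.finrank F s ≤ 7 := fun s => by
    have h1 := Submodule.finrank_le s
    rwa [Module.finrank_fin_fun] at h1
  have hE1 : Module.finrank F (T.eigenspace 1) ≤ 1 := by
    have h1 := hdisj 1 D (sup_le (hle hω1) (hle (inv_ne_one.2 hω1)))
    have h3 := hbound (D ⊔ T.eigenspace 1)
    omega
  -- The eigenvalues ω² and ω⁻² have equal multiplicity and differ from each other and from ω and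
  -- ω⁻¹, since ω, ω³, ω⁴ ≠ 1. Only 7 - 6 = 1 dimension is left for two spaces of equal dimension.
  have hE2 : T.eigenspace (ω * ω) = ⊥ := by
    rw [← Submodule.finrank_eq_zero]
    have h1 := hdisj (ω * ω) D (sup_le (hle fun h => hω1 (by simpa [hω0] using h))
      (hle fun h => hω3 (by
        have h3 := mul_inv_cancel₀ hω0
        rw [h] at h3
        rw [← h3]
        ring)))
    have h3 := hdisj (ω * ω)⁻¹ (D ⊔ T.eigenspace (ω * ω)) (sup_le (sup_le (hle fun h => hω3 (by
        have h3 := mul_inv_cancel₀ (mul_ne_zero hω0 hω0)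
        rw [← h] at h3
        rw [← h3]
        ring))
      (hle fun h => hω1 (by
        have h4 := inv_injective h
        simpa [hω0] using h4))) (hle fun h => hω4 (by
        have h3 := mul_inv_cancel₀ (mul_ne_zero hω0 hω0)
        rw [← h] at h3
        rw [← h3]
        ring)))
    have h4 := finrank_eigenspace_inv h2 hT hinj (mul_ne_zero hω0 hω0)
    have h5 := hbound (D ⊔ T.eigenspace (ω * ω) ⊔ T.eigenspace (ω * ω)⁻¹)
    omega
  have hAA : ∀ x ∈ T.eigenspace ω, ∀ y ∈ T.eigenspace ω, x ⬝ᵥ y = 0 := by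
    intro x hx y hy
    rw [Module.End.mem_eigenspace_iff] at hx hy
    have h1 := hdot x y
    rw [hx, hy, smul_dotProduct, dotProduct_smul, smul_eq_mul, smul_eq_mul] at h1
    have h3 : (ω ^ 2 - 1) * (x ⬝ᵥ y) = 0 := by linear_combination h1
    exact (mul_eq_zero.1 h3).resolve_left (sub_ne_zero.2 hω2)
  -- The eigenspace of ω is isotropic. If it were also orthogonal to that of ω⁻¹, a space of
  -- dimension 3 would lie in the complement of D, of dimension at most 1.
  obtain ⟨w, hw, w', hw', hww'⟩ : ∃ w ∈ T.eigenspace ω, ∃ w' ∈ T.eigenspace ω⁻¹,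
      w ⬝ᵥ w' ≠ 0 := by
    by_contra! hcon
    have h1 : T.eigenspace ω ≤ (dotForm F).orthogonal D := by
      intro x hx
      rw [LinearMap.BilinForm.mem_orthogonal_iff]
      intro y hy
      change y ⬝ᵥ x = 0
      obtain ⟨a, ha, b, hb, rfl⟩ := Submodule.mem_sup.1 hy
      rw [add_dotProduct, hAA a ha x hx, dotProduct_comm, hcon x hx b hb, add_zero]
    have h3 := LinearMap.BilinForm.finrank_orthogonal dotForm_nondegenerate D
    have h4 := Submodule.finrank_mono h1
    rw [Module.finrank_fin_fun] at h3
    omega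
  obtain ⟨z, hz, hz0, hzw'⟩ : ∃ z ∈ T.eigenspace ω, z ≠ 0 ∧ w' ⬝ᵥ z = 0 := by
    let f : T.eigenspace ω →ₗ[F] F := (dotForm F w').domRestrict _
    have h1 := LinearMap.finrank_range_add_finrank_ker f
    have h3 : Module.finrank F (LinearMap.range f) ≤ 1 := by
      have := Submodule.finrank_le (LinearMap.range f)
      rwa [Module.finrank_self] at this
    have h4 : LinearMap.ker f ≠ ⊥ := by
      intro h
      rw [h, finrank_bot] at h1
      omega
    obtain ⟨z, hz, hz0⟩ := Submodule.exists_mem_ne_zero_of_ne_bot h4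
    exact ⟨z, z.2, fun h => hz0 (Subtype.ext h), hz⟩
  have hwz : octCross w z = 0 := by
    have h1 := octCross_mem_eigenspace hT hw hz
    rwa [hE2, Submodule.mem_bot] at h1
  have hq : octCross w' z ∈ T.eigenspace 1 := by
    have h1 := octCross_mem_eigenspace hT hw' hz
    rwa [inv_mul_cancel₀ hω0] at h1
  have hq' : octCross w w' ∈ T.eigenspace 1 := by
    have h1 := octCross_mem_eigenspace hT hw hw'
    rwa [mul_inv_cancel₀ hω0] at h1
  have hw0 : w ≠ 0 := by
    rintro rfl
    simp at hww'
  have hwww' : octCross w (octCross w w') = (w ⬝ᵥ w') • w := by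
    rw [octCross_octCross, hAA w hw w hw, zero_smul, sub_zero]
  have hne : octCross w w' ≠ 0 := by
    intro h
    have h1 := octCross_smul_right (0 : F) w 0
    rw [h] at hwww'
    rw [zero_smul, zero_smul] at h1
    rw [h1] at hwww'
    exact (smul_ne_zero hww' hw0) hwww'.symm
  -- Both products are fixed by T, the fixed space is at most a line, and w × w' is not 0.
  obtain ⟨c, hc⟩ : ∃ c : F, c • octCross w w' = octCross w' z := by
    have h1 := finrank_le_one_iff.1 hE1
    obtain ⟨v, hv⟩ := h1
    obtain ⟨a, ha⟩ := hv ⟨_, hq'⟩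
    obtain ⟨b, hb⟩ := hv ⟨_, hq⟩
    have ha' : a • (v : Fin 7 → F) = octCross w w' := congrArg Subtype.val ha
    have hb' : b • (v : Fin 7 → F) = octCross w' z := congrArg Subtype.val hb
    have ha0 : a ≠ 0 := by
      rintro rfl
      rw [zero_smul] at ha'
      exact hne ha'.symm
    refine ⟨b * a⁻¹, ?_⟩
    rw [← ha', ← hb', smul_smul, mul_assoc, inv_mul_cancel₀ ha0, mul_one]
  -- As w × z = 0 and z is orthogonal to w and w', the identity reduces to c(w·w')w = -2(w·w')z.
  -- Pairing with w' gives c = 0, and then z = 0.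
  have hid := octCross_octCross_add w w' z
  have h0 : octCross w' (0 : Fin 7 → F) = 0 := by
    have h1 := octCross_smul_right (0 : F) w' 0
    rwa [zero_smul, zero_smul] at h1
  rw [hwz, h0, add_zero, ← hc, octCross_smul_right, hwww', hAA w hw z hz, hzw', zero_smul,
    zero_smul, zero_add, zero_sub] at hid
  have hd := congrArg (· ⬝ᵥ w') hid
  simp only [smul_dotProduct, neg_dotProduct, dotProduct_comm z, hzw', smul_eq_mul, mul_zero,
    neg_zero] at hd
  have hc0 : c = 0 := (mul_eq_zero.1 hd).resolve_right (mul_ne_zero hww' hww')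
  rw [hc0, zero_smul, eq_comm, neg_eq_zero] at hid
  exact smul_ne_zero (mul_ne_zero h2 hww') hz0 hid

end OctCross

/-! ### From G₂ to the image of the monodromy representation -/

theorem subset_zariskiClosure {F : Type*} [Field F] {n : ℕ} (H : Set (GL (Fin n) F)) :
    H ⊆ zariskiClosure H :=
  fun _ hg _ hf => hf _ hg

/-- A matrix conjugate to an element of `G₂` has no eigenvalue of prime order `p > 4` with
multiplicity at least `3`. -/
theorem lt_three_of_conj_mem_G2 {F : Type*} [Field F] (h2 : (2 : F) ≠ 0)
    {b g : GL (Fin 7) F} (hg : b⁻¹ * g * b ∈ G2 F) {p : ℕ} (hp : p.Prime) (hp4 : 4 < p) {ω : F}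
    (hω1 : ω ≠ 1) (hωp : ω ^ p = 1) {m : ℕ} {w : Fin m → Fin 7 → F} (hw : LinearIndependent F w)
    (hgw : ∀ i, (g : Matrix (Fin 7) (Fin 7) F).mulVec (w i) = ω • w i) : m < 3 := by
  let T : Module.End F (Fin 7 → F) :=
    Matrix.mulVecLin ((b⁻¹ * g * b : GL (Fin 7) F) : Matrix (Fin 7) (Fin 7) F)
  have hT : ∀ x y, T (octCross x y) = octCross (T x) (T y) := hg
  have hinj : ∀ a : GL (Fin 7) F, Function.Injective (a : Matrix (Fin 7) (Fin 7) F).mulVec := by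
    intro a
    exact Matrix.mulVec_injective_of_isUnit a.isUnit
  have : Fact p.Prime := ⟨hp⟩
  have hω : orderOf ω = p := orderOf_eq_prime hωp hω1
  have hωn : ∀ n, 0 < n → n ≤ 4 → ω ^ n ≠ 1 := by
    intro n hn hn4 h
    have h1 := Nat.le_of_dvd hn (orderOf_dvd_of_pow_eq_one h)
    omega
  have hω0 : ω ≠ 0 := by
    rintro rfl
    rw [zero_pow hp.ne_zero] at hωp
    exact zero_ne_one hωp
  have h3 := finrank_eigenspace_lt_three h2 hT (hinj (b⁻¹ * g * b)) hω0 hω1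
    (hωn 2 (by omega) (by omega)) (hωn 3 (by omega) (by omega)) (hωn 4 (by omega) le_rfl)
  let f : (Fin 7 → F) →ₗ[F] (Fin 7 → F) :=
    Matrix.mulVecLin ((b⁻¹ : GL (Fin 7) F) : Matrix (Fin 7) (Fin 7) F)
  -- Conjugation by b carries the eigenvectors of g to eigenvectors of an element of G₂ itself.
  have hli : LinearIndependent F (f ∘ w) := hw.map' f (LinearMap.ker_eq_bot.2 (hinj b⁻¹))
  have hmem : Submodule.span F (Set.range (f ∘ w)) ≤ T.eigenspace ω := by
    rw [Submodule.span_le]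
    rintro _ ⟨i, rfl⟩
    rw [SetLike.mem_coe, Module.End.mem_eigenspace_iff]
    change ((b⁻¹ * g * b : GL (Fin 7) F) : Matrix (Fin 7) (Fin 7) F).mulVec
      (((b⁻¹ : GL (Fin 7) F) : Matrix (Fin 7) (Fin 7) F).mulVec (w i)) =
      ω • ((b⁻¹ : GL (Fin 7) F) : Matrix (Fin 7) (Fin 7) F).mulVec (w i)
    rw [Matrix.mulVec_mulVec, ← Units.val_mul, mul_inv_cancel_right, Units.val_mul,
      ← Matrix.mulVec_mulVec, hgw, Matrix.mulVec_smul]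
  have h4 := Submodule.finrank_mono hmem
  rw [finrank_span_eq_card hli, Fintype.card_fin] at h4
  omega

end WildG2
end

theorem lemma4p4 {p ℓ : ℕ} [Fact p.Prime] [Fact ℓ.Prime] (hp : 7 < p) (hℓ : ℓ ≠ p)
    (k : Type*) [Field k] [Algebra (ZMod p) k] [IsAlgClosure (ZMod p) k]
    (ψ : AddChar (ZMod p) (PadicAlgCl ℓ)) (hψ : ψ ≠ 1)
    (S : Finset (OnePoint k)) (L : WildG2.LocalSystem k ℓ S 7)
    (hirr : L.rep.IsIrreducible) (hrig : L.IsRigid) (hG2 : L.HasMonodromyG2)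
    (hslopes : ∀ x ∈ S, ∀ y : ℝ, WildG2.IsSlope p (L.localMonodromy x) y → y ≠ 0 →
      ∃ d : ℕ, 0 < d ∧ y = 1 / (d : ℝ))
    (x : OnePoint k) (hx : x ∈ S)
    (φ : Polynomial k) (hφ₀ : φ.coeff 0 = 0) (hφp : ¬ p ∣ φ.natDegree)
    (hφ : WildG2.AppearsIn ψ φ (L.localMonodromy x)) :
    φ.natDegree = 1 ∨ φ.natDegree = 2 := by
  have : IsAlgClosed k := IsAlgClosure.isAlgClosed (ZMod p)
  obtain ⟨σ, ω, hω1, hωp, w, hw, hσw⟩ := hφ.exists_eigenvectors hψ hφp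
    (by rw [Module.finrank_fin_fun]; exact hp) (hslopes x hx)
  obtain ⟨b, hb⟩ := hG2
  have h1 := (hb _).1 (WildG2.subset_zariskiClosure _ ⟨WildG2.inertiaMap x σ, rfl⟩)
  have h2 : (2 : PadicAlgCl ℓ) ≠ 0 := by
    have : CharZero (PadicAlgCl ℓ) := inferInstance
    exact two_ne_zero
  have h3 := WildG2.lt_three_of_conj_mem_G2 h2 h1 Fact.out (by omega) hω1 hωp hw hσw
  -- Degree 0 is excluded because p divides 0.
  have h4 : φ.natDegree ≠ 0 := fun h => hφp (h ▸ dvd_zero p)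
  omega
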